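/- Let $\mathbb K\in\{\mathbb R,\mathbb C\}$; all locally convex spaces are Hausdorff. Let $\mathfrak g$ be a finite-dimensional semisimple (hence perfect) Lie algebra over $\mathbb K$, and let $\kappa_{\mathfrak g}\colon\mathfrak g\times\mathfrak g\to V_{\mathfrak g}$, $(x,y)\mapsto[x\vee y]$, be its universal continuous invariant symmetric bilinear form, where $V_{\mathfrak g}$ is the quotient of $S^2(\mathfrak g)$ by the closed span of the elements $[x,y]\vee z-x\vee[y,z]$. For a commutative associative locally convex algebra $A$ over $\mathbb K$ (with jointly continuous product) let $A_1=\mathbb K\times A$ be its unitalization, $d_{A_1}\colon A_1\to\Omega(A_1)$ the universal topological differential module of $A_1$ (universal among continuous derivations into complete locally convex $A_1$-modules), and $V_{\mathfrak g,A_1}=V_{\mathfrak g}\otimes\bigl(\Omega(A_1)/\overline{d_{A_1}(A_1)}\bigr)$. The Lie algebra $A\otimes\mathfrak g$ carries the bracket $[a\otimes x,b\otimes y]=ab\otimes[x,y]$; tensor products carry the projective topology. A continuous 2-cocycle $\omega$ on a locally convex Lie algebra $L$ with values in a locally convex space $V$ (a trivial module) is called a universal cocycle (for complete locally convex spaces)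 if (i) for every complete locally convex space $W$, the map $\operatorname{Lin}_{ct}(V,W)\to H^2_{ct}(L,W)$, $\theta\mapsto[\theta\circ\omega]$, is bijective; and (ii) for every locally convex Lie algebra $G$ and every surjective continuous Lie algebra homomorphism $q\colon G\to L$ that has a continuous linear section and a complete central kernel, there is a unique continuous Lie algebra homomorphism $\varphi\colon V\times_\omega L\to G$ with $q\circ\varphi=\mathrm{pr}_L$. Here $V\times_\omega L$ is $V\times L$ with the bracket $[(v,x),(w,y)]=(\omega(x,y),[x,y])$. **Theorem.** (a) Suppose that $A$ is the locally convex inductive limit of an increasing sequence of complete subalgebras $A_n\subseteq A$ ($n\in\mathbb N$), each with the subspace topology, such that for every $n$ there is an element $1_n\in A$ with $1_n\cdot a=a$ for all $a\in A_n$. Then the bilinear map $$\omega_{\mathfrak g,A}\colon (A\otimes\mathfrak g)\times(A\otimes\mathfrak g)\to V_{\mathfrak g,A_1},\qquad (a\otimes x,b\otimes y)\mapsto\kappa_{\mathfrak g}(x,y)\otimes[a\cdot d_{A_1}(b)]$$ is a universal cocycle for $A\otimes\mathfrak g$. (b) Let $M$ be a $\sigma$-compact finite-dimensional (Hausdorff)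 smooth manifold. Then $A=C_c^\infty(M,\mathbb K)$, with its usual inductive limit topology, is a Hausdorff locally convex algebra that satisfies the hypotheses of (a), and there is a universal cocycle $\omega$ for the Lie algebra $C_c^\infty(M,\mathfrak g)$ with values in $V_{\mathfrak g,A_1}$ such that $\omega(a x,b y)=\kappa_{\mathfrak g}(x,y)\otimes[a\cdot d_{A_1}(b)]$ for all $a,b\in C_c^\infty(M,\mathbb K)$ and $x,y\in\mathfrak g$. -/

import Mathlib

open scoped TensorProduct Topology Manifold UniformConvergence

universe w

noncomputable section

namespace CurrentLie

/-! ### Projective tensor products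

Locally convex spaces over `𝕜` (real or complex) are expressed by Mathlib's
`PolynormableSpace 𝕜 E`: the topology of `E` is the one defined by its continuous seminorms. -/

/-- The tensor product of two topological vector spaces, to be given the projective topology. -/
def ProjTensor (𝕜 E F : Type*) [RCLike 𝕜] [AddCommGroup E] [Module 𝕜 E] [AddCommGroup F]
    [Module 𝕜 F] : Type _ := E ⊗[𝕜] F

namespace ProjTensor

variable (𝕜 E F : Type*) [RCLike 𝕜] [AddCommGroup E] [Module 𝕜 E] [AddCommGroup F] [Module 𝕜 F]

instance : AddCommGroup (ProjTensor 𝕜 E F) := inferInstanceAs (AddCommGroup (E ⊗[𝕜] F))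

instance : Module 𝕜 (ProjTensor 𝕜 E F) := inferInstanceAs (Module 𝕜 (E ⊗[𝕜] F))

/-- The canonical bilinear map `(x, y) ↦ x ⊗ y`. -/
def mk : E →ₗ[𝕜] F →ₗ[𝕜] ProjTensor 𝕜 E F := TensorProduct.mk 𝕜 E F

variable [TopologicalSpace E] [TopologicalSpace F]

/-- The projective topology: the finest locally convex topology on `E ⊗ F` for which the
canonical bilinear map `E × F → E ⊗ F` is (jointly) continuous. -/
instance : TopologicalSpace (ProjTensor 𝕜 E F) :=
  sInf {t | PolynormableSpace 𝕜 (ProjTensor 𝕜 E F) (topology := t) ∧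
    Continuous[inferInstance, t] fun p : E × F => mk 𝕜 E F p.1 p.2}

instance : PolynormableSpace 𝕜 (ProjTensor 𝕜 E F) :=
  PolynormableSpace.sInf fun _ h => h.1

instance : IsTopologicalAddGroup (ProjTensor 𝕜 E F) :=
  (PolynormableSpace.withSeminorms 𝕜 (ProjTensor 𝕜 E F)).topologicalAddGroup

instance : ContinuousSMul 𝕜 (ProjTensor 𝕜 E F) :=
  (PolynormableSpace.withSeminorms 𝕜 (ProjTensor 𝕜 E F)).continuousSMul

end ProjTensor

/-! ### The current algebra `A ⊗ 𝔤` -/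

section Current

variable (𝕜 A 𝔤 : Type*) [RCLike 𝕜] [NonUnitalCommRing A] [Module 𝕜 A] [IsScalarTower 𝕜 A A]
  [SMulCommClass 𝕜 A A] [LieRing 𝔤] [LieAlgebra 𝕜 𝔤]

/-- The bilinear map on `A ⊗ 𝔤` with `(a ⊗ x, b ⊗ y) ↦ ab ⊗ [x, y]`. -/
def currentBracket :
    ProjTensor 𝕜 A 𝔤 →ₗ[𝕜] ProjTensor 𝕜 A 𝔤 →ₗ[𝕜] ProjTensor 𝕜 A 𝔤 :=
  TensorProduct.map₂ (LinearMap.mul 𝕜 A) (LieModule.toEnd 𝕜 𝔤 𝔤 : 𝔤 →ₗ[𝕜] Module.End 𝕜 𝔤)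

variable {𝕜 A 𝔤}

lemma currentBracket_mk (a b : A) (x y : 𝔤) :
    currentBracket 𝕜 A 𝔤 (ProjTensor.mk 𝕜 A 𝔤 a x) (ProjTensor.mk 𝕜 A 𝔤 b y) =
      ProjTensor.mk 𝕜 A 𝔤 (a * b) ⁅x, y⁆ := rfl

lemma ProjTensor.ind {E F : Type*} [AddCommGroup E] [Module 𝕜 E] [AddCommGroup F] [Module 𝕜 F]
    {P : ProjTensor 𝕜 E F → Prop} (h0 : P 0) (hmk : ∀ x y, P (ProjTensor.mk 𝕜 E F x y))
    (hadd : ∀ u v, P u → P v → P (u + v)) (z : ProjTensor 𝕜 E F) : P z :=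
  TensorProduct.induction_on z h0 hmk hadd

lemma currentBracket_skew (u v : ProjTensor 𝕜 A 𝔤) :
    currentBracket 𝕜 A 𝔤 u v + currentBracket 𝕜 A 𝔤 v u = 0 := by
  induction u using ProjTensor.ind with
  | h0 => simp
  | hmk a x =>
    induction v using ProjTensor.ind with
    | h0 => simp
    | hmk b y =>
      rw [currentBracket_mk, currentBracket_mk, mul_comm b a, ← map_add, ← lie_skew x y,
        neg_add_cancel, map_zero]
    | hadd v w hv hw =>
      simp only [map_add, LinearMap.add_apply]
      rw [add_add_add_comm, hv, hw, add_zero]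
  | hadd u w hu hw =>
    simp only [map_add, LinearMap.add_apply]
    rw [add_add_add_comm, hu, hw, add_zero]

lemma currentBracket_self (u : ProjTensor 𝕜 A 𝔤) : currentBracket 𝕜 A 𝔤 u u = 0 := by
  have h := currentBracket_skew u u
  rw [← two_smul 𝕜] at h
  exact (smul_eq_zero.mp h).resolve_left two_ne_zero

lemma currentBracket_leibniz (u v z : ProjTensor 𝕜 A 𝔤) :
    currentBracket 𝕜 A 𝔤 u (currentBracket 𝕜 A 𝔤 v z) =
      currentBracket 𝕜 A 𝔤 (currentBracket 𝕜 A 𝔤 u v) z +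
        currentBracket 𝕜 A 𝔤 v (currentBracket 𝕜 A 𝔤 u z) := by
  induction u using ProjTensor.ind with
  | h0 => simp
  | hadd u w hu hw => simp only [map_add, LinearMap.add_apply, hu, hw]; abel
  | hmk a x =>
    induction v using ProjTensor.ind with
    | h0 => simp
    | hadd v w hv hw => simp only [map_add, LinearMap.add_apply, hv, hw]; abel
    | hmk b y =>
      induction z using ProjTensor.ind with
      | h0 => simp
      | hadd v w hv hw => simp only [map_add, hv, hw]; abel
      | hmk c z =>
        simp only [currentBracket_mk]
        rw [mul_left_comm b a c, mul_assoc, leibniz_lie, map_add]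

variable (𝕜 A 𝔤)

/-- The Lie bracket `[a ⊗ x, b ⊗ y] = ab ⊗ [x, y]` on `A ⊗ 𝔤`. -/
instance : LieRing (ProjTensor 𝕜 A 𝔤) where
  bracket u v := currentBracket 𝕜 A 𝔤 u v
  add_lie u v z := by change currentBracket 𝕜 A 𝔤 (u + v) z = _; rw [map_add]; rfl
  lie_add u v z := map_add _ _ _
  lie_self u := currentBracket_self u
  leibniz_lie u v z := currentBracket_leibniz u v z

instance : LieAlgebra 𝕜 (ProjTensor 𝕜 A 𝔤) where
  lie_smul c u v := map_smul (currentBracket 𝕜 A 𝔤 u) c v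

end Current

/-! ### The universal continuous invariant symmetric bilinear form -/

section InvariantForm

variable (𝕜 𝔤 : Type*) [RCLike 𝕜] [LieRing 𝔤] [LieAlgebra 𝕜 𝔤] [TopologicalSpace 𝔤]

/-- The relations `x ⊗ y = y ⊗ x` and `[x, y] ⊗ z = x ⊗ [y, z]`. -/
def invariantRelations : Submodule 𝕜 (ProjTensor 𝕜 𝔤 𝔤) :=
  Submodule.span 𝕜
    ({u | ∃ x y : 𝔤, u = ProjTensor.mk 𝕜 𝔤 𝔤 x y - ProjTensor.mk 𝕜 𝔤 𝔤 y x} ∪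
      {u | ∃ x y z : 𝔤, u = ProjTensor.mk 𝕜 𝔤 𝔤 ⁅x, y⁆ z - ProjTensor.mk 𝕜 𝔤 𝔤 x ⁅y, z⁆})

/-- `V_𝔤`: the symmetric square of `𝔤` modulo the closed span of the elements
`[x, y] ∨ z - x ∨ [y, z]`. -/
abbrev InvariantSpace : Type _ :=
  ProjTensor 𝕜 𝔤 𝔤 ⧸ (invariantRelations 𝕜 𝔤).topologicalClosure

/-- `κ_𝔤 : 𝔤 × 𝔤 → V_𝔤`, `(x, y) ↦ [x ∨ y]`. -/
def kappa : 𝔤 →ₗ[𝕜] 𝔤 →ₗ[𝕜] InvariantSpace 𝕜 𝔤 :=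
  (ProjTensor.mk 𝕜 𝔤 𝔤).compr₂ (invariantRelations 𝕜 𝔤).topologicalClosure.mkQ

end InvariantForm

/-! ### The universal topological differential module -/

section Differentials

variable (𝕜 B : Type*) [RCLike 𝕜] [CommRing B] [Algebra 𝕜 B]

/-- The algebraic Kähler differentials of `B`, to be given a locally convex topology. -/
def TopKaehler : Type _ := Ω[B⁄𝕜]

namespace TopKaehler

instance : AddCommGroup (TopKaehler 𝕜 B) := inferInstanceAs (AddCommGroup Ω[B⁄𝕜])

instance : Module B (TopKaehler 𝕜 B) := inferInstanceAs (Module B Ω[B⁄𝕜])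

instance : Module 𝕜 (TopKaehler 𝕜 B) := inferInstanceAs (Module 𝕜 Ω[B⁄𝕜])

instance : IsScalarTower 𝕜 B (TopKaehler 𝕜 B) := inferInstanceAs (IsScalarTower 𝕜 B Ω[B⁄𝕜])

/-- The algebraic universal derivation. -/
def D : Derivation 𝕜 B (TopKaehler 𝕜 B) := KaehlerDifferential.D 𝕜 B

variable [TopologicalSpace B]

/-- The finest locally convex topology on the Kähler differentials for which the module action
`B × Ω → Ω` is (jointly) continuous and the derivation `D : B → Ω` is continuous. -/
instance : TopologicalSpace (TopKaehler 𝕜 B) :=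
  sInf {t | PolynormableSpace 𝕜 (TopKaehler 𝕜 B) (topology := t) ∧
    (@ContinuousSMul B (TopKaehler 𝕜 B) _ _ t) ∧ Continuous[inferInstance, t] (D 𝕜 B)}

instance : PolynormableSpace 𝕜 (TopKaehler 𝕜 B) :=
  PolynormableSpace.sInf fun _ h => h.1

instance : IsTopologicalAddGroup (TopKaehler 𝕜 B) :=
  (PolynormableSpace.withSeminorms 𝕜 (TopKaehler 𝕜 B)).topologicalAddGroup

instance : ContinuousSMul 𝕜 (TopKaehler 𝕜 B) :=
  (PolynormableSpace.withSeminorms 𝕜 (TopKaehler 𝕜 B)).continuousSMul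

instance : ContinuousSMul B (TopKaehler 𝕜 B) :=
  continuousSMul_sInf fun _ h => h.2.1

instance : UniformSpace (TopKaehler 𝕜 B) := IsTopologicalAddGroup.rightUniformSpace _

instance : IsUniformAddGroup (TopKaehler 𝕜 B) := isUniformAddGroup_of_addCommGroup

instance : UniformContinuousConstSMul 𝕜 (TopKaehler 𝕜 B) :=
  uniformContinuousConstSMul_of_continuousConstSMul _ _

instance : UniformContinuousConstSMul B (TopKaehler 𝕜 B) :=
  uniformContinuousConstSMul_of_continuousConstSMul _ _

lemma continuous_D : Continuous (D 𝕜 B) :=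
  continuous_sInf_rng.2 fun _ h => h.2.2

end TopKaehler

variable [TopologicalSpace B]

/-- The universal topological differential module `Ω(B)`: the Hausdorff completion of the
topologized Kähler differentials. -/
abbrev DiffModule : Type _ := UniformSpace.Completion (TopKaehler 𝕜 B)

/-- The universal continuous derivation `d_B : B → Ω(B)`. -/
def univD : B →ₗ[𝕜] DiffModule 𝕜 B where
  toFun b := (TopKaehler.D 𝕜 B b : TopKaehler 𝕜 B)
  map_add' x y := by rw [map_add, UniformSpace.Completion.coe_add]
  map_smul' c x := by rw [Derivation.map_smul, UniformSpace.Completion.coe_smul]; rfl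

/-- The pair `(Ω(B), d_B)` is the universal topological differential module of `B`: every continuous
derivation into a complete locally convex `B`-module factors uniquely through `d_B`. -/
theorem diffModule_universal {F : Type*} [AddCommGroup F] [Module 𝕜 F] [Module B F]
    [IsScalarTower 𝕜 B F] [UniformSpace F] [IsUniformAddGroup F] [PolynormableSpace 𝕜 F]
    [ContinuousSMul B F] [CompleteSpace F] [T2Space F] (T : Derivation 𝕜 B F)
    (hT : Continuous T) :
    ∃! φ : DiffModule 𝕜 B →L[B] F, ∀ b, φ (univD 𝕜 B b) = T b := by
  let f : TopKaehler 𝕜 B →ₗ[B] F := T.liftKaehlerDifferential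
  have hfD : ∀ b, f (TopKaehler.D 𝕜 B b) = T b := T.liftKaehlerDifferential_comp_D
  have hf : Continuous f := by
    rw [continuous_iff_le_induced]
    refine sInf_le ⟨?_, ?_, ?_⟩
    · exact PolynormableSpace.induced (f.restrictScalars 𝕜)
    · exact continuousSMul_induced f
    · rw [continuous_induced_rng]
      exact hT.congr fun b => (hfD b).symm
  have hfu : UniformContinuous f := uniformContinuous_addMonoidHom_of_continuous (f := f) hf
  have hext : ∀ ω : TopKaehler 𝕜 B, UniformSpace.Completion.extension f ω = f ω :=
    UniformSpace.Completion.extension_coe hfu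
  have hc : Continuous (UniformSpace.Completion.extension f) :=
    UniformSpace.Completion.continuous_extension
  let φ : DiffModule 𝕜 B →L[B] F :=
    { toFun := UniformSpace.Completion.extension f
      map_add' := fun u v => by
        induction u, v using UniformSpace.Completion.induction_on₂ with
        | hp => exact isClosed_eq (by fun_prop) (by fun_prop)
        | ih u v => rw [← UniformSpace.Completion.coe_add, hext, hext, hext, map_add]
      map_smul' := fun c u => by
        induction u using UniformSpace.Completion.induction_on with
        | hp => exact isClosed_eq (hc.comp (continuous_const_smul c)) (hc.const_smul c)
        | ih u => rw [← UniformSpace.Completion.coe_smul, hext, hext, map_smul]; rfl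
      cont := hc }
  refine ⟨φ, fun b => (hext _).trans (hfD b), fun ψ hψ => ?_⟩
  ext u
  induction u using UniformSpace.Completion.induction_on with
  | hp => exact isClosed_eq ψ.continuous φ.continuous
  | ih u =>
    let g : TopKaehler 𝕜 B →ₗ[B] F :=
      { toFun := fun u => ψ u
        map_add' := fun u v => by rw [UniformSpace.Completion.coe_add, map_add]
        map_smul' := fun c u => by rw [UniformSpace.Completion.coe_smul, map_smul]; rfl }
    have hg : g = f := by
      refine Derivation.liftKaehlerDifferential_unique (R := 𝕜) (S := B) (M := F) g f ?_
      ext b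
      exact (hψ b).trans (hfD b).symm
    exact (DFunLike.congr_fun hg u).trans (hext u).symm

/-- The closure of `d_B(B)` in `Ω(B)`. -/
def exactForms : Submodule 𝕜 (DiffModule 𝕜 B) :=
  (LinearMap.range (univD 𝕜 B)).topologicalClosure

/-- The quotient `Ω(B) / closure (d_B(B))`. -/
abbrev DiffQuotient : Type _ := DiffModule 𝕜 B ⧸ exactForms 𝕜 B

/-- The bilinear map `B × B → Ω(B) / closure (d_B(B))`, `(a, b) ↦ [a · d_B(b)]`. -/
def adb : B →ₗ[𝕜] B →ₗ[𝕜] DiffQuotient 𝕜 B :=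
  LinearMap.mk₂ 𝕜 (fun a b => (exactForms 𝕜 B).mkQ (a • univD 𝕜 B b))
    (fun a a' b => by rw [add_smul, map_add])
    (fun c a b => by rw [smul_assoc c a (univD 𝕜 B b), map_smul])
    (fun a b b' => by rw [map_add, smul_add, map_add])
    (fun c a b => by
      rw [(univD 𝕜 B).map_smul, smul_algebra_smul_comm c a (univD 𝕜 B b), map_smul])

end Differentials

/-! ### Unitalization and Maier's cocycle -/

section Maier

variable (𝕜 A 𝔤 : Type*) [RCLike 𝕜] [NonUnitalCommRing A] [Module 𝕜 A] [IsScalarTower 𝕜 A A]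
  [SMulCommClass 𝕜 A A]

/-- The unitalization `A₁ = 𝕜 × A` of `A`, to be given the product topology. -/
def TopUnitization : Type _ := Unitization 𝕜 A

instance : CommRing (TopUnitization 𝕜 A) := inferInstanceAs (CommRing (Unitization 𝕜 A))

instance : Algebra 𝕜 (TopUnitization 𝕜 A) := inferInstanceAs (Algebra 𝕜 (Unitization 𝕜 A))

/-- The inclusion `A → A₁`, `a ↦ (0, a)`. -/
def toUnitization : A →ₗ[𝕜] TopUnitization 𝕜 A := Unitization.inrHom 𝕜 𝕜 A

variable [TopologicalSpace A]

instance : TopologicalSpace (TopUnitization 𝕜 A) :=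
  TopologicalSpace.induced (fun u : Unitization 𝕜 A => (u.fst, u.snd)) inferInstance

variable [LieRing 𝔤] [LieAlgebra 𝕜 𝔤] [TopologicalSpace 𝔤]

/-- The space `V_{𝔤,A₁} = V_𝔤 ⊗ (Ω(A₁) / closure (d(A₁)))`. -/
abbrev MaierSpace : Type _ :=
  ProjTensor 𝕜 (InvariantSpace 𝕜 𝔤) (DiffQuotient 𝕜 (TopUnitization 𝕜 A))

/-- The element `κ_𝔤(x, y) ⊗ [a · d_{A₁}(b)]` of `V_{𝔤,A₁}`. -/
def maierValue (a b : A) (x y : 𝔤) : MaierSpace 𝕜 A 𝔤 :=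
  ProjTensor.mk 𝕜 _ _ (kappa 𝕜 𝔤 x y)
    (adb 𝕜 (TopUnitization 𝕜 A) (toUnitization 𝕜 A a) (toUnitization 𝕜 A b))

/-- The bilinear map `ω_{𝔤,A}` on `A ⊗ 𝔤` with
`(a ⊗ x, b ⊗ y) ↦ κ_𝔤(x, y) ⊗ [a · d_{A₁}(b)]`. -/
def maierCocycle : ProjTensor 𝕜 A 𝔤 →ₗ[𝕜] ProjTensor 𝕜 A 𝔤 →ₗ[𝕜] MaierSpace 𝕜 A 𝔤 :=
  (TensorProduct.map₂
    ((adb 𝕜 (TopUnitization 𝕜 A)).compl₁₂ (toUnitization 𝕜 A) (toUnitization 𝕜 A))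
    (kappa 𝕜 𝔤)).compr₂ (TensorProduct.comm 𝕜 _ _).toLinearMap

theorem maierCocycle_mk (a b : A) (x y : 𝔤) :
    maierCocycle 𝕜 A 𝔤 (ProjTensor.mk 𝕜 A 𝔤 a x) (ProjTensor.mk 𝕜 A 𝔤 b y) =
      maierValue 𝕜 A 𝔤 a b x y := rfl

end Maier

/-! ### Continuous second cohomology with trivial coefficients and universality -/

section Cohomology

variable (𝕜 L V W : Type*) [RCLike 𝕜] [LieRing L] [LieAlgebra 𝕜 L] [TopologicalSpace L]
  [AddCommGroup V] [Module 𝕜 V] [TopologicalSpace V] [IsTopologicalAddGroup V] [ContinuousSMul 𝕜 V]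
  [AddCommGroup W] [Module 𝕜 W] [TopologicalSpace W] [IsTopologicalAddGroup W] [ContinuousSMul 𝕜 W]

/-- `Z²_ct(L, V)`: the continuous alternating bilinear maps that satisfy the cocycle identity for
the trivial action of `L` on `V`. -/
def contCocycles : Submodule 𝕜 (L →ₗ[𝕜] L →ₗ[𝕜] V) where
  carrier := {ω | (∀ x, ω x x = 0) ∧ (∀ x y z, ω ⁅x, y⁆ z + ω ⁅y, z⁆ x + ω ⁅z, x⁆ y = 0) ∧
    Continuous fun p : L × L => ω p.1 p.2}
  zero_mem' := ⟨fun _ => rfl, fun _ _ _ => by simp, continuous_const⟩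
  add_mem' {ω η} hω hη := by
    refine ⟨fun x => ?_, fun x y z => ?_, hω.2.2.add hη.2.2⟩
    · simp only [LinearMap.add_apply, hω.1, hη.1, add_zero]
    · simp only [LinearMap.add_apply]
      rw [add_add_add_comm (ω ⁅x, y⁆ z), add_add_add_comm (ω ⁅x, y⁆ z + _), hω.2.1, hη.2.1, add_zero]
  smul_mem' c ω hω := by
    refine ⟨fun x => ?_, fun x y z => ?_, hω.2.2.const_smul c⟩
    · simp only [LinearMap.smul_apply, hω.1, smul_zero]
    · simp only [LinearMap.smul_apply]
      rw [← smul_add, ← smul_add, hω.2.1, smul_zero]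

/-- `B²_ct(L, V)`, as a subspace of `Z²_ct(L, V)`: the cocycles of the form `ℓ ∘ [·, ·]` with a
continuous linear map `ℓ : L → V`. -/
def contCoboundaries : Submodule 𝕜 (contCocycles 𝕜 L V) where
  carrier := {ω | ∃ ℓ : L →L[𝕜] V, ∀ x y, ω.1 x y = ℓ ⁅x, y⁆}
  zero_mem' := ⟨0, fun _ _ => rfl⟩
  add_mem' := by
    rintro ω η ⟨ℓ, hℓ⟩ ⟨m, hm⟩
    refine ⟨ℓ + m, fun x y => ?_⟩
    change ω.1 x y + η.1 x y = ℓ _ + m _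
    rw [hℓ, hm]
  smul_mem' := by
    rintro c ω ⟨ℓ, hℓ⟩
    refine ⟨c • ℓ, fun x y => ?_⟩
    change c • ω.1 x y = c • ℓ _
    rw [hℓ]

/-- `H²_ct(L, V) = Z²_ct(L, V) / B²_ct(L, V)`. -/
abbrev ContH2 : Type _ := contCocycles 𝕜 L V ⧸ (contCoboundaries 𝕜 L V).toAddSubgroup

variable {𝕜 L V}

/-- The cocycle `θ ∘ ω`, for a cocycle `ω` and a continuous linear map `θ`. -/
def pushCocycle {W : Type*} [AddCommGroup W] [Module 𝕜 W] [TopologicalSpace W]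
    [IsTopologicalAddGroup W] [ContinuousSMul 𝕜 W] (ω : contCocycles 𝕜 L V) (θ : V →L[𝕜] W) :
    contCocycles 𝕜 L W :=
  ⟨ω.1.compr₂ θ.toLinearMap, fun x => by
      change θ (ω.1 x x) = 0
      rw [ω.2.1, map_zero], fun x y z => by
      change θ _ + θ _ + θ _ = 0
      rw [← map_add, ← map_add, ω.2.2.1, map_zero],
    θ.continuous.comp ω.2.2.2⟩

/-- `δ_W : Lin_ct(V, W) → H²_ct(L, W)`, `θ ↦ [θ ∘ ω]`. -/
def deltaMap (ω : contCocycles 𝕜 L V) (θ : V →L[𝕜] W) : ContH2 𝕜 L W :=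
  QuotientAddGroup.mk (pushCocycle ω θ)

/-- A continuous cocycle `ω` is weakly universal for complete locally convex spaces if `δ_W` is
bijective for every complete (Hausdorff) locally convex space `W`, viewed as a trivial module. -/
def IsWeaklyUniversal (ω : contCocycles 𝕜 L V) : Prop :=
  ∀ (W : Type w) [AddCommGroup W] [Module 𝕜 W] [UniformSpace W] [IsUniformAddGroup W]
    [ContinuousSMul 𝕜 W] [PolynormableSpace 𝕜 W] [T2Space W] [CompleteSpace W],
    Function.Bijective (deltaMap W ω)

/-- A continuous cocycle `ω` is universal, in the classical sense, for complete locally convex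
spaces if the central extension `V ×_ω L` of `L`, that is `V × L` with the bracket
`[(v, x), (w, y)] = (ω(x, y), [x, y])`, is universal: for every locally convex Lie algebra `G` with
a continuous surjective homomorphism `q : G → L` that has a continuous linear section and a
complete central kernel, there is exactly one continuous Lie algebra homomorphism
`φ : V ×_ω L → G` over `L`. -/
def IsClassicallyUniversal (ω : contCocycles 𝕜 L V) : Prop :=
  ∀ (G : Type w) [LieRing G] [LieAlgebra 𝕜 G] [UniformSpace G] [IsUniformAddGroup G]
    [ContinuousSMul 𝕜 G] [PolynormableSpace 𝕜 G] [T2Space G],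
    (Continuous fun p : G × G => ⁅p.1, p.2⁆) →
    ∀ q : G →ₗ⁅𝕜⁆ L, Continuous q →
    (∃ σ : L →L[𝕜] G, ∀ x, q (σ x) = x) →
    (∀ z : G, q z = 0 → ∀ g : G, ⁅z, g⁆ = 0) →
    IsComplete {z : G | q z = 0} →
    ∃! φ : V × L →L[𝕜] G,
      (∀ s t : V × L, φ (ω.1 s.2 t.2, ⁅s.2, t.2⁆) = ⁅φ s, φ t⁆) ∧ ∀ s, q (φ s) = s.2

/-- A bilinear map is a universal cocycle for `L` (for complete locally convex spaces) if it is a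
continuous cocycle that is universal both in the weak and in the classical sense. -/
def IsUniversalCocycle (ω : L →ₗ[𝕜] L →ₗ[𝕜] V) : Prop :=
  ∃ hω : ω ∈ contCocycles 𝕜 L V,
    IsWeaklyUniversal.{w} (⟨ω, hω⟩ : contCocycles 𝕜 L V) ∧
      IsClassicallyUniversal.{w} (⟨ω, hω⟩ : contCocycles 𝕜 L V)

end Cohomology

/-! ### Inductive limits of complete subalgebras with local units -/

/-- `A` is the locally convex inductive limit of an increasing sequence of complete subalgebras
`A_n`, for each of which there is an element `1_n` of `A` with `1_n · a = a` for all `a ∈ A_n`.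
The limit topology is expressed by seminorms: a seminorm on `A` is continuous as soon as its
restrictions to all the `A_n` (with the subspace topologies) are. -/
def IsLimitOfUnitalSubalgebras (𝕜 A : Type*) [RCLike 𝕜] [NonUnitalCommRing A] [Module 𝕜 A]
    [IsScalarTower 𝕜 A A] [SMulCommClass 𝕜 A A] [TopologicalSpace A]
    [IsTopologicalAddGroup A] : Prop :=
  ∃ S : ℕ → NonUnitalSubalgebra 𝕜 A,
    Monotone S ∧ (∀ a : A, ∃ n, a ∈ S n) ∧
    (∀ n, letI := IsTopologicalAddGroup.rightUniformSpace A; IsComplete (S n : Set A)) ∧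
    (∀ n, ∃ e : A, ∀ a ∈ S n, e * a = a) ∧
    ∀ p : Seminorm 𝕜 A, (∀ n, Continuous fun a : S n => p a) → Continuous p

/-! ### Compactly supported smooth functions -/

section Smooth

variable (𝕜 E M F : Type*) [RCLike 𝕜] [NormedAddCommGroup E] [NormedSpace ℝ E]
  [TopologicalSpace M] [ChartedSpace E M] [AddCommGroup F] [Module 𝕜 F]

variable {𝕜 E M} in
lemma contMDiff_mul {f g : M → 𝕜} (hf : ContMDiff 𝓘(ℝ, E) 𝓘(ℝ, 𝕜) (⊤ : ℕ∞) f)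
    (hg : ContMDiff 𝓘(ℝ, E) 𝓘(ℝ, 𝕜) (⊤ : ℕ∞) g) :
    ContMDiff 𝓘(ℝ, E) 𝓘(ℝ, 𝕜) (⊤ : ℕ∞) fun p => f p * g p :=
  (contDiff_mul (𝕜 := ℝ) (𝔸 := 𝕜)).comp_contMDiff (hf.prodMk_space hg)

variable {𝕜 E M} in
lemma contMDiff_functional (ℓ : 𝕜 →ₗ[𝕜] 𝕜) {f : M → 𝕜}
    (hf : ContMDiff 𝓘(ℝ, E) 𝓘(ℝ, 𝕜) (⊤ : ℕ∞) f) :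
    ContMDiff 𝓘(ℝ, E) 𝓘(ℝ, 𝕜) (⊤ : ℕ∞) fun p => ℓ (f p) := by
  have h : ∀ c : 𝕜, ℓ c = ℓ 1 * c := fun c => by
    rw [mul_comm, ← smul_eq_mul, ← map_smul, smul_eq_mul, mul_one]
  simpa only [← h] using contMDiff_mul (contMDiff_const (c := ℓ 1)) hf

/-- `C_c^∞(M, F)` for a finite-dimensional `𝕜`-vector space `F` and a manifold `M` modelled
on `E`: smoothness is smoothness of all components, i.e. of the compositions with linear
functionals. -/
def SmoothCc : Submodule 𝕜 (M → F) where
  carrier := {f | HasCompactSupport f ∧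
    ∀ ℓ : F →ₗ[𝕜] 𝕜, ContMDiff 𝓘(ℝ, E) 𝓘(ℝ, 𝕜) (⊤ : ℕ∞) fun p => ℓ (f p)}
  zero_mem' := ⟨HasCompactSupport.zero, fun ℓ => by
    simpa using (contMDiff_const (c := (0 : 𝕜)))⟩
  add_mem' {f g} hf hg := ⟨hf.1.add hg.1, fun ℓ => by
    simp only [Pi.add_apply, map_add]
    exact (hf.2 ℓ).add (hg.2 ℓ)⟩
  smul_mem' c f hf := ⟨hf.1.mono' ((Function.support_const_smul_subset c f).trans subset_closure),
    fun ℓ => by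
      simpa only [Pi.smul_apply, map_smul, smul_eq_mul] using contMDiff_mul contMDiff_const (hf.2 ℓ)⟩

namespace SmoothCc

/-- The derivative of order `k` of the component `ℓ ∘ f` in the chart `φ`, as an element of the
space of functions with the topology of uniform convergence on the compact subsets of the
image of the chart. -/
def chartDeriv (φ : OpenPartialHomeomorph M E) (k : ℕ) (ℓ : F →ₗ[𝕜] 𝕜) (f : SmoothCc 𝕜 E M F) :
    E →ᵤ[{C : Set E | IsCompact C ∧ C ⊆ φ.target}] (E [×k]→L[ℝ] 𝕜) :=
  UniformOnFun.ofFun _ (iteratedFDeriv ℝ k fun v => ℓ (f.1 (φ.symm v)))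

/-- The `C^∞`-topology: uniform convergence of all derivatives on compact sets in charts. -/
@[reducible] def smoothTop : TopologicalSpace (SmoothCc 𝕜 E M F) :=
  ⨅ (φ : atlas E M) (k : ℕ) (ℓ : F →ₗ[𝕜] 𝕜),
    TopologicalSpace.induced (chartDeriv 𝕜 E M F φ.1 k ℓ) inferInstance

/-- The topology of `C_c^∞(M, F)` as the locally convex inductive limit of the spaces
`C_K^∞(M, F)` for compact `K ⊆ M`, which carry the `C^∞`-topology. -/
instance : TopologicalSpace (SmoothCc 𝕜 E M F) :=
  sInf {t | PolynormableSpace 𝕜 (SmoothCc 𝕜 E M F) (topology := t) ∧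
    ∀ K : Set M, IsCompact K →
      Continuous[TopologicalSpace.induced Subtype.val (smoothTop 𝕜 E M F), t]
        (Subtype.val : {f : SmoothCc 𝕜 E M F // tsupport f.1 ⊆ K} → SmoothCc 𝕜 E M F)}

instance : PolynormableSpace 𝕜 (SmoothCc 𝕜 E M F) :=
  PolynormableSpace.sInf fun _ h => h.1

instance : IsTopologicalAddGroup (SmoothCc 𝕜 E M F) :=
  (PolynormableSpace.withSeminorms 𝕜 (SmoothCc 𝕜 E M F)).topologicalAddGroup

instance : ContinuousSMul 𝕜 (SmoothCc 𝕜 E M F) :=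
  (PolynormableSpace.withSeminorms 𝕜 (SmoothCc 𝕜 E M F)).continuousSMul

variable {𝕜 E M}

lemma contMDiff_coe (a : SmoothCc 𝕜 E M 𝕜) : ContMDiff 𝓘(ℝ, E) 𝓘(ℝ, 𝕜) (⊤ : ℕ∞) a.1 :=
  a.2.2 LinearMap.id

variable {F}

/-- The function `p ↦ a(p) x`, for a scalar function `a` and a vector `x`. -/
def smulVec (a : SmoothCc 𝕜 E M 𝕜) (x : F) : SmoothCc 𝕜 E M F :=
  ⟨fun p => a.1 p • x, a.2.1.smul_right, fun ℓ => by
    simpa only [map_smul, smul_eq_mul] using contMDiff_mul (contMDiff_coe a) contMDiff_const⟩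

/-- The algebra `C_c^∞(M) = C_c^∞(M, 𝕜)` with the pointwise product. -/
instance : NonUnitalCommRing (SmoothCc 𝕜 E M 𝕜) :=
  { (inferInstance : AddCommGroup (SmoothCc 𝕜 E M 𝕜)) with
    mul := fun a b => ⟨a.1 * b.1, a.2.1.mul_right, fun ℓ =>
      contMDiff_functional ℓ (contMDiff_mul (contMDiff_coe a) (contMDiff_coe b))⟩
    left_distrib := fun a b c => Subtype.ext (mul_add a.1 b.1 c.1)
    right_distrib := fun a b c => Subtype.ext (add_mul a.1 b.1 c.1)
    zero_mul := fun a => Subtype.ext (zero_mul a.1)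
    mul_zero := fun a => Subtype.ext (mul_zero a.1)
    mul_assoc := fun a b c => Subtype.ext (mul_assoc a.1 b.1 c.1)
    mul_comm := fun a b => Subtype.ext (mul_comm a.1 b.1) }

instance : IsScalarTower 𝕜 (SmoothCc 𝕜 E M 𝕜) (SmoothCc 𝕜 E M 𝕜) :=
  ⟨fun c a b => Subtype.ext (smul_mul_assoc c a.1 b.1)⟩

instance : SMulCommClass 𝕜 (SmoothCc 𝕜 E M 𝕜) (SmoothCc 𝕜 E M 𝕜) :=
  ⟨fun c a b => Subtype.ext (mul_smul_comm c a.1 b.1).symm⟩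

variable {𝔤 : Type*} [LieRing 𝔤] [LieAlgebra 𝕜 𝔤] [FiniteDimensional 𝕜 𝔤]

/-- The pointwise bracket of `C_c^∞(M, 𝔤)`. -/
instance : Bracket (SmoothCc 𝕜 E M 𝔤) (SmoothCc 𝕜 E M 𝔤) where
  bracket f g := ⟨fun p => ⁅f.1 p, g.1 p⁆, by
      refine f.2.1.mono' ((Function.support_subset_iff'.2 fun p hp => ?_).trans subset_closure)
      rw [Function.notMem_support.1 hp, zero_lie], fun ℓ => by
      let b := Module.finBasis 𝕜 𝔤
      have h : ∀ p, ℓ ⁅f.1 p, g.1 p⁆ = ∑ i, b.coord i (f.1 p) *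
          (ℓ ∘ₗ (LieModule.toEnd 𝕜 𝔤 𝔤 (b i))) (g.1 p) := fun p => by
        conv_lhs => rw [← b.sum_repr (f.1 p), sum_lie, map_sum]
        simp
      simp only [h]
      exact contMDiff_finsetSum fun i _ => contMDiff_mul (f.2.2 _) (g.2.2 _)⟩

instance : LieRing (SmoothCc 𝕜 E M 𝔤) where
  add_lie f g h := Subtype.ext (funext fun p => add_lie (f.1 p) (g.1 p) (h.1 p))
  lie_add f g h := Subtype.ext (funext fun p => lie_add (f.1 p) (g.1 p) (h.1 p))
  lie_self f := Subtype.ext (funext fun p => lie_self (f.1 p))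
  leibniz_lie f g h := Subtype.ext (funext fun p => leibniz_lie (f.1 p) (g.1 p) (h.1 p))

instance : LieAlgebra 𝕜 (SmoothCc 𝕜 E M 𝔤) where
  lie_smul c f g := Subtype.ext (funext fun p => lie_smul c (f.1 p) (g.1 p))

end SmoothCc

end Smooth

end CurrentLie

end

/-! Weak universality is the core. Injectivity of `θ ↦ [θ ∘ ω]` is a symmetry argument: `κ(x, y)` is
symmetric while `[x, y]` is skew, so `θ ∘ ω = ℓ ∘ [·,·]` forces `θ` to equal its own negative on the
values `κ(x, y) ⊗ [a db]`, and these determine a continuous linear map.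

For surjectivity let `η` be a continuous cocycle on `A ⊗ 𝔤`. If `A` had a unit, Whitehead's first
lemma, applied to `(x, y) ↦ η(1 ⊗ x, b ⊗ y)`, would make these forms vanish after subtraction of a
coboundary. Here `1` is replaced by an element `E` with `E e = e` for some `e` with `e b = b`.
Perfectness of `𝔤` makes the form independent of `E` (`IsCocycle.formAt_eq`), hence linear in `b`.
The primitive is written down with the Casimir element (`whitehead_primitive`). It is continuous
because one `E` serves a whole `A_n` and `A` is the inductive limit
(`IsLimitOfUnitalSubalgebras.continuous_unitForm`).

For the normalized cocycle every form `η(a ⊗ ·, b ⊗ ·)` is invariant, therefore symmetric, and the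
cocycle identity turns into the Leibniz rule `η(a, bc) = η(ab, c) + η(ac, b)`
(`IsCocycle.formAt_mul`). Maps with this property are the linear maps on Kähler differentials, and
skewness makes them vanish on exact forms; with the universality of `κ` this factors `η` through `ω`
(`IsCocycle.exists_eq_maierCocycle`). The topological input is that joint continuity of `(a, b) ↦
f(a db)` suffices for continuity of `f` (`TopKaehler.continuous_of_continuous_smul_D`).

Since `A ⊗ 𝔤` is perfect, classical universality follows from weak universality: a section of a
central extension has a cocycle as its defect, and that cocycle is of the form `θ ∘ ω` up to a
coboundary.

For compactly supported smooth functions the subalgebras are the `C_K^∞(M)`, with cutoff functions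
as local units. Completeness comes from uniform convergence of all derivatives; joint continuity of
the product needs a locally finite decomposition of `f g` (`SmoothCc.exists_partition`). The cocycle
is transported along `C_c^∞(M, 𝔤) ≃ C_c^∞(M) ⊗ 𝔤`. -/

noncomputable section

namespace CurrentLie

/-! ### Seminorm estimates for bilinear maps -/

section Seminorms

variable {𝕜 E F W : Type*} [RCLike 𝕜] [AddCommGroup E] [Module 𝕜 E]
  [AddCommGroup F] [Module 𝕜 F] [AddCommGroup W] [Module 𝕜 W]

/-- A homogeneous estimate on unit balls gives a product estimate. -/
lemma le_mul_of_le_one_of_lt_one (p : Seminorm 𝕜 E) (q : Seminorm 𝕜 F) (s : Seminorm 𝕜 W)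
    (B : E →ₗ[𝕜] F →ₗ[𝕜] W) (h : ∀ x y, p x < 1 → q y < 1 → s (B x y) ≤ 1) (x : E) (y : F) :
    s (B x y) ≤ p x * q y := by
  -- `p x` and `q y` may vanish, so the vectors are scaled by `(p x + ε)⁻¹` and `(q y + ε)⁻¹`, and
  -- `ε` tends to `0` at the end.
  have key : ∀ ε : ℝ, 0 < ε → s (B x y) ≤ (p x + ε) * (q y + ε) := by
    intro ε hε
    have hp : 0 < p x + ε := add_pos_of_nonneg_of_pos (apply_nonneg p x) hε
    have hq : 0 < q y + ε := add_pos_of_nonneg_of_pos (apply_nonneg q y) hε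
    have h1 := h ((((p x + ε)⁻¹ : ℝ) : 𝕜) • x) ((((q y + ε)⁻¹ : ℝ) : 𝕜) • y)
      (by
        rw [map_smul_eq_mul, RCLike.norm_ofReal, abs_of_pos (inv_pos.2 hp), inv_mul_lt_iff₀ hp]
        linarith)
      (by
        rw [map_smul_eq_mul, RCLike.norm_ofReal, abs_of_pos (inv_pos.2 hq), inv_mul_lt_iff₀ hq]
        linarith)
    rw [map_smul B, LinearMap.map_smul, LinearMap.smul_apply, map_smul_eq_mul, map_smul_eq_mul,
      RCLike.norm_ofReal, RCLike.norm_ofReal, abs_of_pos (inv_pos.2 hp),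
      abs_of_pos (inv_pos.2 hq), inv_mul_le_iff₀ hq, inv_mul_le_iff₀ hp] at h1
    simpa using h1
  have hlim : Filter.Tendsto (fun ε : ℝ => (p x + ε) * (q y + ε)) (𝓝[>] 0)
      (𝓝 ((p x + 0) * (q y + 0))) := by
    apply Filter.Tendsto.mono_left _ nhdsWithin_le_nhds
    exact ((continuous_const.add continuous_id).mul (continuous_const.add continuous_id)).tendsto 0
  simp only [add_zero] at hlim
  exact ge_of_tendsto hlim (Filter.eventually_of_mem self_mem_nhdsWithin fun ε hε => key ε hε)

variable [TopologicalSpace E] [TopologicalSpace F]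

lemma exists_seminorm_of_mem_nhds_zero [PolynormableSpace 𝕜 E] {U : Set E} (hU : U ∈ 𝓝 (0 : E)) :
    ∃ p : Seminorm 𝕜 E, Continuous p ∧ ∀ x, p x < 1 → x ∈ U := by
  obtain ⟨⟨s, r⟩, hr, h⟩ :=
    (PolynormableSpace.withSeminorms 𝕜 E).hasBasis_zero_ball.mem_iff.1 hU
  have hE := (PolynormableSpace.withSeminorms 𝕜 E).topologicalAddGroup
  let c : NNReal := ⟨r⁻¹, (inv_pos.2 hr).le⟩
  have hc : Continuous ⇑(s.sup (fun i : {p : Seminorm 𝕜 E // Continuous p} => i.1)) :=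
    Seminorm.continuous_finsetSup fun i _ => i.2
  refine ⟨c • s.sup (fun i : {p : Seminorm 𝕜 E // Continuous p} => i.1), hc.const_smul c,
    fun x hx => h ?_⟩
  rw [Seminorm.mem_ball_zero]
  have : r⁻¹ * (s.sup (fun i : {p : Seminorm 𝕜 E // Continuous p} => i.1)) x < 1 := hx
  rwa [inv_mul_lt_iff₀ hr, mul_one] at this

/-- Continuity at the origin already gives unit balls on which `s ∘ B < 1`, and homogeneity does the
rest. Together with the converse below, this replaces joint continuity by product estimates
throughout. -/
lemma exists_seminorm_bound_of_continuous [PolynormableSpace 𝕜 E] [PolynormableSpace 𝕜 F]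
    (s : Seminorm 𝕜 W) (B : E →ₗ[𝕜] F →ₗ[𝕜] W)
    (hB : Continuous fun z : E × F => s (B z.1 z.2)) :
    ∃ (p : Seminorm 𝕜 E) (q : Seminorm 𝕜 F), Continuous p ∧ Continuous q ∧
      ∀ x y, s (B x y) ≤ p x * q y := by
  have h0 : {z : E × F | s (B z.1 z.2) < 1} ∈ 𝓝 ((0 : E), (0 : F)) := by
    apply (isOpen_lt hB continuous_const).mem_nhds
    simp
  rw [nhds_prod_eq, Filter.mem_prod_iff] at h0
  obtain ⟨U, hU, V, hV, hUV⟩ := h0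
  obtain ⟨p, hp, hpU⟩ := exists_seminorm_of_mem_nhds_zero (𝕜 := 𝕜) hU
  obtain ⟨q, hq, hqV⟩ := exists_seminorm_of_mem_nhds_zero (𝕜 := 𝕜) hV
  exact ⟨p, q, hp, hq, le_mul_of_le_one_of_lt_one p q s B fun x y hx hy =>
    (hUV (Set.mk_mem_prod (hpU x hx) (hqV y hy))).le⟩

lemma continuous_bilinear_of_seminorm_bound {ι : Type*} [TopologicalSpace W]
    {r : SeminormFamily 𝕜 W ι} (hr : WithSeminorms r) [IsTopologicalAddGroup E]
    [IsTopologicalAddGroup F] (B : E →ₗ[𝕜] F →ₗ[𝕜] W)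
    (hB : ∀ i, ∃ (p : Seminorm 𝕜 E) (q : Seminorm 𝕜 F), Continuous p ∧ Continuous q ∧
      ∀ x y, r i (B x y) ≤ p x * q y) :
    Continuous fun z : E × F => B z.1 z.2 := by
  rw [continuous_iff_continuousAt]
  rintro ⟨x₀, y₀⟩
  rw [ContinuousAt, hr.tendsto_nhds]
  intro i ε hε
  obtain ⟨p, q, hp, hq, h⟩ := hB i
  have hc : Continuous fun z : E × F =>
      p (z.1 - x₀) * q (z.2 - y₀) + p (z.1 - x₀) * q y₀ + p x₀ * q (z.2 - y₀) := by fun_prop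
  have hev := (hc.tendsto (x₀, y₀)).eventually_lt_const (u := ε) (by simpa using hε)
  filter_upwards [hev] with z hz
  have hsplit : B z.1 z.2 - B x₀ y₀ =
      B (z.1 - x₀) (z.2 - y₀) + B (z.1 - x₀) y₀ + B x₀ (z.2 - y₀) := by
    simp only [map_sub, LinearMap.sub_apply]; abel
  change r i (B z.1 z.2 - B x₀ y₀) < ε
  rw [hsplit]
  refine lt_of_le_of_lt ((map_add_le_add _ _ _).trans
    (add_le_add ((map_add_le_add _ _ _).trans (add_le_add (h _ _) (h _ _))) (h _ _))) hz

/-- A linear map is continuous as soon as its compositions with continuous seminorms are. -/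
lemma continuous_of_continuous_seminorm_comp [TopologicalSpace W] [PolynormableSpace 𝕜 W]
    [IsTopologicalAddGroup E] (f : E →ₗ[𝕜] W)
    (h : ∀ p : Seminorm 𝕜 W, Continuous p → Continuous fun x => p (f x)) : Continuous f := by
  have := (PolynormableSpace.withSeminorms 𝕜 W).topologicalAddGroup
  apply continuous_of_continuousAt_zero f
  rw [ContinuousAt, map_zero, (PolynormableSpace.withSeminorms 𝕜 W).tendsto_nhds]
  intro p ε hε
  simp only [sub_zero]
  exact ((h p.1 p.2).tendsto 0).eventually_lt_const (u := ε) (by simpa using hε)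

end Seminorms

/-! ### Projective tensor products with a finite-dimensional factor -/

namespace ProjTensor

section Algebraic

variable {𝕜 E F W : Type*} [RCLike 𝕜] [AddCommGroup E] [Module 𝕜 E] [AddCommGroup F] [Module 𝕜 F]
  [AddCommGroup W] [Module 𝕜 W]

/-- The linear map on `E ⊗ F` defined by a bilinear map. -/
def lift (B : E →ₗ[𝕜] F →ₗ[𝕜] W) : ProjTensor 𝕜 E F →ₗ[𝕜] W := TensorProduct.lift B

lemma ext_mk {f g : ProjTensor 𝕜 E F →ₗ[𝕜] W}
    (h : ∀ x y, f (mk 𝕜 E F x y) = g (mk 𝕜 E F x y)) : f = g :=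
  TensorProduct.ext' h

variable {ι : Type*} (b : Module.Basis ι 𝕜 F)

/-- The `i`-th coordinate map `E ⊗ F → E` for a basis of `F`. -/
def coord (i : ι) : ProjTensor 𝕜 E F →ₗ[𝕜] E :=
  lift (LinearMap.lsmul 𝕜 E ∘ₗ b.coord i).flip

lemma coord_mk (i : ι) (x : E) (y : F) : coord b i (mk 𝕜 E F x y) = b.coord i y • x := rfl

lemma sum_coord [Fintype ι] (z : ProjTensor 𝕜 E F) : ∑ i, mk 𝕜 E F (coord b i z) (b i) = z := by
  induction z using ProjTensor.ind with
  | h0 => simp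
  | hmk x y =>
    simp only [coord_mk, map_smul, LinearMap.smul_apply]
    conv_rhs => rw [← b.sum_repr y, map_sum]
    simp
  | hadd u v hu hv =>
    simp only [map_add, LinearMap.add_apply, Finset.sum_add_distrib, hu, hv]

end Algebraic

variable {𝕜 E F W : Type*} [RCLike 𝕜] [AddCommGroup E] [Module 𝕜 E] [TopologicalSpace E]
  [AddCommGroup F] [Module 𝕜 F] [TopologicalSpace F] [AddCommGroup W] [Module 𝕜 W]
  [TopologicalSpace W]

lemma continuous_mk : Continuous fun z : E × F => mk 𝕜 E F z.1 z.2 :=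
  continuous_sInf_rng.2 fun _ h => h.2

lemma continuous_mk_left (y : F) : Continuous fun x : E => mk 𝕜 E F x y :=
  continuous_mk.comp (Continuous.prodMk_left y)

lemma continuous_mk_right (x : E) : Continuous fun y : F => mk 𝕜 E F x y :=
  continuous_mk.comp (Continuous.prodMk_right x)

/-- Linear maps on a projective tensor product are continuous when the associated bilinear maps
are. -/
lemma continuous_of_continuous_mk [PolynormableSpace 𝕜 W] (f : ProjTensor 𝕜 E F →ₗ[𝕜] W)
    (hf : Continuous fun z : E × F => f (mk 𝕜 E F z.1 z.2)) : Continuous f := by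
  rw [continuous_iff_le_induced]
  refine sInf_le ⟨PolynormableSpace.induced f, ?_⟩
  rwa [continuous_induced_rng]

variable [FiniteDimensional 𝕜 F] [IsTopologicalAddGroup F] [ContinuousSMul 𝕜 F] [T2Space F]
  [PolynormableSpace 𝕜 E]

lemma continuous_coord {ι : Type*} (b : Module.Basis ι 𝕜 F) (i : ι) :
    Continuous (coord (E := E) b i) := by
  have := (PolynormableSpace.withSeminorms 𝕜 E).continuousSMul
  refine continuous_of_continuous_mk _ ?_
  exact ((LinearMap.continuous_of_finiteDimensional (b.coord i)).comp continuous_snd).smul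
    continuous_fst

/-- Continuity of bilinear maps on `E ⊗ F` for finite-dimensional `F`. -/
lemma continuous_bilinear [ContinuousAdd W]
    (B : ProjTensor 𝕜 E F →ₗ[𝕜] ProjTensor 𝕜 E F →ₗ[𝕜] W)
    (hB : ∀ y y' : F, Continuous fun z : E × E => B (mk 𝕜 E F z.1 y) (mk 𝕜 E F z.2 y')) :
    Continuous fun z : ProjTensor 𝕜 E F × ProjTensor 𝕜 E F => B z.1 z.2 := by
  let b := Module.finBasis 𝕜 F
  have h : ∀ u v : ProjTensor 𝕜 E F, B u v =
      ∑ i, ∑ j, B (mk 𝕜 E F (coord b i u) (b i)) (mk 𝕜 E F (coord b j v) (b j)) := by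
    intro u v
    conv_lhs => rw [← sum_coord b u, ← sum_coord b v]
    simp only [map_sum, LinearMap.sum_apply]
    exact Finset.sum_comm
  have h' : (fun z : ProjTensor 𝕜 E F × ProjTensor 𝕜 E F => B z.1 z.2) = fun z =>
      ∑ i, ∑ j, B (mk 𝕜 E F (coord b i z.1) (b i)) (mk 𝕜 E F (coord b j z.2) (b j)) :=
    funext fun z => h z.1 z.2
  rw [h']
  refine continuous_finsetSum _ fun i _ => continuous_finsetSum _ fun j _ => ?_
  exact (hB (b i) (b j)).comp (((continuous_coord b i).comp continuous_fst).prodMk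
    ((continuous_coord b j).comp continuous_snd))

/-- Expansion in a basis of `F` writes `f` as a finite sum of partial maps composed with the
continuous coordinates, so no joint continuity is needed. -/
lemma continuous_of_continuous_mk_left [ContinuousAdd W]
    (f : ProjTensor 𝕜 E F →ₗ[𝕜] W) (hf : ∀ y : F, Continuous fun x : E => f (mk 𝕜 E F x y)) :
    Continuous f := by
  let b := Module.finBasis 𝕜 F
  have h : ⇑f = fun u => ∑ i, f (mk 𝕜 E F (coord b i u) (b i)) := by
    funext u
    conv_lhs => rw [← sum_coord b u, map_sum]
  rw [h]
  exact continuous_finsetSum _ fun i _ => (hf (b i)).comp (continuous_coord b i)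

end ProjTensor

/-! ### The Casimir element and Whitehead's first lemma -/

section Casimir

variable {𝕜 𝔤 : Type*} [Field 𝕜] [LieRing 𝔤] [LieAlgebra 𝕜 𝔤]
  [LieAlgebra.IsKilling 𝕜 𝔤] {ι : Type*} [Fintype ι] [DecidableEq ι] (b : Module.Basis ι 𝕜 𝔤)

/-- The basis dual to `b` with respect to the Killing form. -/
def killingDual : Module.Basis ι 𝕜 𝔤 :=
  LinearMap.BilinForm.dualBasis (killingForm 𝕜 𝔤)
    (LieAlgebra.IsKilling.killingForm_nondegenerate 𝕜 𝔤) b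

lemma killingDual_repr (x : 𝔤) (i : ι) : (killingDual b).repr x i = killingForm 𝕜 𝔤 x (b i) :=
  LinearMap.BilinForm.dualBasis_repr_apply _ _ _ _

lemma basis_repr_eq_killingForm (x : 𝔤) (i : ι) :
    b.repr x i = killingForm 𝕜 𝔤 x (killingDual b i) := by
  have h : b.coord i = (killingForm 𝕜 𝔤).flip (killingDual b i) := by
    refine b.ext fun j => ?_
    change _ = killingForm 𝕜 𝔤 (b j) (killingDual b i)
    rw [killingDual, LieModule.traceForm_comm, LinearMap.BilinForm.apply_dualBasis_left,
      Module.Basis.coord_apply, b.repr_self, Finsupp.single_apply]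
  exact DFunLike.congr_fun h x

/-- The Casimir tensor `∑ eᵢ ⊗ eⁱ` of the Killing form is invariant. -/
lemma sum_killingDual_invariant {W : Type*} [AddCommGroup W] [Module 𝕜 W]
    (β : 𝔤 →ₗ[𝕜] 𝔤 →ₗ[𝕜] W) (x : 𝔤) :
    ∑ i, (β (b i) ⁅killingDual b i, x⁆ + β ⁅b i, x⁆ (killingDual b i)) = 0 := by
  have h1 : ∀ i, β (b i) ⁅killingDual b i, x⁆ =
      ∑ j, killingForm 𝕜 𝔤 ⁅killingDual b i, x⁆ (b j) • β (b i) (killingDual b j) := by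
    intro i
    conv_lhs => rw [← (killingDual b).sum_repr ⁅killingDual b i, x⁆, map_sum]
    simp only [map_smul, killingDual_repr]
  have h2 : ∀ i, β ⁅b i, x⁆ (killingDual b i) =
      ∑ j, killingForm 𝕜 𝔤 ⁅b i, x⁆ (killingDual b j) • β (b j) (killingDual b i) := by
    intro i
    conv_lhs => rw [← b.sum_repr ⁅b i, x⁆, map_sum, LinearMap.sum_apply]
    simp only [map_smul, LinearMap.smul_apply, basis_repr_eq_killingForm]
  rw [Finset.sum_add_distrib, Finset.sum_congr rfl fun i _ => h1 i,
    Finset.sum_congr rfl fun i _ => h2 i, Finset.sum_comm (f := fun i j =>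
      killingForm 𝕜 𝔤 ⁅b i, x⁆ (killingDual b j) • β (b j) (killingDual b i)),
    ← Finset.sum_add_distrib]
  refine Finset.sum_eq_zero fun i _ => ?_
  rw [← Finset.sum_add_distrib]
  refine Finset.sum_eq_zero fun j _ => ?_
  rw [← add_smul]
  -- After the second double sum is transposed, the two coefficients of `β (b i) (killingDual b j)`
  -- cancel by invariance of the Killing form.
  have : killingForm 𝕜 𝔤 ⁅killingDual b i, x⁆ (b j) +
      killingForm 𝕜 𝔤 ⁅b j, x⁆ (killingDual b i) = 0 := by
    rw [LieModule.traceForm_apply_lie_apply, LieModule.traceForm_comm 𝕜 𝔤 𝔤 ⁅b j, x⁆, ← lie_skew,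
      map_neg, neg_add_cancel]
  rw [this, zero_smul]

/-- The Casimir operator of the Killing form is the identity in the adjoint representation. -/
lemma sum_lie_killingDual (y : 𝔤) : ∑ i, ⁅b i, ⁅killingDual b i, y⁆⁆ = y := by
  have h := LieAlgebra.IsKilling.killingForm_nondegenerate 𝕜 𝔤
  have hinj : ∀ u v : 𝔤, (∀ x, killingForm 𝕜 𝔤 u x = killingForm 𝕜 𝔤 v x) → u = v := by
    intro u v huv
    exact LinearMap.ker_eq_bot.1 (LinearMap.BilinForm.Nondegenerate.ker_eq_bot h)
      (LinearMap.ext huv)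
  refine hinj _ _ fun x => ?_
  rw [map_sum, LinearMap.sum_apply]
  -- Moving brackets across the Killing form turns the `i`-th term into the `i`-th diagonal entry of
  -- `ad y ∘ ad x` in the basis `b`. The sum is then the trace that defines the Killing form of `y`
  -- and `x`.
  have h1 : ∀ i, killingForm 𝕜 𝔤 ⁅b i, ⁅killingDual b i, y⁆⁆ x =
      b.repr ⁅y, ⁅x, b i⁆⁆ i := by
    intro i
    rw [basis_repr_eq_killingForm, LieModule.traceForm_comm 𝕜 𝔤 𝔤 _ x,
      ← LieModule.traceForm_apply_lie_apply, LieModule.traceForm_comm 𝕜 𝔤 𝔤 ⁅x, b i⁆,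
      LieModule.traceForm_apply_lie_apply, LieModule.traceForm_comm]
  rw [Finset.sum_congr rfl fun i _ => h1 i, LieModule.traceForm_apply_apply,
    LinearMap.trace_eq_matrix_trace 𝕜 b]
  simp [Matrix.trace, LinearMap.toMatrix_apply]

/-- Elements of a Killing Lie algebra are finite sums of brackets. -/
lemma exists_sum_lie (𝕜 : Type*) {𝔤 : Type*} [Field 𝕜] [LieRing 𝔤] [LieAlgebra 𝕜 𝔤]
    [FiniteDimensional 𝕜 𝔤] [LieAlgebra.IsKilling 𝕜 𝔤] (y : 𝔤) : ∃ (n : ℕ) (u v : Fin n → 𝔤), y = ∑ i, ⁅u i, v i⁆ :=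
  ⟨_, _, _, (sum_lie_killingDual (Module.finBasis 𝕜 𝔤) y).symm⟩

/-- Whitehead's first lemma for the coadjoint representation with values in a vector space,
with an explicit primitive. -/
lemma whitehead_primitive {W : Type*} [AddCommGroup W] [Module 𝕜 W]
    (β : 𝔤 →ₗ[𝕜] 𝔤 →ₗ[𝕜] W) (hβ : ∀ x x' y, β ⁅x, x'⁆ y = β x ⁅x', y⁆ - β x' ⁅x, y⁆) (x y : 𝔤) :
    ∑ i, β (b i) ⁅killingDual b i, ⁅x, y⁆⁆ = β x y := by
  -- The bracketed terms sum to zero by invariance of the Casimir tensor, applied to `(u, v) ↦ β u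
  -- ⁅v, y⁆`; the remaining term is `β x` of the Casimir operator at `y`, which is `y`.
  have h : ∀ i, β (b i) ⁅killingDual b i, ⁅x, y⁆⁆ =
      (β (b i) ⁅⁅killingDual b i, x⁆, y⁆ + β ⁅b i, x⁆ ⁅killingDual b i, y⁆) +
        β x ⁅b i, ⁅killingDual b i, y⁆⁆ := by
    intro i
    rw [hβ, leibniz_lie (killingDual b i) x y, map_add]
    abel
  rw [Finset.sum_congr rfl fun i _ => h i, Finset.sum_add_distrib, ← map_sum,
    sum_lie_killingDual]
  have h0 := sum_killingDual_invariant b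
    (β.compl₂ ((LieModule.toEnd 𝕜 𝔤 𝔤 : 𝔤 →ₗ[𝕜] Module.End 𝕜 𝔤).flip y)) x
  have h1 : ∑ i, (β (b i) ⁅⁅killingDual b i, x⁆, y⁆ + β ⁅b i, x⁆ ⁅killingDual b i, y⁆) = 0 := h0
  rw [h1, zero_add]

/-- Invariant bilinear forms on a Killing Lie algebra are symmetric. -/
lemma symm_of_invariant [FiniteDimensional 𝕜 𝔤] {W : Type*} [AddCommGroup W] [Module 𝕜 W] [CharZero 𝕜]
    (β : 𝔤 →ₗ[𝕜] 𝔤 →ₗ[𝕜] W) (hβ : ∀ x y z, β ⁅x, y⁆ z = β x ⁅y, z⁆) (x y : 𝔤) :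
    β x y = β y x := by
  obtain ⟨n, u, v, rfl⟩ := exists_sum_lie 𝕜 y
  simp only [map_sum, LinearMap.sum_apply]
  refine Finset.sum_congr rfl fun i _ => ?_
  -- Write `T(a, c, d)` for `β a ⁅c, d⁆ = β ⁅a, c⁆ d`. The first expression is skew in the last two
  -- arguments, the second in the first two, so `T` is cyclically invariant; and `β ⁅c, d⁆ a = T(c,
  -- d, a)`. The identities below spell this out.
  have key : ∀ a c d : 𝔤, β a ⁅c, d⁆ - β ⁅c, d⁆ a = -(β a ⁅c, d⁆ - β ⁅c, d⁆ a) := by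
    intro a c d
    have h2 : β c ⁅d, a⁆ = β ⁅c, d⁆ a := (hβ c d a).symm
    have h3 : β d ⁅a, c⁆ = β ⁅d, a⁆ c := (hβ d a c).symm
    have h4 : β ⁅a, c⁆ d = β a ⁅c, d⁆ := hβ a c d
    have h5 : β ⁅d, a⁆ c = β d ⁅a, c⁆ := hβ d a c
    have h6 : β d ⁅c, a⁆ = β ⁅d, c⁆ a := (hβ d c a).symm
    have h7 : β a ⁅d, c⁆ = β ⁅a, d⁆ c := (hβ a d c).symm
    have h8 : β c ⁅a, d⁆ = β ⁅c, a⁆ d := (hβ c a d).symm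
    have e1 : β d ⁅c, a⁆ = - β d ⁅a, c⁆ := by rw [← lie_skew, map_neg]
    have e2 : β a ⁅d, c⁆ = - β a ⁅c, d⁆ := by rw [← lie_skew, map_neg]
    have e3 : β c ⁅a, d⁆ = - β c ⁅d, a⁆ := by rw [← lie_skew, map_neg]
    have e4 : β ⁅d, c⁆ a = - β ⁅c, d⁆ a := by rw [← lie_skew, map_neg, LinearMap.neg_apply]
    have e5 : β ⁅a, d⁆ c = - β ⁅d, a⁆ c := by rw [← lie_skew, map_neg, LinearMap.neg_apply]
    have e6 : β ⁅c, a⁆ d = - β ⁅a, c⁆ d := by rw [← lie_skew, map_neg, LinearMap.neg_apply]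
    grind
  have h := key x (u i) (v i)
  rw [eq_neg_iff_add_eq_zero, ← two_smul 𝕜] at h
  exact sub_eq_zero.1 ((smul_eq_zero.1 h).resolve_left two_ne_zero)

end Casimir

/-! ### Weak and classical universality of cocycles -/

section Cohomology

lemma lie_lie_cyclic {L : Type*} [LieRing L] (x y z : L) :
    ⁅⁅x, y⁆, z⁆ + ⁅⁅y, z⁆, x⁆ + ⁅⁅z, x⁆, y⁆ = 0 := by
  rw [← lie_skew ⁅x, y⁆ z, ← lie_skew ⁅y, z⁆ x, ← lie_skew ⁅z, x⁆ y, ← neg_add, ← neg_add,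
    lie_jacobi z x y, neg_zero]

variable {𝕜 L V : Type*} [RCLike 𝕜] [LieRing L] [LieAlgebra 𝕜 L] [TopologicalSpace L]
  [AddCommGroup V] [Module 𝕜 V] [TopologicalSpace V] [IsTopologicalAddGroup V] [ContinuousSMul 𝕜 V]

lemma deltaMap_eq_mk_iff {W : Type*} [AddCommGroup W] [Module 𝕜 W] [TopologicalSpace W]
    [IsTopologicalAddGroup W] [ContinuousSMul 𝕜 W] (ω : contCocycles 𝕜 L V) (θ : V →L[𝕜] W)
    (η : contCocycles 𝕜 L W) :
    deltaMap W ω θ = QuotientAddGroup.mk η ↔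
      ∃ ℓ : L →L[𝕜] W, ∀ x y, η.1 x y = θ (ω.1 x y) + ℓ ⁅x, y⁆ := by
  rw [deltaMap, QuotientAddGroup.eq]
  refine exists_congr fun ℓ => forall₂_congr fun x y => ?_
  change -(θ (ω.1 x y)) + η.1 x y = ℓ ⁅x, y⁆ ↔ _
  rw [neg_add_eq_iff_eq_add]

/-- By linearity in `θ` only the kernel matters. As `deltaMap` is a bare function, differences of
`θ` are formed by hand. -/
lemma injective_deltaMap_iff {W : Type*} [AddCommGroup W] [Module 𝕜 W] [TopologicalSpace W]
    [IsTopologicalAddGroup W] [ContinuousSMul 𝕜 W] (ω : contCocycles 𝕜 L V) :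
    Function.Injective (deltaMap W ω) ↔ ∀ (θ : V →L[𝕜] W) (ℓ : L →L[𝕜] W),
      (∀ x y, θ (ω.1 x y) = ℓ ⁅x, y⁆) → θ = 0 := by
  constructor
  · intro h θ ℓ hθ
    refine h ?_
    change _ = QuotientAddGroup.mk (pushCocycle ω 0)
    rw [deltaMap_eq_mk_iff]
    refine ⟨-ℓ, fun x y => ?_⟩
    change (0 : W) = θ (ω.1 x y) + -ℓ ⁅x, y⁆
    rw [hθ, add_neg_cancel]
  · intro h θ θ' hθ
    change _ = QuotientAddGroup.mk (pushCocycle ω θ') at hθ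
    rw [deltaMap_eq_mk_iff] at hθ
    obtain ⟨ℓ, hℓ⟩ := hθ
    rw [← sub_eq_zero]
    refine h _ (-ℓ) fun x y => ?_
    have h1 : θ' (ω.1 x y) = θ (ω.1 x y) + ℓ ⁅x, y⁆ := hℓ x y
    change θ (ω.1 x y) - θ' (ω.1 x y) = -ℓ ⁅x, y⁆
    rw [h1]; abel

lemma surjective_deltaMap_iff {W : Type*} [AddCommGroup W] [Module 𝕜 W] [TopologicalSpace W]
    [IsTopologicalAddGroup W] [ContinuousSMul 𝕜 W] (ω : contCocycles 𝕜 L V) :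
    Function.Surjective (deltaMap W ω) ↔ ∀ η : contCocycles 𝕜 L W,
      ∃ (θ : V →L[𝕜] W) (ℓ : L →L[𝕜] W), ∀ x y, η.1 x y = θ (ω.1 x y) + ℓ ⁅x, y⁆ := by
  constructor
  · intro h η
    obtain ⟨θ, hθ⟩ := h (QuotientAddGroup.mk η)
    exact ⟨θ, (deltaMap_eq_mk_iff ω θ η).1 hθ⟩
  · intro h c
    obtain ⟨η, rfl⟩ := QuotientAddGroup.mk_surjective c
    obtain ⟨θ, hθ⟩ := h η
    exact ⟨θ, (deltaMap_eq_mk_iff ω θ η).2 hθ⟩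

/-- For perfect Lie algebras, weak universality implies classical universality. -/
theorem IsWeaklyUniversal.isClassicallyUniversal {ω : contCocycles 𝕜 L V}
    (h : IsWeaklyUniversal.{w} ω)
    (hL : Submodule.span 𝕜 {z : L | ∃ x y : L, z = ⁅x, y⁆} = ⊤) :
    IsClassicallyUniversal.{w} ω := by
  intro G _ _ _ _ _ _ _ hG q hq ⟨σ, hσ⟩ hcentral hcomplete
  let Z : Submodule 𝕜 G := LinearMap.ker (q : G →ₗ[𝕜] L)
  have hZ : ∀ {z : G}, z ∈ Z ↔ q z = 0 := Iff.rfl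
  have : CompleteSpace Z := hcomplete.completeSpace_coe
  have hcentral' : ∀ z : G, q z = 0 → ∀ g : G, ⁅g, z⁆ = 0 := fun z hz g => by
    rw [← lie_skew, hcentral z hz, neg_zero]
  have : IsUniformAddGroup Z := inferInstanceAs (IsUniformAddGroup Z.toAddSubgroup)
  obtain ⟨hinj, hsurj⟩ := h Z
  rw [injective_deltaMap_iff] at hinj
  rw [surjective_deltaMap_iff] at hsurj
  -- The bracket of `L` is not assumed to be continuous; it inherits continuity from `G` through `q`
  -- and the section `σ`.
  have hbr : Continuous fun p : L × L => ⁅p.1, p.2⁆ := by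
    have : (fun p : L × L => ⁅p.1, p.2⁆) = fun p => q ⁅σ p.1, σ p.2⁆ := by
      funext p
      rw [LieHom.map_lie, hσ, hσ]
    rw [this]
    exact hq.comp (hG.comp ((σ.continuous.comp continuous_fst).prodMk
      (σ.continuous.comp continuous_snd)))
  have hmem : ∀ x y : L, ⁅σ x, σ y⁆ - σ ⁅x, y⁆ ∈ Z := fun x y => by
    rw [hZ, map_sub, LieHom.map_lie, hσ, hσ, hσ, sub_self]
  -- The defect of the section `σ` from being a homomorphism takes values in the kernel of `q`; it
  -- is a cocycle because this kernel is central.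
  let η₀ : L →ₗ[𝕜] L →ₗ[𝕜] Z := LinearMap.mk₂ 𝕜 (fun x y => ⟨⁅σ x, σ y⁆ - σ ⁅x, y⁆, hmem x y⟩)
    (fun x x' y => Subtype.ext (by
      change _ = (⁅σ x, σ y⁆ - σ ⁅x, y⁆) + (⁅σ x', σ y⁆ - σ ⁅x', y⁆)
      simp only [map_add, add_lie]; abel))
    (fun c x y => Subtype.ext (by
      change _ = c • (⁅σ x, σ y⁆ - σ ⁅x, y⁆)
      simp only [map_smul, smul_lie, smul_sub]))
    (fun x y y' => Subtype.ext (by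
      change _ = (⁅σ x, σ y⁆ - σ ⁅x, y⁆) + (⁅σ x, σ y'⁆ - σ ⁅x, y'⁆)
      simp only [map_add, lie_add]; abel))
    (fun c x y => Subtype.ext (by
      change _ = c • (⁅σ x, σ y⁆ - σ ⁅x, y⁆)
      simp only [map_smul, lie_smul, smul_sub]))
  have hη₀ : ∀ x y, (η₀ x y : G) = ⁅σ x, σ y⁆ - σ ⁅x, y⁆ := fun _ _ => rfl
  have hη₀L : ∀ x y z, (η₀ ⁅x, y⁆ z : G) = ⁅⁅σ x, σ y⁆, σ z⁆ - σ ⁅⁅x, y⁆, z⁆ := fun x y z => by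
    rw [hη₀, sub_left_inj, ← sub_eq_zero, ← sub_lie, ← neg_sub, neg_lie,
      hcentral _ (hZ.1 (hmem x y)), neg_zero]
  have hη : η₀ ∈ contCocycles 𝕜 L Z := by
    refine ⟨fun x => Subtype.ext (by simp [hη₀]), fun x y z => Subtype.ext ?_, ?_⟩
    · change (η₀ ⁅x, y⁆ z : G) + η₀ ⁅y, z⁆ x + η₀ ⁅z, x⁆ y = 0
      have hJ := lie_lie_cyclic x y z
      have hJ' := lie_lie_cyclic (σ x) (σ y) (σ z)
      rw [hη₀L, hη₀L, hη₀L]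
      calc _ = (⁅⁅σ x, σ y⁆, σ z⁆ + ⁅⁅σ y, σ z⁆, σ x⁆ + ⁅⁅σ z, σ x⁆, σ y⁆) -
          σ (⁅⁅x, y⁆, z⁆ + ⁅⁅y, z⁆, x⁆ + ⁅⁅z, x⁆, y⁆) := by
            simp only [map_add]; abel
        _ = 0 := by rw [hJ, hJ', map_zero, sub_zero]
    · refine Continuous.subtype_mk (Continuous.sub ?_ (σ.continuous.comp hbr)) _
      exact hG.comp ((σ.continuous.comp continuous_fst).prodMk
        (σ.continuous.comp continuous_snd))
  obtain ⟨θ, ℓ, hθ⟩ := hsurj ⟨η₀, hη⟩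
  have hθ' : ∀ x y, ⁅σ x, σ y⁆ - σ ⁅x, y⁆ = (θ (ω.1 x y) : G) + ℓ ⁅x, y⁆ := fun x y =>
    congrArg Subtype.val (hθ x y)
  -- Replacing `σ` by `σ + ℓ` makes the defect of the section equal to `θ ∘ ω`, which is what is
  -- needed for a homomorphism that is `θ` on `V`.
  let φ : V × L →L[𝕜] G :=
    (Z.subtypeL ∘L θ) ∘L ContinuousLinearMap.fst 𝕜 V L +
      (σ + Z.subtypeL ∘L ℓ) ∘L ContinuousLinearMap.snd 𝕜 V L
  have hφ : ∀ s : V × L, φ s = (θ s.1 : G) + (σ s.2 + ℓ s.2) := fun _ => rfl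
  have hker : ∀ z : Z, ∀ g : G, ⁅(z : G), g⁆ = 0 := fun z => hcentral z z.2
  have hker' : ∀ z : Z, ∀ g : G, ⁅g, (z : G)⁆ = 0 := fun z => hcentral' z z.2
  refine ⟨φ, ⟨fun s t => ?_, fun s => ?_⟩, fun ψ hψ => ?_⟩
  · simp only [hφ, add_lie, lie_add, hker, hker', zero_add, add_zero]
    rw [add_left_comm, ← hθ', add_sub_cancel]
  · rw [hφ, map_add, map_add, hσ, hZ.1 (θ s.1).2, hZ.1 (ℓ s.2).2, zero_add, add_zero]
  · have hφ2 : ∀ s : V × L, q (φ s) = s.2 := fun s => by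
      rw [hφ, map_add, map_add, hσ, hZ.1 (θ s.1).2, hZ.1 (ℓ s.2).2, zero_add, add_zero]
    have hφ1 : ∀ s t : V × L, φ (ω.1 s.2 t.2, ⁅s.2, t.2⁆) = ⁅φ s, φ t⁆ := fun s t => by
      simp only [hφ, add_lie, lie_add, hker, hker', zero_add, add_zero]
      rw [add_left_comm, ← hθ', add_sub_cancel]
    let δ : V × L →L[𝕜] Z := (ψ - φ).codRestrict Z fun s => by
      rw [hZ, sub_apply, map_sub, hψ.2, hφ2, sub_self]
    have hδ : ∀ s, (δ s : G) = ψ s - φ s := fun _ => rfl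
    -- The homomorphisms `ψ` and `φ` differ by central elements, so the brackets of their values
    -- agree and `δ` vanishes on brackets.
    have hδ0 : ∀ x y : L, δ (ω.1 x y, ⁅x, y⁆) = 0 := fun x y => Subtype.ext (by
      have h1 := hψ.1 (0, x) (0, y)
      have h2 := hφ1 (0, x) (0, y)
      have h3 : ψ (0, x) = φ (0, x) + δ (0, x) := by rw [hδ]; abel
      have h4 : ψ (0, y) = φ (0, y) + δ (0, y) := by rw [hδ]; abel
      rw [h3, h4, add_lie, lie_add, hker, hker', add_zero, add_zero, ← h2] at h1
      rw [hδ]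
      exact sub_eq_zero.2 h1)
    have hsplit : ∀ s : V × L, δ s = δ (s.1, 0) + δ (0, s.2) := fun s => by
      rw [← map_add, Prod.mk_add_mk, add_zero, zero_add]
    -- On `V`, the map `δ` composed with `ω` is a coboundary, so injectivity of `deltaMap` kills it.
    -- The part on `L` then vanishes on brackets, hence everywhere by perfectness.
    have hV : δ ∘L ContinuousLinearMap.inl 𝕜 V L = 0 := by
      refine hinj _ (-(δ ∘L ContinuousLinearMap.inr 𝕜 V L)) fun x y => ?_
      change δ (ω.1 x y, 0) = -δ (0, ⁅x, y⁆)
      rw [eq_neg_iff_add_eq_zero, ← hδ0 x y, hsplit (ω.1 x y, ⁅x, y⁆)]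
    have hVv : ∀ v, δ (v, 0) = 0 := fun v => DFunLike.congr_fun hV v
    have hLl : (δ ∘L ContinuousLinearMap.inr 𝕜 V L : L →ₗ[𝕜] Z) = 0 := by
      refine LinearMap.ext_on hL ?_
      rintro _ ⟨x, y, rfl⟩
      change δ (0, ⁅x, y⁆) = 0
      rw [← hδ0 x y, hsplit (ω.1 x y, ⁅x, y⁆), hVv, zero_add]
    have hLl' : ∀ x, δ (0, x) = 0 := fun x => DFunLike.congr_fun hLl x
    refine ContinuousLinearMap.ext fun s => ?_
    rw [← sub_eq_zero, ← hδ, hsplit, hVv, hLl', add_zero]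
    rfl

/-- Universal cocycles on a perfect Lie algebra can be transported along isomorphisms of
topological Lie algebras. -/
theorem isUniversalCocycle_comp_equiv {L' : Type*} [LieRing L'] [LieAlgebra 𝕜 L']
    [TopologicalSpace L'] (e : L' ≃L[𝕜] L) (he : ∀ x y, e ⁅x, y⁆ = ⁅e x, e y⁆)
    {ω : L →ₗ[𝕜] L →ₗ[𝕜] V} (hω : ω ∈ contCocycles 𝕜 L V)
    (h : IsWeaklyUniversal.{w} (⟨ω, hω⟩ : contCocycles 𝕜 L V))
    (hL : Submodule.span 𝕜 {z : L | ∃ x y : L, z = ⁅x, y⁆} = ⊤) :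
    IsUniversalCocycle.{w} (ω.compl₁₂ (e : L' →ₗ[𝕜] L) (e : L' →ₗ[𝕜] L)) := by
  have he' : ∀ x y, e.symm ⁅x, y⁆ = ⁅e.symm x, e.symm y⁆ := fun x y => by
    rw [ContinuousLinearEquiv.symm_apply_eq, he, e.apply_symm_apply, e.apply_symm_apply]
  have hcont : Continuous fun p : L' × L' => (e p.1, e p.2) :=
    (e.continuous.comp continuous_fst).prodMk (e.continuous.comp continuous_snd)
  have hcont' : Continuous fun p : L × L => (e.symm p.1, e.symm p.2) :=
    (e.symm.continuous.comp continuous_fst).prodMk (e.symm.continuous.comp continuous_snd)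
  have hmem : ω.compl₁₂ (e : L' →ₗ[𝕜] L) (e : L' →ₗ[𝕜] L) ∈ contCocycles 𝕜 L' V := by
    refine ⟨fun x => hω.1 _, fun x y z => ?_, hω.2.2.comp hcont⟩
    change ω (e ⁅x, y⁆) (e z) + ω (e ⁅y, z⁆) (e x) + ω (e ⁅z, x⁆) (e y) = 0
    rw [he, he, he]
    exact hω.2.1 _ _ _
  have hweak : IsWeaklyUniversal.{w}
      (⟨ω.compl₁₂ (e : L' →ₗ[𝕜] L) (e : L' →ₗ[𝕜] L), hmem⟩ : contCocycles 𝕜 L' V) := by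
    intro W _ _ _ _ _ _ _ _
    obtain ⟨hinj, hsurj⟩ := h W
    rw [injective_deltaMap_iff] at hinj
    rw [surjective_deltaMap_iff] at hsurj
    refine ⟨(injective_deltaMap_iff _).2 fun θ ℓ hθ => ?_,
      (surjective_deltaMap_iff _).2 fun η => ?_⟩
    · refine hinj θ (ℓ ∘L (e.symm : L →L[𝕜] L')) fun x y => ?_
      have := hθ (e.symm x) (e.symm y)
      rw [← he'] at this
      refine Eq.trans ?_ this
      change _ = θ (ω (e (e.symm x)) (e (e.symm y)))
      rw [e.apply_symm_apply, e.apply_symm_apply]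
    · have hη : η.1.compl₁₂ (e.symm : L →ₗ[𝕜] L') (e.symm : L →ₗ[𝕜] L') ∈
          contCocycles 𝕜 L W := by
        refine ⟨fun x => η.2.1 _, fun x y z => ?_, η.2.2.2.comp hcont'⟩
        change η.1 (e.symm ⁅x, y⁆) (e.symm z) + η.1 (e.symm ⁅y, z⁆) (e.symm x) +
          η.1 (e.symm ⁅z, x⁆) (e.symm y) = 0
        rw [he', he', he']
        exact η.2.2.1 _ _ _
      obtain ⟨θ, ℓ, hθ⟩ := hsurj ⟨_, hη⟩
      refine ⟨θ, ℓ ∘L (e : L' →L[𝕜] L), fun x y => ?_⟩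
      have := hθ (e x) (e y)
      rw [← he] at this
      refine Eq.trans ?_ this
      change _ = η.1 (e.symm (e x)) (e.symm (e y))
      rw [e.symm_apply_apply, e.symm_apply_apply]
  refine ⟨hmem, hweak, hweak.isClassicallyUniversal ?_⟩
  -- Perfectness of `L` is carried to `L'` by the image of the span of brackets under `e.symm`.
  have hmap := congrArg (Submodule.map (e.symm : L →ₗ[𝕜] L')) hL
  rw [Submodule.map_span, Submodule.map_top] at hmap
  have hrange : LinearMap.range (e.symm : L →ₗ[𝕜] L') = ⊤ :=
    LinearMap.range_eq_top.2 e.symm.surjective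
  rw [eq_top_iff, ← hrange, ← hmap]
  refine Submodule.span_mono ?_
  rintro _ ⟨_, ⟨x, y, rfl⟩, rfl⟩
  exact ⟨e.symm x, e.symm y, he' x y⟩

end Cohomology

/-! ### Continuous linear maps on Kähler differentials -/

section Kaehler

variable {𝕜 B W : Type*} [RCLike 𝕜] [CommRing B] [Algebra 𝕜 B] [AddCommGroup W] [Module 𝕜 W]

lemma kaehler_induction {p : Ω[B⁄𝕜] → Prop} (hD : ∀ b, p (KaehlerDifferential.D 𝕜 B b))
    (hzero : p 0) (hadd : ∀ s t, p s → p t → p (s + t)) (hsmul : ∀ (b : B) t, p t → p (b • t))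
    (t : Ω[B⁄𝕜]) : p t := by
  have ht : t ∈ Submodule.span B (Set.range (KaehlerDifferential.D 𝕜 B)) := by
    rw [KaehlerDifferential.span_range_derivation]; trivial
  induction ht using Submodule.span_induction with
  | mem x h => obtain ⟨b, rfl⟩ := h; exact hD b
  | zero => exact hzero
  | add s t _ _ hs ht => exact hadd s t hs ht
  | smul b t _ ht => exact hsmul b t ht

/-- A bilinear map on `B × B` that is a derivation in the second variable, in the sense that
`g (a, bc) = g (ab, c) + g (ac, b)`, defines a linear map on the Kähler differentials. -/
lemma exists_linearMap_kaehler (g : B →ₗ[𝕜] B →ₗ[𝕜] W)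
    (hg : ∀ a b c, g a (b * c) = g (a * b) c + g (a * c) b) :
    ∃ f : Ω[B⁄𝕜] →ₗ[𝕜] W, ∀ a b, f (a • KaehlerDifferential.D 𝕜 B b) = g a b := by
  -- With the action `(b • φ)(a) = φ(ba)` on linear maps `B → W`, the hypothesis on `g` says that `b
  -- ↦ g(·, b)` is a derivation. Its lift to the differentials, evaluated at `1`, is the required
  -- map.
  let _ : Module B (B →ₗ[𝕜] W) :=
    { smul := fun b φ => φ ∘ₗ LinearMap.mulLeft 𝕜 b
      one_smul := fun φ => LinearMap.ext fun a => congrArg φ (one_mul a)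
      mul_smul := fun b c φ => LinearMap.ext fun a => congrArg φ (by
        change b * c * a = c * (b * a); ring)
      smul_zero := fun _ => rfl
      smul_add := fun _ _ _ => rfl
      add_smul := fun b c φ => LinearMap.ext fun a => by
        change φ ((b + c) * a) = φ (b * a) + φ (c * a)
        rw [add_mul, map_add]
      zero_smul := fun φ => LinearMap.ext fun a => by
        change φ (0 * a) = 0
        rw [zero_mul, map_zero] }
  have hsm : ∀ (b : B) (φ : B →ₗ[𝕜] W) (a : B), (b • φ) a = φ (b * a) := fun _ _ _ => rfl
  have : IsScalarTower 𝕜 B (B →ₗ[𝕜] W) := ⟨fun c b φ => LinearMap.ext fun a => by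
    rw [hsm, LinearMap.smul_apply, hsm, smul_mul_assoc, map_smul]⟩
  let T : Derivation 𝕜 B (B →ₗ[𝕜] W) := Derivation.mk' g.flip fun b c => LinearMap.ext fun a => by
    rw [LinearMap.add_apply, hsm, hsm]
    change g a (b * c) = g (b * a) c + g (c * a) b
    rw [hg, mul_comm b a, mul_comm c a]
  refine ⟨LinearMap.applyₗ (1 : B) ∘ₗ T.liftKaehlerDifferential.restrictScalars 𝕜, fun a b => ?_⟩
  change T.liftKaehlerDifferential (a • KaehlerDifferential.D 𝕜 B b) 1 = g a b
  rw [map_smul, Derivation.liftKaehlerDifferential_comp_D, hsm, mul_one]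
  rfl

namespace TopKaehler

lemma induction {p : TopKaehler 𝕜 B → Prop} (hD : ∀ b, p (D 𝕜 B b)) (hzero : p 0)
    (hadd : ∀ s t, p s → p t → p (s + t)) (hsmul : ∀ (b : B) t, p t → p (b • t))
    (t : TopKaehler 𝕜 B) : p t :=
  kaehler_induction hD hzero hadd hsmul t

/-- The action `B × Ω → Ω` as a bilinear map. -/
def action (𝕜 B : Type*) [RCLike 𝕜] [CommRing B] [Algebra 𝕜 B] :
    B →ₗ[𝕜] Ω[B⁄𝕜] →ₗ[𝕜] Ω[B⁄𝕜] :=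
  (Algebra.lsmul 𝕜 𝕜 Ω[B⁄𝕜]).toLinearMap

variable [TopologicalSpace B]

/-- The `B`-linear maps on the topologized Kähler differentials that correspond to continuous
derivations are continuous. -/
lemma continuous_of_continuous_comp_D {X : Type*} [AddCommGroup X] [Module 𝕜 X] [Module B X]
    [IsScalarTower 𝕜 B X] [TopologicalSpace X] [PolynormableSpace 𝕜 X] [ContinuousSMul B X]
    (f : TopKaehler 𝕜 B →ₗ[B] X) (hf : Continuous fun b => f (D 𝕜 B b)) : Continuous f := by
  rw [continuous_iff_le_induced]
  exact sInf_le ⟨PolynormableSpace.induced (f.restrictScalars 𝕜), continuousSMul_induced f,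
    continuous_induced_rng.2 hf⟩

/-- The seminorms on the Kähler differentials that satisfy an estimate
`s (a db) ≤ P(a) Q(b)` with continuous seminorms `P` and `Q`. -/
abbrev DiffSeminorm (𝕜 B : Type*) [RCLike 𝕜] [CommRing B] [Algebra 𝕜 B] [TopologicalSpace B] :=
  {s : Seminorm 𝕜 Ω[B⁄𝕜] // ∃ P Q : Seminorm 𝕜 B, Continuous P ∧ Continuous Q ∧
    ∀ a b, s (a • KaehlerDifferential.D 𝕜 B b) ≤ P a * Q b}

variable [ContinuousMul B] [PolynormableSpace 𝕜 B]

/-- The new seminorm is `t ↦ sup s(u t)` over `u` in the unit ball of `P₁`, where `P(ab) ≤ P₁(a)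
P₂(b)`. On `a db` it is at most `P₂(a) Q(b)`, so the supremum is finite and again admissible. This
makes the module action jointly continuous for the topology of all such seminorms. -/
lemma DiffSeminorm.exists_action_le (s : DiffSeminorm 𝕜 B) :
    ∃ (P : Seminorm 𝕜 B) (s' : DiffSeminorm 𝕜 B), Continuous P ∧
      ∀ b t, s.1 (action 𝕜 B b t) ≤ P b * s'.1 t := by
  obtain ⟨s, P, Q, hP, hQ, hs⟩ := s
  obtain ⟨P₁, P₂, hP₁, hP₂, hmul⟩ := exists_seminorm_bound_of_continuous P (LinearMap.mul 𝕜 B)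
    (hP.comp continuous_mul)
  have hmul' : ∀ a b, P (a * b) ≤ P₁ a * P₂ b := hmul
  let F : {b : B // P₁ b ≤ 1} → Seminorm 𝕜 Ω[B⁄𝕜] := fun b => s.comp (action 𝕜 B b)
  have hFapp : ∀ b t, F b t = s (b.1 • t) := fun _ _ => rfl
  have key : ∀ a b (u : {b : B // P₁ b ≤ 1}),
      s (u.1 • a • KaehlerDifferential.D 𝕜 B b) ≤ P₂ a * Q b := fun a b u => by
    rw [smul_smul]
    refine (hs _ _).trans (mul_le_mul_of_nonneg_right ?_ (apply_nonneg Q b))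
    refine (hmul' _ _).trans ?_
    exact mul_le_of_le_one_left (apply_nonneg P₂ a) u.2
  have hbdd : BddAbove (Set.range F) := by
    rw [Seminorm.bddAbove_range_iff]
    -- The extra factor `a` is needed for the induction over the `B`-module generated by the `db`.
    have h : ∀ t : Ω[B⁄𝕜], ∀ a : B, ∃ C, ∀ u : {b : B // P₁ b ≤ 1}, s (u.1 • a • t) ≤ C := by
      intro t
      induction t using kaehler_induction with
      | hD b => exact fun a => ⟨_, key a b⟩
      | hzero => exact fun a => ⟨0, fun u => by simp⟩
      | hadd t t' ht ht' =>
        intro a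
        obtain ⟨C, hC⟩ := ht a
        obtain ⟨C', hC'⟩ := ht' a
        refine ⟨C + C', fun u => ?_⟩
        rw [smul_add, smul_add]
        exact (map_add_le_add _ _ _).trans (add_le_add (hC u) (hC' u))
      | hsmul b t ht =>
        intro a
        obtain ⟨C, hC⟩ := ht (a * b)
        exact ⟨C, fun u => by rw [smul_smul a b t]; exact hC u⟩
    intro t
    obtain ⟨C, hC⟩ := h t 1
    refine ⟨C, ?_⟩
    rintro _ ⟨u, rfl⟩
    have := hC u
    rwa [one_smul] at this
  have hsup : ∀ t, (⨆ u, F u) t = ⨆ u, F u t := fun t => Seminorm.iSup_apply hbdd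
  have hne : Nonempty {b : B // P₁ b ≤ 1} := ⟨0, by rw [map_zero]; exact zero_le_one⟩
  refine ⟨P₁, ⟨⨆ u, F u, P₂, Q, hP₂, hQ, fun a b => ?_⟩, hP₁, ?_⟩
  · rw [hsup]
    exact ciSup_le (key a b)
  · refine le_mul_of_le_one_of_lt_one P₁ (⨆ u, F u) s (action 𝕜 B) fun b t hb ht => ?_
    refine le_trans ?_ ht.le
    rw [hsup]
    exact le_ciSup (f := fun u => F u t) ((Seminorm.bddAbove_range_iff.1 hbdd) t) ⟨b, hb.le⟩

variable [IsTopologicalAddGroup B]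

/-- A linear map `f` on the topologized Kähler differentials is continuous if `(a, b) ↦ f (a db)`
is jointly continuous. -/
lemma continuous_of_continuous_smul_D [TopologicalSpace W] [PolynormableSpace 𝕜 W]
    (f : TopKaehler 𝕜 B →ₗ[𝕜] W) (hf : Continuous fun z : B × B => f (z.1 • D 𝕜 B z.2)) :
    Continuous f := by
  let fam : SeminormFamily 𝕜 Ω[B⁄𝕜] (DiffSeminorm 𝕜 B) := fun s => s.1
  -- The topology of all `DiffSeminorm`s is locally convex with continuous action and continuous
  -- `D`, so the topology of `TopKaehler` is at least as fine. For it `f` is continuous, because `p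
  -- ∘ f` is itself such a seminorm for each continuous seminorm `p`.
  let _ : TopologicalSpace Ω[B⁄𝕜] := fam.moduleFilterBasis.topology
  have hfam : WithSeminorms fam := ⟨rfl⟩
  have : PolynormableSpace 𝕜 Ω[B⁄𝕜] := hfam.toPolynormableSpace
  have : IsTopologicalAddGroup Ω[B⁄𝕜] := hfam.topologicalAddGroup
  have : ContinuousSMul B Ω[B⁄𝕜] := ⟨by
    refine continuous_bilinear_of_seminorm_bound hfam (action 𝕜 B) fun s => ?_
    obtain ⟨P, s', hP, h⟩ := s.exists_action_le
    exact ⟨P, s'.1, hP, hfam.continuous_seminorm s', h⟩⟩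
  let i : TopKaehler 𝕜 B →ₗ[B] Ω[B⁄𝕜] := LinearMap.id
  let f₁ : Ω[B⁄𝕜] →ₗ[𝕜] W := f
  have hid : Continuous i := by
    refine continuous_of_continuous_comp_D _ ?_
    refine hfam.continuous_of_continuous_comp (KaehlerDifferential.D 𝕜 B : B →ₗ[𝕜] Ω[B⁄𝕜])
      fun s => ?_
    obtain ⟨P, Q, hP, hQ, h⟩ := s.2
    let c : NNReal := ⟨P 1, apply_nonneg P 1⟩
    refine Seminorm.continuous_of_le (q := c • Q) (hQ.const_smul c) fun b => ?_
    have := h 1 b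
    rw [one_smul] at this
    exact this
  have hf₁ : Continuous f₁ := by
    refine (PolynormableSpace.withSeminorms 𝕜 W).continuous_of_continuous_comp
      f₁ fun p => ?_
    let g : B →ₗ[𝕜] B →ₗ[𝕜] W :=
      ((action 𝕜 B).compl₂ (KaehlerDifferential.D 𝕜 B : B →ₗ[𝕜] Ω[B⁄𝕜])).compr₂
        f₁
    obtain ⟨P, Q, hP, hQ, h⟩ := exists_seminorm_bound_of_continuous p.1 g (p.2.comp hf)
    exact hfam.continuous_seminorm
      (⟨p.1.comp f₁, P, Q, hP, hQ, h⟩ : DiffSeminorm 𝕜 B)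
  exact hf₁.comp hid

end TopKaehler

/-! ### The universal property of differentials modulo exact forms -/

section DiffQuotient

variable [TopologicalSpace B]

lemma adb_apply (a b : B) : adb 𝕜 B a b = (exactForms 𝕜 B).mkQ (a • univD 𝕜 B b) := rfl

lemma adb_mul_right (a b c : B) : adb 𝕜 B a (b * c) = adb 𝕜 B (a * b) c + adb 𝕜 B (a * c) b := by
  have h : univD 𝕜 B (b * c) = b • univD 𝕜 B c + c • univD 𝕜 B b := by
    change ((TopKaehler.D 𝕜 B (b * c) : TopKaehler 𝕜 B) : DiffModule 𝕜 B) = _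
    rw [Derivation.leibniz, UniformSpace.Completion.coe_add, UniformSpace.Completion.coe_smul,
      UniformSpace.Completion.coe_smul]
    rfl
  rw [adb_apply, adb_apply, adb_apply, h, smul_add, map_add, smul_smul, smul_smul]

lemma adb_one_left (b : B) : adb 𝕜 B 1 b = 0 := by
  rw [adb_apply, one_smul, Submodule.mkQ_apply, Submodule.Quotient.mk_eq_zero]
  exact Submodule.le_topologicalClosure _ ⟨b, rfl⟩

/-- Integration by parts: `a db + b da = d(ab)` is exact. -/
lemma adb_skew (a b : B) : adb 𝕜 B a b = -adb 𝕜 B b a := by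
  have h := adb_mul_right (𝕜 := 𝕜) 1 a b
  rw [adb_one_left, one_mul, one_mul] at h
  exact eq_neg_of_add_eq_zero_left h.symm

lemma continuous_adb : Continuous fun z : B × B => adb 𝕜 B z.1 z.2 := by
  have h : Continuous fun z : B × B =>
      ((z.1 • TopKaehler.D 𝕜 B z.2 : TopKaehler 𝕜 B) : DiffModule 𝕜 B) :=
    (UniformSpace.Completion.continuous_coe _).comp
      (continuous_fst.smul ((TopKaehler.continuous_D 𝕜 B).comp continuous_snd))
  refine ((exactForms 𝕜 B).mkQL.continuous.comp h).congr fun z => ?_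
  rw [adb_apply, Submodule.coe_mkQL, Function.comp_apply, UniformSpace.Completion.coe_smul]
  rfl

lemma DiffQuotient.hom_ext [TopologicalSpace W] [T2Space W] {f g : DiffQuotient 𝕜 B →L[𝕜] W}
    (h : ∀ a b, f (adb 𝕜 B a b) = g (adb 𝕜 B a b)) : f = g := by
  refine ContinuousLinearMap.ext fun x => ?_
  obtain ⟨u, rfl⟩ := (exactForms 𝕜 B).mkQ_surjective x
  induction u using UniformSpace.Completion.induction_on with
  | hp =>
    exact isClosed_eq (f.continuous.comp (exactForms 𝕜 B).mkQL.continuous)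
      (g.continuous.comp (exactForms 𝕜 B).mkQL.continuous)
  | ih t =>
    let F (f : DiffQuotient 𝕜 B →L[𝕜] W) : TopKaehler 𝕜 B →ₗ[𝕜] W :=
      { toFun := fun t => f ((exactForms 𝕜 B).mkQ (t : DiffModule 𝕜 B))
        map_add' := fun s t => by rw [UniformSpace.Completion.coe_add, map_add, map_add]
        map_smul' := fun c t => by
          rw [UniformSpace.Completion.coe_smul, map_smul, map_smul]; rfl }
    have hF : ∀ (f : DiffQuotient 𝕜 B →L[𝕜] W) a b,
        F f (a • TopKaehler.D 𝕜 B b) = f (adb 𝕜 B a b) := fun f a b => by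
      change f ((exactForms 𝕜 B).mkQ _) = _
      rw [UniformSpace.Completion.coe_smul]
      rfl
    change F f t = F g t
    -- The maps are only `𝕜`-linear, so the statement is proved for all multiples `a • t` in order
    -- to pass the step `b • t` of the induction.
    have key : ∀ a : B, F f (a • t) = F g (a • t) := by
      induction t using TopKaehler.induction with
      | hD b => exact fun a => (hF f a b).trans ((h a b).trans (hF g a b).symm)
      | hzero => intro a; rw [smul_zero, map_zero, map_zero]
      | hadd s t hs ht => intro a; rw [smul_add, map_add, map_add, hs, ht]
      | hsmul b t ht => intro a; rw [smul_smul, ht]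
    simpa only [one_smul] using key 1

variable [IsTopologicalAddGroup B] [ContinuousMul B] [PolynormableSpace 𝕜 B]

/-- Continuous bilinear maps with the derivation property factor through `(a, b) ↦ [a · d b]`. -/
lemma exists_continuousLinearMap_diffQuotient [UniformSpace W] [IsUniformAddGroup W]
    [PolynormableSpace 𝕜 W] [T2Space W] [CompleteSpace W] (g : B →ₗ[𝕜] B →ₗ[𝕜] W)
    (hg : ∀ a b c, g a (b * c) = g (a * b) c + g (a * c) b) (hg1 : ∀ b, g 1 b = 0)
    (hcont : Continuous fun z : B × B => g z.1 z.2) :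
    ∃ f : DiffQuotient 𝕜 B →L[𝕜] W, ∀ a b, f (adb 𝕜 B a b) = g a b := by
  have := (PolynormableSpace.withSeminorms 𝕜 W).continuousSMul
  obtain ⟨f, hf⟩ := exists_linearMap_kaehler g hg
  let f₁ : TopKaehler 𝕜 B →ₗ[𝕜] W := f
  have hfc : Continuous f₁ := TopKaehler.continuous_of_continuous_smul_D f₁
    (hcont.congr fun z => (hf z.1 z.2).symm)
  let f' : TopKaehler 𝕜 B →+ W := f₁.toAddMonoidHom
  have hfu : UniformContinuous f' := uniformContinuous_addMonoidHom_of_continuous hfc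
  have hext : ∀ t : TopKaehler 𝕜 B, UniformSpace.Completion.extension f' t = f t :=
    UniformSpace.Completion.extension_coe hfu
  have hc : Continuous (UniformSpace.Completion.extension f') :=
    UniformSpace.Completion.continuous_extension
  let φ : DiffModule 𝕜 B →L[𝕜] W :=
    { toFun := UniformSpace.Completion.extension f'
      map_add' := fun u v => by
        induction u, v using UniformSpace.Completion.induction_on₂ with
        | hp => exact isClosed_eq (by fun_prop) (by fun_prop)
        | ih u v =>
          rw [← UniformSpace.Completion.coe_add, hext, hext, hext]
          exact map_add f u v
      map_smul' := fun c u => by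
        induction u using UniformSpace.Completion.induction_on with
        | hp => exact isClosed_eq (hc.comp (continuous_const_smul c)) (hc.const_smul c)
        | ih u =>
          rw [← UniformSpace.Completion.coe_smul, hext, hext]
          exact map_smul f c u
      cont := hc }
  have hφ : ∀ a b, φ (a • univD 𝕜 B b) = g a b := fun a b => by
    have : a • univD 𝕜 B b =
        ((a • TopKaehler.D 𝕜 B b : TopKaehler 𝕜 B) : DiffModule 𝕜 B) := by
      rw [UniformSpace.Completion.coe_smul]; rfl
    rw [this]
    exact (hext _).trans (hf a b)
  refine ⟨(exactForms 𝕜 B).liftQL φ ?_, fun a b => hφ a b⟩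
  -- The kernel of `φ` is closed and contains the exact forms, since `g(1, b) = 0`.
  refine Submodule.topologicalClosure_minimal _ ?_ (isClosed_singleton.preimage φ.continuous)
  rintro _ ⟨b, rfl⟩
  have := hφ 1 b
  rw [one_smul, hg1] at this
  exact this

end DiffQuotient

end Kaehler

/-! ### The unitalization -/

section Unitization

variable {𝕜 A : Type*} [RCLike 𝕜] [NonUnitalCommRing A] [Module 𝕜 A] [IsScalarTower 𝕜 A A]
  [SMulCommClass 𝕜 A A]

namespace TopUnitization

/-- The identification of the unitization with `𝕜 × A`. -/
def toProd (𝕜 A : Type*) [RCLike 𝕜] [NonUnitalCommRing A] [Module 𝕜 A] [IsScalarTower 𝕜 A A]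
    [SMulCommClass 𝕜 A A] : TopUnitization 𝕜 A →ₗ[𝕜] 𝕜 × A where
  toFun u := Unitization.toProd u
  map_add' _ _ := rfl
  map_smul' _ _ := rfl

/-- The projection `A₁ → A`. -/
def snd (𝕜 A : Type*) [RCLike 𝕜] [NonUnitalCommRing A] [Module 𝕜 A] [IsScalarTower 𝕜 A A]
    [SMulCommClass 𝕜 A A] : TopUnitization 𝕜 A →ₗ[𝕜] A :=
  LinearMap.snd 𝕜 𝕜 A ∘ₗ toProd 𝕜 A

lemma snd_toUnitization (a : A) : snd 𝕜 A (toUnitization 𝕜 A a) = a := rfl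

lemma snd_one : snd 𝕜 A 1 = 0 := rfl

lemma snd_mul (u v : TopUnitization 𝕜 A) : snd 𝕜 A (u * v) =
    (toProd 𝕜 A u).1 • snd 𝕜 A v + (toProd 𝕜 A v).1 • snd 𝕜 A u + snd 𝕜 A u * snd 𝕜 A v :=
  Unitization.snd_mul (R := 𝕜) (A := A) u v

lemma eq_smul_one_add (u : TopUnitization 𝕜 A) :
    u = (toProd 𝕜 A u).1 • (1 : TopUnitization 𝕜 A) + toUnitization 𝕜 A (snd 𝕜 A u) := by
  refine Unitization.ext ?_ ?_
  · change _ = (toProd 𝕜 A u).1 • (1 : 𝕜) + 0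
    rw [smul_eq_mul, mul_one, add_zero]; rfl
  · change _ = (toProd 𝕜 A u).1 • (0 : A) + snd 𝕜 A u
    rw [smul_zero, zero_add]; rfl

lemma toUnitization_mul (a b : A) :
    toUnitization 𝕜 A (a * b) = toUnitization 𝕜 A a * toUnitization 𝕜 A b :=
  Unitization.inr_mul 𝕜 a b

variable [TopologicalSpace A]

lemma continuous_toProd : Continuous (toProd 𝕜 A) := continuous_induced_dom

lemma continuous_snd : Continuous (snd 𝕜 A) := _root_.continuous_snd.comp continuous_toProd

lemma continuous_toUnitization : Continuous (toUnitization 𝕜 A) :=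
  continuous_induced_rng.2 (continuous_const.prodMk continuous_id)

instance [PolynormableSpace 𝕜 A] : PolynormableSpace 𝕜 (TopUnitization 𝕜 A) :=
  PolynormableSpace.induced (toProd 𝕜 A)

instance [PolynormableSpace 𝕜 A] : IsTopologicalAddGroup (TopUnitization 𝕜 A) :=
  (PolynormableSpace.withSeminorms 𝕜 (TopUnitization 𝕜 A)).topologicalAddGroup

instance [ContinuousAdd A] [ContinuousSMul 𝕜 A] [ContinuousMul A] :
    ContinuousMul (TopUnitization 𝕜 A) where
  continuous_mul := by
    have h1 : Continuous fun z : TopUnitization 𝕜 A × TopUnitization 𝕜 A => (toProd 𝕜 A z.1) :=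
      continuous_toProd.comp continuous_fst
    have h2 : Continuous fun z : TopUnitization 𝕜 A × TopUnitization 𝕜 A => (toProd 𝕜 A z.2) :=
      continuous_toProd.comp _root_.continuous_snd
    exact continuous_induced_rng.2 ((h1.fst.mul h2.fst).prodMk
      (((h1.fst.smul h2.snd).add (h2.fst.smul h1.snd)).add (h1.snd.mul h2.snd)))

end TopUnitization

variable [TopologicalSpace A]

/-- Scalars contribute nothing: `[1 · dv]` is exact, and `[u · d1]` vanishes by skewness. Hence
elements of `A` alone give all values `[u dv]`. -/
lemma adb_unitization (u v : TopUnitization 𝕜 A) :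
    adb 𝕜 (TopUnitization 𝕜 A) u v = adb 𝕜 (TopUnitization 𝕜 A)
      (toUnitization 𝕜 A (TopUnitization.snd 𝕜 A u))
      (toUnitization 𝕜 A (TopUnitization.snd 𝕜 A v)) := by
  have h : ∀ w, adb 𝕜 (TopUnitization 𝕜 A) w 1 = 0 := fun w => by
    rw [adb_skew, adb_one_left, neg_zero]
  conv_lhs => rw [TopUnitization.eq_smul_one_add u, TopUnitization.eq_smul_one_add v]
  simp only [map_add, map_smul, LinearMap.add_apply, LinearMap.smul_apply, h, adb_one_left,
    smul_zero, zero_add]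

end Unitization

/-! ### The universal invariant symmetric form -/

section Kappa

variable {𝕜 𝔤 : Type*} [RCLike 𝕜] [LieRing 𝔤] [LieAlgebra 𝕜 𝔤] [TopologicalSpace 𝔤]

lemma kappa_symm (x y : 𝔤) : kappa 𝕜 𝔤 x y = kappa 𝕜 𝔤 y x :=
  (Submodule.Quotient.eq _).2 (Submodule.le_topologicalClosure _
    (Submodule.subset_span (Or.inl ⟨x, y, rfl⟩)))

lemma kappa_lie (x y z : 𝔤) : kappa 𝕜 𝔤 ⁅x, y⁆ z = kappa 𝕜 𝔤 x ⁅y, z⁆ :=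
  (Submodule.Quotient.eq _).2 (Submodule.le_topologicalClosure _
    (Submodule.subset_span (Or.inr ⟨x, y, z, rfl⟩)))

lemma kappa_induction {p : InvariantSpace 𝕜 𝔤 → Prop} (hk : ∀ x y, p (kappa 𝕜 𝔤 x y))
    (h0 : p 0) (hadd : ∀ u v, p u → p v → p (u + v)) (v : InvariantSpace 𝕜 𝔤) : p v := by
  obtain ⟨t, rfl⟩ := (invariantRelations 𝕜 𝔤).topologicalClosure.mkQ_surjective v
  induction t using ProjTensor.ind with
  | h0 => rwa [map_zero]
  | hmk x y => exact hk x y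
  | hadd s t hs ht => rw [map_add]; exact hadd _ _ hs ht

instance [FiniteDimensional 𝕜 𝔤] : FiniteDimensional 𝕜 (ProjTensor 𝕜 𝔤 𝔤) :=
  inferInstanceAs (FiniteDimensional 𝕜 (𝔤 ⊗[𝕜] 𝔤))

instance : T2Space (InvariantSpace 𝕜 𝔤) := by
  have : IsClosed ((invariantRelations 𝕜 𝔤).topologicalClosure : Set (ProjTensor 𝕜 𝔤 𝔤)) :=
    (invariantRelations 𝕜 𝔤).isClosed_topologicalClosure
  have := Submodule.t3_quotient_of_isClosed (invariantRelations 𝕜 𝔤).topologicalClosure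
  infer_instance

/-- The universal property of `V_𝔤 ⊗ E` for invariant symmetric bilinear forms on `𝔤` with values
in the continuous linear maps on `E`. -/
lemma exists_continuousLinearMap_invariantSpace [FiniteDimensional 𝕜 𝔤] [IsTopologicalAddGroup 𝔤]
    [ContinuousSMul 𝕜 𝔤] [T2Space 𝔤] {E W : Type*} [AddCommGroup E] [Module 𝕜 E]
    [TopologicalSpace E] [AddCommGroup W] [Module 𝕜 W] [TopologicalSpace W]
    [IsTopologicalAddGroup W] [ContinuousSMul 𝕜 W] [PolynormableSpace 𝕜 W] [T2Space W]
    (F : 𝔤 →ₗ[𝕜] 𝔤 →ₗ[𝕜] (E →L[𝕜] W)) (hsymm : ∀ x y, F x y = F y x)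
    (hinv : ∀ x y z, F ⁅x, y⁆ z = F x ⁅y, z⁆) :
    ∃ θ : ProjTensor 𝕜 (InvariantSpace 𝕜 𝔤) E →L[𝕜] W,
      ∀ x y d, θ (ProjTensor.mk 𝕜 _ _ (kappa 𝕜 𝔤 x y) d) = F x y d := by
  let Φ : ProjTensor 𝕜 𝔤 𝔤 →ₗ[𝕜] (E →L[𝕜] W) := ProjTensor.lift F
  have hΦ : ∀ d, Continuous fun t => Φ t d := fun d => by
    let ev : (E →L[𝕜] W) →ₗ[𝕜] W := LinearMap.applyₗ d ∘ₗ ContinuousLinearMap.coeLM 𝕜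
    refine ProjTensor.continuous_of_continuous_mk (ev ∘ₗ Φ) ?_
    let b := Module.finBasis 𝕜 𝔤
    have h : (fun z : 𝔤 × 𝔤 => (ev ∘ₗ Φ) (ProjTensor.mk 𝕜 𝔤 𝔤 z.1 z.2)) =
        fun z => ∑ i, b.coord i z.1 • (ev ∘ₗ F (b i)) z.2 := by
      funext z
      change ev (F z.1 z.2) = _
      conv_lhs => rw [← b.sum_repr z.1, map_sum]
      simp
    rw [h]
    exact continuous_finsetSum _ fun i _ =>
      ((LinearMap.continuous_of_finiteDimensional (b.coord i)).comp continuous_fst).smul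
        ((LinearMap.continuous_of_finiteDimensional (ev ∘ₗ F (b i))).comp continuous_snd)
  -- The continuous linear maps on `E` carry no topology here; the kernel of `Φ` is closed as the
  -- intersection of the kernels of the continuous maps `t ↦ Φ t d`.
  have hle : (invariantRelations 𝕜 𝔤).topologicalClosure ≤ LinearMap.ker Φ := by
    have hclosed : IsClosed (LinearMap.ker Φ : Set (ProjTensor 𝕜 𝔤 𝔤)) := by
      have : (LinearMap.ker Φ : Set (ProjTensor 𝕜 𝔤 𝔤)) = ⋂ d, {t | Φ t d = 0} := by
        ext t
        simp only [SetLike.mem_coe, LinearMap.mem_ker, Set.mem_iInter, Set.mem_ofPred_eq]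
        exact DFunLike.ext_iff
      rw [this]
      exact isClosed_iInter fun d => isClosed_eq (hΦ d) continuous_const
    refine Submodule.topologicalClosure_minimal _ (Submodule.span_le.2 ?_) hclosed
    rintro _ (⟨x, y, rfl⟩ | ⟨x, y, z, rfl⟩)
    · rw [SetLike.mem_coe, LinearMap.mem_ker, map_sub, sub_eq_zero]
      exact hsymm x y
    · rw [SetLike.mem_coe, LinearMap.mem_ker, map_sub, sub_eq_zero]
      exact hinv x y z
  let Ψ : InvariantSpace 𝕜 𝔤 →ₗ[𝕜] (E →L[𝕜] W) := Submodule.liftQ _ Φ hle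
  let θ : ProjTensor 𝕜 (InvariantSpace 𝕜 𝔤) E →ₗ[𝕜] W :=
    ProjTensor.lift (ContinuousLinearMap.coeLM 𝕜 ∘ₗ Ψ)
  refine ⟨⟨θ, ProjTensor.continuous_of_continuous_mk θ ?_⟩, fun x y d => rfl⟩
  -- Finite dimension of the invariant space reduces joint continuity to continuity of the finitely
  -- many maps `Ψ (b i)` and of the coordinates.
  let b := Module.finBasis 𝕜 (InvariantSpace 𝕜 𝔤)
  have h : (fun z : InvariantSpace 𝕜 𝔤 × E => θ (ProjTensor.mk 𝕜 _ _ z.1 z.2)) =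
      fun z => ∑ i, b.coord i z.1 • Ψ (b i) z.2 := by
    funext z
    change Ψ z.1 z.2 = _
    conv_lhs => rw [← b.sum_repr z.1, map_sum]
    simp
  rw [h]
  exact continuous_finsetSum _ fun i _ =>
    ((LinearMap.continuous_of_finiteDimensional (b.coord i)).comp continuous_fst).smul
      ((Ψ (b i)).continuous.comp continuous_snd)

end Kappa

/-! ### The Maier cocycle: cocycle property, continuity and injectivity -/

section MaierCocycle

variable {𝕜 A 𝔤 : Type*} [RCLike 𝕜] [NonUnitalCommRing A] [Module 𝕜 A] [IsScalarTower 𝕜 A A]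
  [SMulCommClass 𝕜 A A] [LieRing 𝔤] [LieAlgebra 𝕜 𝔤]

lemma lie_mk (a b : A) (x y : 𝔤) :
    ⁅ProjTensor.mk 𝕜 A 𝔤 a x, ProjTensor.mk 𝕜 A 𝔤 b y⁆ = ProjTensor.mk 𝕜 A 𝔤 (a * b) ⁅x, y⁆ :=
  rfl

/-- Perfectness of `𝔤` and a unit `e` for `a` give `a ⊗ [u, v] = [e ⊗ u, a ⊗ v]`. -/
lemma span_lie_current [FiniteDimensional 𝕜 𝔤] [LieAlgebra.IsKilling 𝕜 𝔤]
    (hU : ∀ a : A, ∃ e : A, e * a = a) :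
    Submodule.span 𝕜 {z : ProjTensor 𝕜 A 𝔤 | ∃ x y : ProjTensor 𝕜 A 𝔤, z = ⁅x, y⁆} = ⊤ := by
  rw [eq_top_iff]
  intro z _
  induction z using ProjTensor.ind with
  | h0 => exact zero_mem _
  | hadd u v hu hv => exact add_mem (hu trivial) (hv trivial)
  | hmk a y =>
    obtain ⟨e, he⟩ := hU a
    obtain ⟨n, u, v, rfl⟩ := exists_sum_lie 𝕜 y
    rw [map_sum]
    refine sum_mem fun i _ => Submodule.subset_span
      ⟨ProjTensor.mk 𝕜 A 𝔤 e (u i), ProjTensor.mk 𝕜 A 𝔤 a (v i), ?_⟩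
    rw [lie_mk, he]

variable [TopologicalSpace A] [TopologicalSpace 𝔤]

lemma maierCocycle_skew (u v : ProjTensor 𝕜 A 𝔤) :
    maierCocycle 𝕜 A 𝔤 u v = -maierCocycle 𝕜 A 𝔤 v u := by
  induction u using ProjTensor.ind with
  | h0 => simp
  | hadd u w hu hw => simp only [map_add, LinearMap.add_apply, hu, hw, neg_add]
  | hmk a x =>
    induction v using ProjTensor.ind with
    | h0 => simp
    | hadd v w hv hw => simp only [map_add, LinearMap.add_apply, hv, hw, neg_add]
    | hmk b y =>
      rw [maierCocycle_mk, maierCocycle_mk, maierValue, maierValue, kappa_symm y x, adb_skew,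
        map_neg]

lemma maierCocycle_self (u : ProjTensor 𝕜 A 𝔤) : maierCocycle 𝕜 A 𝔤 u u = 0 := by
  have h := maierCocycle_skew u u
  rw [eq_neg_iff_add_eq_zero, ← two_smul 𝕜] at h
  exact (smul_eq_zero.1 h).resolve_left two_ne_zero

lemma maierCocycle_cyclic (u v w : ProjTensor 𝕜 A 𝔤) :
    maierCocycle 𝕜 A 𝔤 ⁅u, v⁆ w + maierCocycle 𝕜 A 𝔤 ⁅v, w⁆ u +
      maierCocycle 𝕜 A 𝔤 ⁅w, u⁆ v = 0 := by
  have hadd : ∀ a b c a' b' c' : MaierSpace 𝕜 A 𝔤, a + b + c = 0 → a' + b' + c' = 0 →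
      (a + a') + (b + b') + (c + c') = 0 := fun a b c a' b' c' h h' => by
    rw [add_add_add_comm a, add_add_add_comm (a + b), h, h', add_zero]
  induction u using ProjTensor.ind with
  | h0 => simp
  | hadd u u' hu hu' =>
    simp only [add_lie, lie_add, map_add, LinearMap.add_apply]
    exact hadd _ _ _ _ _ _ hu hu'
  | hmk a x =>
    induction v using ProjTensor.ind with
    | h0 => simp
    | hadd v v' hv hv' =>
      simp only [add_lie, lie_add, map_add, LinearMap.add_apply]
      exact hadd _ _ _ _ _ _ hv hv'
    | hmk b y =>
      induction w using ProjTensor.ind with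
      | h0 => simp
      | hadd w w' hw hw' =>
        simp only [add_lie, lie_add, map_add, LinearMap.add_apply]
        exact hadd _ _ _ _ _ _ hw hw'
      | hmk c z =>
        simp only [lie_mk, maierCocycle_mk, maierValue]
        -- Invariance and symmetry make the three `κ` factors equal. What remains is `ab dc + bc da
        -- + ca db`, which is the exact form `d(abc)`.
        have h1 : kappa 𝕜 𝔤 ⁅y, z⁆ x = kappa 𝕜 𝔤 ⁅x, y⁆ z := by rw [kappa_symm, kappa_lie]
        have h2 : kappa 𝕜 𝔤 ⁅z, x⁆ y = kappa 𝕜 𝔤 ⁅x, y⁆ z := by rw [kappa_lie, kappa_symm]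
        rw [h1, h2, ← map_add, ← map_add]
        simp only [TopUnitization.toUnitization_mul]
        set a' := toUnitization 𝕜 A a
        set b' := toUnitization 𝕜 A b
        set c' := toUnitization 𝕜 A c
        have h3 : adb 𝕜 (TopUnitization 𝕜 A) (a' * b') c' =
            -(adb 𝕜 (TopUnitization 𝕜 A) (c' * a') b' +
              adb 𝕜 (TopUnitization 𝕜 A) (b' * c') a') := by
          rw [adb_skew, adb_mul_right, mul_comm c' b']
        rw [h3]
        have : ∀ s t : DiffQuotient 𝕜 (TopUnitization 𝕜 A), -(s + t) + t + s = 0 :=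
          fun s t => by abel
        rw [this, map_zero]

lemma continuous_maierCocycle [FiniteDimensional 𝕜 𝔤] [IsTopologicalAddGroup 𝔤]
    [ContinuousSMul 𝕜 𝔤] [T2Space 𝔤] [PolynormableSpace 𝕜 A] :
    Continuous fun p : ProjTensor 𝕜 A 𝔤 × ProjTensor 𝕜 A 𝔤 => maierCocycle 𝕜 A 𝔤 p.1 p.2 := by
  refine ProjTensor.continuous_bilinear _ fun x y => ?_
  have h1 : Continuous fun z : A × A => (toUnitization 𝕜 A z.1, toUnitization 𝕜 A z.2) :=
    (TopUnitization.continuous_toUnitization.comp continuous_fst).prodMk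
      (TopUnitization.continuous_toUnitization.comp continuous_snd)
  have h2 := (continuous_adb (𝕜 := 𝕜) (B := TopUnitization 𝕜 A)).comp h1
  exact (ProjTensor.continuous_mk_right (kappa 𝕜 𝔤 x y)).comp h2

lemma maierCocycle_mem [FiniteDimensional 𝕜 𝔤] [IsTopologicalAddGroup 𝔤]
    [ContinuousSMul 𝕜 𝔤] [T2Space 𝔤] [PolynormableSpace 𝕜 A] :
    maierCocycle 𝕜 A 𝔤 ∈ contCocycles 𝕜 (ProjTensor 𝕜 A 𝔤) (MaierSpace 𝕜 A 𝔤) := by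
  refine ⟨?_, ?_, ?_⟩
  · exact maierCocycle_self
  · exact maierCocycle_cyclic
  · exact continuous_maierCocycle

lemma MaierSpace.hom_ext {W : Type*} [AddCommGroup W] [Module 𝕜 W] [TopologicalSpace W]
    [T2Space W] {θ θ' : MaierSpace 𝕜 A 𝔤 →L[𝕜] W}
    (h : ∀ a b x y, θ (maierValue 𝕜 A 𝔤 a b x y) = θ' (maierValue 𝕜 A 𝔤 a b x y)) : θ = θ' := by
  let F (θ : MaierSpace 𝕜 A 𝔤 →L[𝕜] W) (v : InvariantSpace 𝕜 𝔤) :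
      DiffQuotient 𝕜 (TopUnitization 𝕜 A) →L[𝕜] W :=
    θ ∘L ⟨ProjTensor.mk 𝕜 _ _ v, ProjTensor.continuous_mk_right v⟩
  have hF : ∀ v, F θ v = F θ' v := by
    intro v
    induction v using kappa_induction with
    | h0 =>
        refine ContinuousLinearMap.ext fun d => ?_
        change θ (ProjTensor.mk 𝕜 _ _ 0 d) = θ' (ProjTensor.mk 𝕜 _ _ 0 d)
        rw [map_zero, LinearMap.zero_apply, map_zero, map_zero]
    | hadd u v hu hv =>
        refine ContinuousLinearMap.ext fun d => ?_
        have hu' : θ (ProjTensor.mk 𝕜 _ _ u d) = θ' (ProjTensor.mk 𝕜 _ _ u d) :=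
          DFunLike.congr_fun hu d
        have hv' : θ (ProjTensor.mk 𝕜 _ _ v d) = θ' (ProjTensor.mk 𝕜 _ _ v d) :=
          DFunLike.congr_fun hv d
        change θ (ProjTensor.mk 𝕜 _ _ (u + v) d) = θ' (ProjTensor.mk 𝕜 _ _ (u + v) d)
        rw [map_add, LinearMap.add_apply, map_add, map_add, hu', hv']
    | hk x y =>
        refine DiffQuotient.hom_ext fun a b => ?_
        rw [adb_unitization]
        exact h _ _ x y
  refine ContinuousLinearMap.coe_injective (ProjTensor.ext_mk fun v d => ?_)
  exact DFunLike.congr_fun (hF v) d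

/-- Exchanging `x` and `y` fixes `κ(x, y)` and changes the sign of `[x, y]`, so every value of `θ`
on `maierValue` equals its own negative. -/
lemma injective_deltaMap_maierCocycle (hω : maierCocycle 𝕜 A 𝔤 ∈
      contCocycles 𝕜 (ProjTensor 𝕜 A 𝔤) (MaierSpace 𝕜 A 𝔤))
    {W : Type*} [AddCommGroup W] [Module 𝕜 W]
    [TopologicalSpace W] [IsTopologicalAddGroup W] [ContinuousSMul 𝕜 W] [T2Space W] :
    Function.Injective (deltaMap W (⟨maierCocycle 𝕜 A 𝔤, hω⟩ :
      contCocycles 𝕜 (ProjTensor 𝕜 A 𝔤) (MaierSpace 𝕜 A 𝔤))) := by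
  rw [injective_deltaMap_iff]
  intro θ ℓ h
  refine MaierSpace.hom_ext fun a b x y => ?_
  have h1 : θ (maierValue 𝕜 A 𝔤 a b x y) = ℓ (ProjTensor.mk 𝕜 A 𝔤 (a * b) ⁅x, y⁆) :=
    h (ProjTensor.mk 𝕜 A 𝔤 a x) (ProjTensor.mk 𝕜 A 𝔤 b y)
  have h2 : θ (maierValue 𝕜 A 𝔤 a b y x) = ℓ (ProjTensor.mk 𝕜 A 𝔤 (a * b) ⁅y, x⁆) :=
    h (ProjTensor.mk 𝕜 A 𝔤 a y) (ProjTensor.mk 𝕜 A 𝔤 b x)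
  rw [maierValue, kappa_symm] at h2
  have h3 : θ (maierValue 𝕜 A 𝔤 a b x y) = -θ (maierValue 𝕜 A 𝔤 a b x y) := by
    conv_lhs => rw [h1, ← lie_skew, map_neg, map_neg, ← h2]
    rfl
  rw [eq_neg_iff_add_eq_zero, ← two_smul 𝕜] at h3
  exact (smul_eq_zero.1 h3).resolve_left two_ne_zero

end MaierCocycle

/-! ### Cocycles on algebras with local units -/

section FormAt

variable {𝕜 A 𝔤 W : Type*} [RCLike 𝕜] [AddCommGroup A] [Module 𝕜 A] [LieRing 𝔤] [LieAlgebra 𝕜 𝔤]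
  [AddCommGroup W] [Module 𝕜 W]

/-- The bilinear form `(x, y) ↦ η (a ⊗ x, b ⊗ y)` on `𝔤`. -/
def formAt (η : ProjTensor 𝕜 A 𝔤 →ₗ[𝕜] ProjTensor 𝕜 A 𝔤 →ₗ[𝕜] W) (a b : A) :
    𝔤 →ₗ[𝕜] 𝔤 →ₗ[𝕜] W :=
  η.compl₁₂ (ProjTensor.mk 𝕜 A 𝔤 a) (ProjTensor.mk 𝕜 A 𝔤 b)

lemma formAt_apply (η : ProjTensor 𝕜 A 𝔤 →ₗ[𝕜] ProjTensor 𝕜 A 𝔤 →ₗ[𝕜] W) (a b : A) (x y : 𝔤) :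
    formAt η a b x y = η (ProjTensor.mk 𝕜 A 𝔤 a x) (ProjTensor.mk 𝕜 A 𝔤 b y) := rfl

end FormAt

section LocalUnits

variable {𝕜 A 𝔤 W : Type*} [RCLike 𝕜] [NonUnitalCommRing A] [Module 𝕜 A] [IsScalarTower 𝕜 A A]
  [SMulCommClass 𝕜 A A] [LieRing 𝔤] [LieAlgebra 𝕜 𝔤] [AddCommGroup W] [Module 𝕜 W]

/-- Any two elements of `A` have a common local unit. -/
def HasLocalUnits (A : Type*) [Mul A] : Prop := ∀ a b : A, ∃ e : A, e * a = a ∧ e * b = b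

/-- `E` is a local unit for a local unit for `b`. -/
def IsIteratedUnit (E b : A) : Prop := ∃ e : A, e * b = b ∧ E * e = e

lemma IsIteratedUnit.mul_eq {E b : A} (h : IsIteratedUnit E b) : E * b = b := by
  obtain ⟨e, he, hE⟩ := h
  rw [← he, ← mul_assoc, hE]

/-- In the cocycle identity for `E ⊗ x`, `E ⊗ x'`, `b ⊗ y` the bracket produces `E * E`; as another
iterated unit it may be exchanged for `E`. -/
lemma IsIteratedUnit.mul_self {E b : A} (h : IsIteratedUnit E b) : IsIteratedUnit (E * E) b := by
  obtain ⟨e, he, hE⟩ := h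
  exact ⟨e, he, by rw [mul_assoc, hE, hE]⟩

lemma HasLocalUnits.exists_isIteratedUnit₂ (hA : HasLocalUnits A) (a b : A) :
    ∃ E e : A, e * a = a ∧ e * b = b ∧ E * e = e := by
  obtain ⟨e, ha, hb⟩ := hA a b
  obtain ⟨E, hE, -⟩ := hA e e
  exact ⟨E, e, ha, hb, hE⟩

lemma HasLocalUnits.exists_isIteratedUnit (hA : HasLocalUnits A) (b : A) :
    ∃ E : A, IsIteratedUnit E b := by
  obtain ⟨E, e, h, -, hE⟩ := hA.exists_isIteratedUnit₂ b b
  exact ⟨E, e, h, hE⟩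

/-- An algebraic `2`-cocycle. -/
structure IsCocycle {L : Type*} [LieRing L] [LieAlgebra 𝕜 L] (η : L →ₗ[𝕜] L →ₗ[𝕜] W) : Prop where
  self : ∀ u, η u u = 0
  cyclic : ∀ u v w, η ⁅u, v⁆ w + η ⁅v, w⁆ u + η ⁅w, u⁆ v = 0

lemma IsCocycle.skew {L : Type*} [LieRing L] [LieAlgebra 𝕜 L] {η : L →ₗ[𝕜] L →ₗ[𝕜] W}
    (hη : IsCocycle η) (u v : L) : η u v = -η v u := by
  have h := hη.self (u + v)
  simp only [map_add, LinearMap.add_apply, hη.self, zero_add, add_zero] at h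
  rw [add_comm] at h
  exact eq_neg_of_add_eq_zero_left h

lemma IsCocycle.sub_coboundary {L : Type*} [LieRing L] [LieAlgebra 𝕜 L]
    {η η' : L →ₗ[𝕜] L →ₗ[𝕜] W} (hη : IsCocycle η) (ℓ : L →ₗ[𝕜] W)
    (h : ∀ u v, η' u v = η u v - ℓ ⁅u, v⁆) : IsCocycle η' where
  self u := by rw [h, hη.self, lie_self, map_zero, sub_zero]
  cyclic u v w := by
    have h1 := hη.cyclic u v w
    have h2 := congrArg ℓ (lie_lie_cyclic u v w)
    simp only [map_add, map_zero] at h2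
    rw [h, h, h]
    calc _ = (η ⁅u, v⁆ w + η ⁅v, w⁆ u + η ⁅w, u⁆ v) -
        (ℓ ⁅⁅u, v⁆, w⁆ + ℓ ⁅⁅v, w⁆, u⁆ + ℓ ⁅⁅w, u⁆, v⁆) := by abel
      _ = 0 := by rw [h1, h2, sub_zero]

variable {η : ProjTensor 𝕜 A 𝔤 →ₗ[𝕜] ProjTensor 𝕜 A 𝔤 →ₗ[𝕜] W}

/-- The cocycle vanishes on pairs `(E ⊗ x, b ⊗ y)` with an iterated unit `E` for `b`. -/
def IsNormalized (η : ProjTensor 𝕜 A 𝔤 →ₗ[𝕜] ProjTensor 𝕜 A 𝔤 →ₗ[𝕜] W) : Prop :=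
  ∀ E b, IsIteratedUnit E b → formAt η E b = 0

/-- Insert `E ⊗ y` with a common iterated unit `E` for `a` and `b` into the cocycle identity with `a
⊗ x` and `b ⊗ z`. The term that pairs `E` with `ab` vanishes by normalization, and the other two
express invariance. -/
lemma IsCocycle.formAt_invariant (hη : IsCocycle η) (hA : HasLocalUnits A)
    (hn : IsNormalized η) (a b : A) (x y z : 𝔤) :
    formAt η a b ⁅x, y⁆ z = formAt η a b x ⁅y, z⁆ := by
  obtain ⟨E, e, ha, hb, hE⟩ := hA.exists_isIteratedUnit₂ a b
  have hEa : E * a = a := IsIteratedUnit.mul_eq ⟨e, ha, hE⟩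
  have hEb : E * b = b := IsIteratedUnit.mul_eq ⟨e, hb, hE⟩
  have hab : formAt η E (a * b) = 0 := hn E (a * b) ⟨e, by rw [← mul_assoc, ha], hE⟩
  have h := hη.cyclic (ProjTensor.mk 𝕜 A 𝔤 E y) (ProjTensor.mk 𝕜 A 𝔤 a x)
    (ProjTensor.mk 𝕜 A 𝔤 b z)
  have h0 : η (ProjTensor.mk 𝕜 A 𝔤 E y) (ProjTensor.mk 𝕜 A 𝔤 (a * b) ⁅x, z⁆) = 0 := by
    rw [← formAt_apply, hab]; rfl
  rw [lie_mk, lie_mk, lie_mk, mul_comm b, hEa, hEb, hη.skew (ProjTensor.mk 𝕜 A 𝔤 (a * b) _), h0,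
    neg_zero, add_zero, hη.skew (ProjTensor.mk 𝕜 A 𝔤 b _), ← lie_skew y x, ← lie_skew z y] at h
  simp only [map_neg, LinearMap.neg_apply, neg_neg, neg_add_eq_zero] at h
  exact h

variable [FiniteDimensional 𝕜 𝔤] [LieAlgebra.IsKilling 𝕜 𝔤]

/-- The form `η (E ⊗ x, b ⊗ y)` does not depend on the choice of the iterated unit `E` for `b`. -/
lemma IsCocycle.formAt_eq (hη : IsCocycle η) {E E' b : A} (hE : IsIteratedUnit E b)
    (hE' : IsIteratedUnit E' b) : formAt η E b = formAt η E' b := by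
  obtain ⟨e, heb, hEe⟩ := hE
  obtain ⟨e', heb', hEe'⟩ := hE'
  -- The product `f = e e'` is a unit for `b` on which both `E` and `E'` act as the identity, so `c
  -- = E - E'` annihilates `b` and `f`. The cocycle identity for `c ⊗ x`, `f ⊗ u`, `b ⊗ v` then
  -- leaves only `η(b ⊗ [u, v], c ⊗ x) = 0`.
  obtain ⟨f, hf, hEf, hEf'⟩ : ∃ f, f * b = b ∧ E * f = f ∧ E' * f = f :=
    ⟨e * e', by rw [mul_assoc, heb', heb], by rw [← mul_assoc, hEe],
      by rw [mul_left_comm, hEe']⟩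
  have hEb : E * b = b := by rw [← hf, ← mul_assoc, hEf]
  have hEb' : E' * b = b := by rw [← hf, ← mul_assoc, hEf']
  have hcb : (E - E') * b = 0 := by rw [sub_mul, hEb, hEb', sub_self]
  have hcf : (E - E') * f = 0 := by rw [sub_mul, hEf, hEf', sub_self]
  refine LinearMap.ext₂ fun x y => ?_
  rw [← sub_eq_zero]
  have hsub : formAt η E b x y - formAt η E' b x y = formAt η (E - E') b x y := by
    simp only [formAt_apply, map_sub, LinearMap.sub_apply]
  rw [hsub]
  obtain ⟨n, u, v, rfl⟩ := exists_sum_lie 𝕜 y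
  rw [map_sum]
  refine Finset.sum_eq_zero fun i _ => ?_
  have h := hη.cyclic (ProjTensor.mk 𝕜 A 𝔤 (E - E') x) (ProjTensor.mk 𝕜 A 𝔤 f (u i))
    (ProjTensor.mk 𝕜 A 𝔤 b (v i))
  rw [lie_mk, lie_mk, lie_mk, hcf, hf, mul_comm b, hcb] at h
  simp only [map_zero, LinearMap.zero_apply, zero_add, add_zero] at h
  rw [formAt_apply, hη.skew, h, neg_zero]

/-- This is the hypothesis of `whitehead_primitive`: `x ↦ η(E ⊗ x, b ⊗ ·)` is a 1-cocycle for the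
coadjoint action. -/
lemma IsCocycle.formAt_cocycle (hη : IsCocycle η) {E b : A} (hE : IsIteratedUnit E b)
    (x x' y : 𝔤) : formAt η E b ⁅x, x'⁆ y =
      formAt η E b x ⁅x', y⁆ - formAt η E b x' ⁅x, y⁆ := by
  have h := hη.cyclic (ProjTensor.mk 𝕜 A 𝔤 E x) (ProjTensor.mk 𝕜 A 𝔤 E x')
    (ProjTensor.mk 𝕜 A 𝔤 b y)
  rw [lie_mk, lie_mk, lie_mk, mul_comm b, hE.mul_eq,
    hη.skew (ProjTensor.mk 𝕜 A 𝔤 b ⁅x', y⁆), hη.skew (ProjTensor.mk 𝕜 A 𝔤 b ⁅y, x⁆),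
    ← lie_skew y x, map_neg, map_neg, neg_neg] at h
  rw [hη.formAt_eq hE hE.mul_self, formAt_apply]
  rw [hη.formAt_eq hE.mul_self hE, formAt_apply, formAt_apply]
  rw [add_assoc, add_eq_zero_iff_eq_neg] at h
  rw [h]
  abel

/-- The bilinear forms `(x, y) ↦ η (E ⊗ x, b ⊗ y)`, for iterated units `E` of `b`, as a linear
function of `b`. -/
lemma IsCocycle.exists_unitForm (hη : IsCocycle η) (hA : HasLocalUnits A) :
    ∃ β : A →ₗ[𝕜] 𝔤 →ₗ[𝕜] 𝔤 →ₗ[𝕜] W, ∀ E b, IsIteratedUnit E b → β b = formAt η E b := by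
  -- The choice of `E b` is arbitrary, but linearity may be checked with one iterated unit common to
  -- all elements involved.
  choose E hE using hA.exists_isIteratedUnit
  have key : ∀ F b, IsIteratedUnit F b → formAt η (E b) b = formAt η F b := fun F b hF =>
    hη.formAt_eq (hE b) hF
  refine ⟨⟨⟨fun b => formAt η (E b) b, fun b c => ?_⟩, fun t b => ?_⟩, fun F b hF => key F b hF⟩
  · obtain ⟨F, e, hb, hc, hF⟩ := hA.exists_isIteratedUnit₂ b c
    rw [key F b ⟨e, hb, hF⟩, key F c ⟨e, hc, hF⟩, key F (b + c) ⟨e, by rw [mul_add, hb, hc], hF⟩]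
    refine LinearMap.ext₂ fun x y => ?_
    simp only [formAt_apply, map_add, LinearMap.add_apply]
  · obtain ⟨F, e, hb, -, hF⟩ := hA.exists_isIteratedUnit₂ b b
    change formAt η (E (t • b)) (t • b) = t • formAt η (E b) b
    rw [key F b ⟨e, hb, hF⟩, key F (t • b) ⟨e, by rw [mul_smul_comm, hb], hF⟩]
    refine LinearMap.ext₂ fun x y => ?_
    simp only [formAt_apply, map_smul, LinearMap.smul_apply]

/-- A cocycle on `A ⊗ 𝔤` can be normalized by a coboundary so that it vanishes on pairs
`(E ⊗ x, b ⊗ y)` with an iterated unit `E` for `b`. -/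
lemma IsCocycle.exists_normalizing (hη : IsCocycle η) (β : A →ₗ[𝕜] 𝔤 →ₗ[𝕜] 𝔤 →ₗ[𝕜] W)
    (hA : HasLocalUnits A) (hβ : ∀ E b, IsIteratedUnit E b → β b = formAt η E b) :
    ∃ ℓ : ProjTensor 𝕜 A 𝔤 →ₗ[𝕜] W,
      (∀ b x y, ℓ (ProjTensor.mk 𝕜 A 𝔤 b ⁅x, y⁆) = β b x y) ∧
      ∀ y, ∃ (n : ℕ) (u v : Fin n → 𝔤), ∀ b, ℓ (ProjTensor.mk 𝕜 A 𝔤 b y) =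
        ∑ i, β b (u i) (v i) := by
  let bas := Module.finBasis 𝕜 𝔤
  let ad : 𝔤 →ₗ[𝕜] Module.End 𝕜 𝔤 := (LieModule.toEnd 𝕜 𝔤 𝔤 : 𝔤 →ₗ[𝕜] Module.End 𝕜 𝔤)
  -- This is the Whitehead primitive of `β b`. The last clause of the statement records that it is a
  -- finite sum of values of `β`, from which its continuity is deduced later.
  let ℓ : ProjTensor 𝕜 A 𝔤 →ₗ[𝕜] W := ProjTensor.lift (∑ i,
    (LinearMap.lcomp 𝕜 W (ad (killingDual bas i))) ∘ₗ (β.flip (bas i)))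
  have hℓ : ∀ b y, ℓ (ProjTensor.mk 𝕜 A 𝔤 b y) = ∑ i, β b (bas i) ⁅killingDual bas i, y⁆ := by
    intro b y
    change (∑ i, (LinearMap.lcomp 𝕜 W (ad (killingDual bas i))) ∘ₗ (β.flip (bas i))) b y = _
    rw [LinearMap.sum_apply, LinearMap.sum_apply]
    rfl
  refine ⟨ℓ, fun b x y => ?_, fun y => ⟨_, _, _, fun b => hℓ b y⟩⟩
  rw [hℓ]
  obtain ⟨E, hE⟩ := hA.exists_isIteratedUnit b
  refine whitehead_primitive bas (β b) ?_ x y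
  rw [hβ E b hE]
  exact hη.formAt_cocycle hE

lemma IsCocycle.formAt_symm (hη : IsCocycle η) (hA : HasLocalUnits A)
    (hn : IsNormalized η) (a b : A) (x y : 𝔤) : formAt η a b x y = formAt η a b y x :=
  symm_of_invariant _ (hη.formAt_invariant hA hn a b) x y

lemma IsCocycle.formAt_skew (hη : IsCocycle η) (hA : HasLocalUnits A)
    (hn : IsNormalized η) (a b : A) (x y : 𝔤) : formAt η a b x y = -formAt η b a x y := by
  rw [formAt_apply, hη.skew, ← formAt_apply, hη.formAt_symm hA hn]

/-- With `y = [u, v]`, the cocycle identity for `a ⊗ x`, `b ⊗ u`, `c ⊗ v` has three terms that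
invariance and symmetry turn into forms evaluated at `(x, [u, v])`; skewness in the algebra
arguments fixes the sign. -/
lemma IsCocycle.formAt_mul (hη : IsCocycle η) (hA : HasLocalUnits A)
    (hn : IsNormalized η) (a b c : A) (x y : 𝔤) :
    formAt η a (b * c) x y = formAt η (a * b) c x y + formAt η (a * c) b x y := by
  obtain ⟨n, u, v, rfl⟩ := exists_sum_lie 𝕜 y
  simp only [map_sum]
  rw [← Finset.sum_add_distrib]
  refine Finset.sum_congr rfl fun i _ => ?_
  have hinv := hη.formAt_invariant hA hn
  have hsymm := hη.formAt_symm hA hn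
  have h : formAt η (a * b) c ⁅x, u i⁆ (v i) + formAt η (b * c) a ⁅u i, v i⁆ x +
      formAt η (c * a) b ⁅v i, x⁆ (u i) = 0 :=
    hη.cyclic (ProjTensor.mk 𝕜 A 𝔤 a x) (ProjTensor.mk 𝕜 A 𝔤 b (u i)) (ProjTensor.mk 𝕜 A 𝔤 c (v i))
  rw [hinv, hsymm (b * c), hη.formAt_skew hA hn (b * c), hsymm (c * a), ← hinv (c * a),
    hsymm (c * a), mul_comm c, add_right_comm, ← sub_eq_add_neg, sub_eq_zero] at h
  exact h.symm

end LocalUnits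

/-! ### Universality of the Maier cocycle -/

section Universality

variable {𝕜 A 𝔤 : Type*} [RCLike 𝕜] [NonUnitalCommRing A] [Module 𝕜 A] [IsScalarTower 𝕜 A A]
  [SMulCommClass 𝕜 A A] [TopologicalSpace A] [LieRing 𝔤] [LieAlgebra 𝕜 𝔤]

lemma IsLimitOfUnitalSubalgebras.hasLocalUnits [IsTopologicalAddGroup A]
    (hA : IsLimitOfUnitalSubalgebras 𝕜 A) : HasLocalUnits A := by
  obtain ⟨S, hmono, hex, -, he, -⟩ := hA
  intro a b
  obtain ⟨m, hm⟩ := hex a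
  obtain ⟨n, hn⟩ := hex b
  obtain ⟨e, he⟩ := he (max m n)
  exact ⟨e, he a (hmono (le_max_left m n) hm), he b (hmono (le_max_right m n) hn)⟩

lemma IsLimitOfUnitalSubalgebras.span_lie_current [IsTopologicalAddGroup A]
    [FiniteDimensional 𝕜 𝔤] [LieAlgebra.IsKilling 𝕜 𝔤]
    (hA : IsLimitOfUnitalSubalgebras 𝕜 A) :
    Submodule.span 𝕜 {z : ProjTensor 𝕜 A 𝔤 | ∃ x y : ProjTensor 𝕜 A 𝔤, z = ⁅x, y⁆} = ⊤ :=
  CurrentLie.span_lie_current fun a => (hA.hasLocalUnits a a).imp fun _ h => h.1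

variable [TopologicalSpace 𝔤]

lemma IsLimitOfUnitalSubalgebras.continuous_unitForm [IsTopologicalAddGroup A]
    (hA : IsLimitOfUnitalSubalgebras 𝕜 A) {W : Type*} [AddCommGroup W] [Module 𝕜 W]
    [TopologicalSpace W] [PolynormableSpace 𝕜 W]
    {η : ProjTensor 𝕜 A 𝔤 →ₗ[𝕜] ProjTensor 𝕜 A 𝔤 →ₗ[𝕜] W}
    (hη : Continuous fun z : ProjTensor 𝕜 A 𝔤 × ProjTensor 𝕜 A 𝔤 => η z.1 z.2)
    (β : A →ₗ[𝕜] 𝔤 →ₗ[𝕜] 𝔤 →ₗ[𝕜] W) (hβ : ∀ E b, IsIteratedUnit E b → β b = formAt η E b)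
    (x y : 𝔤) : Continuous fun b => β b x y := by
  obtain ⟨S, hmono, hex, -, he, hlim⟩ := hA
  refine continuous_of_continuous_seminorm_comp (𝕜 := 𝕜)
    (LinearMap.applyₗ y ∘ₗ LinearMap.applyₗ x ∘ₗ β) fun p hp => ?_
  refine hlim (p.comp (LinearMap.applyₗ y ∘ₗ LinearMap.applyₗ x ∘ₗ β)) fun n => ?_
  -- The unit `e` of `S n` lies in some `S m`, and the unit `E` of `S m` is then an iterated unit
  -- for all elements of `S n` at once. So `β` on `S n` is given by the continuous map `a ↦ η(E ⊗ x,
  -- a ⊗ y)`.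
  obtain ⟨e, he'⟩ := he n
  obtain ⟨m, hm⟩ := hex e
  obtain ⟨E, hE⟩ := he m
  have h : ∀ a : S n, β a x y = η (ProjTensor.mk 𝕜 A 𝔤 E x) (ProjTensor.mk 𝕜 A 𝔤 a y) := fun a => by
    rw [hβ E a ⟨e, he' a a.2, hE e hm⟩, formAt_apply]
  change Continuous fun a : S n => p (β a x y)
  simp only [h]
  exact hp.comp (hη.comp (continuous_const.prodMk
    ((ProjTensor.continuous_mk_left y).comp continuous_subtype_val)))

variable [FiniteDimensional 𝕜 𝔤] [LieAlgebra.IsKilling 𝕜 𝔤] [IsTopologicalAddGroup 𝔤]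
  [ContinuousSMul 𝕜 𝔤] [T2Space 𝔤] [ContinuousMul A] [PolynormableSpace 𝕜 A]

/-- Normalized cocycles factor through Maier's cocycle. -/
lemma IsCocycle.exists_eq_maierCocycle {W : Type*} [AddCommGroup W] [Module 𝕜 W] [UniformSpace W]
    [IsUniformAddGroup W] [ContinuousSMul 𝕜 W] [PolynormableSpace 𝕜 W] [T2Space W]
    [CompleteSpace W] {η : ProjTensor 𝕜 A 𝔤 →ₗ[𝕜] ProjTensor 𝕜 A 𝔤 →ₗ[𝕜] W} (hη : IsCocycle η)
    (hA : HasLocalUnits A) (hn : IsNormalized η)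
    (hcont : ∀ x y, Continuous fun z : A × A => formAt η z.1 z.2 x y) :
    ∃ θ : MaierSpace 𝕜 A 𝔤 →L[𝕜] W, ∀ u v, η u v = θ (maierCocycle 𝕜 A 𝔤 u v) := by
  have := (PolynormableSpace.withSeminorms 𝕜 A).topologicalAddGroup
  have := (PolynormableSpace.withSeminorms 𝕜 A).continuousSMul
  -- The form is extended to the unitalization by zero on scalars.
  let g (x y : 𝔤) : TopUnitization 𝕜 A →ₗ[𝕜] TopUnitization 𝕜 A →ₗ[𝕜] W :=
    η.compl₁₂ ((ProjTensor.mk 𝕜 A 𝔤).flip x ∘ₗ TopUnitization.snd 𝕜 A)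
      ((ProjTensor.mk 𝕜 A 𝔤).flip y ∘ₗ TopUnitization.snd 𝕜 A)
  have hg : ∀ x y a b, g x y a b =
    formAt η (TopUnitization.snd 𝕜 A a) (TopUnitization.snd 𝕜 A b) x y := fun _ _ _ _ => rfl
  have hskew := hη.formAt_skew hA hn
  have key : ∀ x y, ∃ f : DiffQuotient 𝕜 (TopUnitization 𝕜 A) →L[𝕜] W,
      ∀ a b, f (adb 𝕜 (TopUnitization 𝕜 A) a b) = g x y a b := by
    intro x y
    refine exists_continuousLinearMap_diffQuotient (g x y) (fun a b c => ?_) (fun b => ?_) ?_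
    · have hadd : ∀ a b c, formAt η (a + b) c x y = formAt η a c x y + formAt η b c x y :=
        fun a b c => by simp only [formAt_apply, map_add, LinearMap.add_apply]
      have hsmul : ∀ (t : 𝕜) a c, formAt η (t • a) c x y = t • formAt η a c x y :=
        fun t a c => by simp only [formAt_apply, map_smul, LinearMap.smul_apply]
      have hadd' : ∀ a b c, formAt η a (b + c) x y = formAt η a b x y + formAt η a c x y :=
        fun a b c => by simp only [formAt_apply, map_add, LinearMap.add_apply]
      have hsmul' : ∀ (t : 𝕜) a c, formAt η a (t • c) x y = t • formAt η a c x y :=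
        fun t a c => by simp only [formAt_apply, map_smul, LinearMap.smul_apply]
      -- Besides the Leibniz rule on `A`, the scalar part of `a` contributes `formAt η b c + formAt
      -- η c b` (projected to `A`), which vanishes by skewness.
      simp only [hg, TopUnitization.snd_mul, hadd, hsmul, hadd', hsmul', hη.formAt_mul hA hn]
      rw [hskew (TopUnitization.snd 𝕜 A c) (TopUnitization.snd 𝕜 A b)]
      module
    · rw [hg, TopUnitization.snd_one, formAt_apply, map_zero, LinearMap.zero_apply, map_zero,
        LinearMap.zero_apply]
    · have h1 : Continuous fun z : TopUnitization 𝕜 A × TopUnitization 𝕜 A =>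
          (TopUnitization.snd 𝕜 A z.1, TopUnitization.snd 𝕜 A z.2) :=
        (TopUnitization.continuous_snd.comp continuous_fst).prodMk
          (TopUnitization.continuous_snd.comp continuous_snd)
      exact (hcont x y).comp h1
  choose f hf using key
  have hext : ∀ {F G : DiffQuotient 𝕜 (TopUnitization 𝕜 A) →L[𝕜] W},
      (∀ a b, F (adb 𝕜 (TopUnitization 𝕜 A) a b) = G (adb 𝕜 (TopUnitization 𝕜 A) a b)) → F = G :=
    fun h => DiffQuotient.hom_ext h
  -- The chosen maps `f x y` are bilinear in `x` and `y` because a continuous map on the quotient is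
  -- determined by its values on the classes `[a db]`.
  let F : 𝔤 →ₗ[𝕜] 𝔤 →ₗ[𝕜] (DiffQuotient 𝕜 (TopUnitization 𝕜 A) →L[𝕜] W) :=
    LinearMap.mk₂ 𝕜 f
      (fun x x' y => hext fun a b => by
        simp only [add_apply, hf, hg, map_add, LinearMap.add_apply])
      (fun t x y => hext fun a b => by
        simp only [smul_apply, hf, hg, map_smul, LinearMap.smul_apply])
      (fun x y y' => hext fun a b => by
        simp only [add_apply, hf, hg, map_add])
      (fun t x y => hext fun a b => by
        simp only [smul_apply, hf, hg, map_smul])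
  have hF : ∀ x y, F x y = f x y := fun _ _ => rfl
  obtain ⟨θ, hθ⟩ := exists_continuousLinearMap_invariantSpace F
    (fun x y => hext fun a b => by rw [hF, hF, hf, hf, hg, hg, hη.formAt_symm hA hn])
    (fun x y z => hext fun a b => by rw [hF, hF, hf, hf, hg, hg, hη.formAt_invariant hA hn])
  refine ⟨θ, fun u v => ?_⟩
  induction u using ProjTensor.ind with
  | h0 => simp only [map_zero, LinearMap.zero_apply]
  | hadd u u' hu hu' => simp only [map_add, LinearMap.add_apply, hu, hu']
  | hmk a x =>
    induction v using ProjTensor.ind with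
    | h0 => simp only [map_zero]
    | hadd v v' hv hv' => simp only [map_add, hv, hv']
    | hmk b y =>
      rw [maierCocycle_mk, maierValue, hθ, hF, hf, hg, TopUnitization.snd_toUnitization,
        TopUnitization.snd_toUnitization, formAt_apply]

lemma surjective_deltaMap_maierCocycle [IsTopologicalAddGroup A]
    (hA : IsLimitOfUnitalSubalgebras 𝕜 A)
    (hω : maierCocycle 𝕜 A 𝔤 ∈ contCocycles 𝕜 (ProjTensor 𝕜 A 𝔤) (MaierSpace 𝕜 A 𝔤))
    {W : Type*} [AddCommGroup W] [Module 𝕜 W] [UniformSpace W]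
    [IsUniformAddGroup W] [ContinuousSMul 𝕜 W] [PolynormableSpace 𝕜 W] [T2Space W]
    [CompleteSpace W] :
    Function.Surjective (deltaMap W (⟨maierCocycle 𝕜 A 𝔤, hω⟩ :
      contCocycles 𝕜 (ProjTensor 𝕜 A 𝔤) (MaierSpace 𝕜 A 𝔤))) := by
  rw [surjective_deltaMap_iff]
  rintro ⟨η, hηs, hηc, hηcont⟩
  have hη : IsCocycle η := ⟨hηs, hηc⟩
  have hU := hA.hasLocalUnits
  obtain ⟨β, hβ⟩ := hη.exists_unitForm hU
  obtain ⟨ℓ, hℓ, hℓ'⟩ := hη.exists_normalizing β hU hβ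
  have hβc := hA.continuous_unitForm hηcont β hβ
  have hℓc : Continuous ℓ := ProjTensor.continuous_of_continuous_mk_left ℓ fun y => by
    obtain ⟨n, u, v, h⟩ := hℓ' y
    simp only [h]
    exact continuous_finsetSum _ fun i _ => hβc (u i) (v i)
  let η' := η - (currentBracket 𝕜 A 𝔤).compr₂ ℓ
  have hη' : ∀ u v, η' u v = η u v - ℓ ⁅u, v⁆ := fun _ _ => rfl
  obtain ⟨θ, hθ⟩ := (hη.sub_coboundary ℓ hη').exists_eq_maierCocycle hU
    -- Normalization: since `E b = b`, the subtracted term is `ℓ(b ⊗ [x, y]) = β b x y`, which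
    -- equals `η(E ⊗ x, b ⊗ y)`.
    (fun E b hE => LinearMap.ext₂ fun x y => by
      rw [formAt_apply, hη', lie_mk, hE.mul_eq, hℓ, hβ E b hE, formAt_apply, sub_self]
      rfl)
    (fun x y => by
      have h : (fun z : A × A => formAt η' z.1 z.2 x y) = fun z =>
          η (ProjTensor.mk 𝕜 A 𝔤 z.1 x) (ProjTensor.mk 𝕜 A 𝔤 z.2 y) -
            ℓ (ProjTensor.mk 𝕜 A 𝔤 (z.1 * z.2) ⁅x, y⁆) := rfl
      rw [h]
      refine (hηcont.comp (((ProjTensor.continuous_mk_left x).comp continuous_fst).prodMk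
        ((ProjTensor.continuous_mk_left y).comp continuous_snd))).sub (hℓc.comp
          ((ProjTensor.continuous_mk_left ⁅x, y⁆).comp continuous_mul)))
  refine ⟨θ, ⟨ℓ, hℓc⟩, fun u v => ?_⟩
  change η u v = θ (maierCocycle 𝕜 A 𝔤 u v) + ℓ ⁅u, v⁆
  rw [← hθ, hη', sub_add_cancel]

theorem isWeaklyUniversal_maierCocycle [IsTopologicalAddGroup A]
    (hA : IsLimitOfUnitalSubalgebras 𝕜 A)
    (hω : maierCocycle 𝕜 A 𝔤 ∈ contCocycles 𝕜 (ProjTensor 𝕜 A 𝔤) (MaierSpace 𝕜 A 𝔤)) :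
    IsWeaklyUniversal.{w} (⟨maierCocycle 𝕜 A 𝔤, hω⟩ :
      contCocycles 𝕜 (ProjTensor 𝕜 A 𝔤) (MaierSpace 𝕜 A 𝔤)) := fun _ _ _ _ _ _ _ _ _ =>
  ⟨injective_deltaMap_maierCocycle hω, surjective_deltaMap_maierCocycle hA hω⟩

theorem isUniversalCocycle_maierCocycle [IsTopologicalAddGroup A]
    (hA : IsLimitOfUnitalSubalgebras 𝕜 A) : IsUniversalCocycle.{w} (maierCocycle 𝕜 A 𝔤) :=
  ⟨maierCocycle_mem, isWeaklyUniversal_maierCocycle hA maierCocycle_mem,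
    (isWeaklyUniversal_maierCocycle hA maierCocycle_mem).isClassicallyUniversal
      hA.span_lie_current⟩

theorem IsLimitOfUnitalSubalgebras.exists_isUniversalCocycle_of_equiv [IsTopologicalAddGroup A]
    (hA : IsLimitOfUnitalSubalgebras 𝕜 A) {L : Type*} [LieRing L] [LieAlgebra 𝕜 L]
    [TopologicalSpace L] (e : L ≃L[𝕜] ProjTensor 𝕜 A 𝔤) (he : ∀ x y, e ⁅x, y⁆ = ⁅e x, e y⁆) :
    ∃ ω : L →ₗ[𝕜] L →ₗ[𝕜] MaierSpace 𝕜 A 𝔤,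
      (∀ u v, ω u v = maierCocycle 𝕜 A 𝔤 (e u) (e v)) ∧ IsUniversalCocycle.{w} ω :=
  ⟨_, fun _ _ => rfl, isUniversalCocycle_comp_equiv e he maierCocycle_mem
    (isWeaklyUniversal_maierCocycle hA maierCocycle_mem) hA.span_lie_current⟩

end Universality

/-! ### Seminorms of the smooth topology -/

namespace SmoothCc

section Jets

variable (𝕜 E M F : Type*) [RCLike 𝕜] [NormedAddCommGroup E] [NormedSpace ℝ E]
  [TopologicalSpace M] [ChartedSpace E M] [AddCommGroup F] [Module 𝕜 F]

/-- The data that determine one of the seminorms of the `C^∞`-topology: a chart, an order of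
differentiation, a linear functional on the values and a compact set in the image of the chart. -/
structure JetIndex where
  chart : OpenPartialHomeomorph M E
  chart_mem : chart ∈ atlas E M
  order : ℕ
  functional : F →ₗ[𝕜] 𝕜
  set : Set E
  isCompact : IsCompact set
  subset : set ⊆ chart.target

variable {𝕜 E M F}

instance (i : JetIndex 𝕜 E M F) : CompactSpace i.set := isCompact_iff_compactSpace.1 i.isCompact

/-- The component `ℓ ∘ f` in the chart `φ`. -/
def inChart (φ : OpenPartialHomeomorph M E) (ℓ : F →ₗ[𝕜] 𝕜) : SmoothCc 𝕜 E M F →ₗ[𝕜] (E → 𝕜) where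
  toFun f v := ℓ (f.1 (φ.symm v))
  map_add' _ _ := funext fun _ => map_add ℓ _ _
  map_smul' _ _ := funext fun _ => map_smul ℓ _ _

lemma inChart_apply (φ : OpenPartialHomeomorph M E) (ℓ : F →ₗ[𝕜] 𝕜) (f : SmoothCc 𝕜 E M F)
    (v : E) : inChart φ ℓ f v = ℓ (f.1 (φ.symm v)) := rfl

variable [IsManifold 𝓘(ℝ, E) (⊤ : ℕ∞) M]

lemma contDiffOn_chart (f : SmoothCc 𝕜 E M F) (ℓ : F →ₗ[𝕜] 𝕜) {φ : OpenPartialHomeomorph M E}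
    (hφ : φ ∈ atlas E M) :
    ContDiffOn ℝ (⊤ : ℕ∞) (inChart φ ℓ f) φ.target := by
  rw [← contMDiffOn_iff_contDiffOn]
  exact (f.2.2 ℓ).comp_contMDiffOn (contMDiffOn_symm_of_mem_maximalAtlas
    (IsManifold.subset_maximalAtlas hφ))

lemma contDiffAt_chart (f : SmoothCc 𝕜 E M F) (ℓ : F →ₗ[𝕜] 𝕜) {φ : OpenPartialHomeomorph M E}
    (hφ : φ ∈ atlas E M) {v : E} (hv : v ∈ φ.target) (n : ℕ) :
    ContDiffAt ℝ n (inChart φ ℓ f) v :=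
  ((contDiffOn_chart f ℓ hφ).contDiffAt (φ.open_target.mem_nhds hv)).of_le
    (by exact_mod_cast le_top)

lemma continuousOn_chartDeriv (f : SmoothCc 𝕜 E M F) (ℓ : F →ₗ[𝕜] 𝕜)
    {φ : OpenPartialHomeomorph M E} (hφ : φ ∈ atlas E M) (k : ℕ) :
    ContinuousOn (iteratedFDeriv ℝ k (inChart φ ℓ f)) φ.target :=
  ((contDiffOn_chart f ℓ hφ).continuousOn_iteratedFDerivWithin (by exact_mod_cast le_top)
    φ.open_target.uniqueDiffOn).congr fun _ hv =>
      (iteratedFDerivWithin_of_isOpen k φ.open_target hv).symm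

/-- The Banach space of continuous functions that contains the restrictions of derivatives to the
compact set of `i`. -/
def JetSpace (i : JetIndex 𝕜 E M F) : Type _ :=
  BoundedContinuousFunction i.set (E [×i.order]→L[ℝ] 𝕜)

instance (i : JetIndex 𝕜 E M F) : NormedAddCommGroup (JetSpace i) :=
  inferInstanceAs (NormedAddCommGroup (BoundedContinuousFunction i.set (E [×i.order]→L[ℝ] 𝕜)))

instance (i : JetIndex 𝕜 E M F) : NormedSpace 𝕜 (JetSpace i) :=
  inferInstanceAs (NormedSpace 𝕜 (BoundedContinuousFunction i.set (E [×i.order]→L[ℝ] 𝕜)))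

instance (i : JetIndex 𝕜 E M F) : CompleteSpace (JetSpace i) :=
  inferInstanceAs (CompleteSpace (BoundedContinuousFunction i.set (E [×i.order]→L[ℝ] 𝕜)))

/-- The derivative of order `k` of the component `ℓ ∘ f` in a chart, restricted to a compact
set. -/
def jet (i : JetIndex 𝕜 E M F) :
    SmoothCc 𝕜 E M F →ₗ[𝕜] JetSpace i where
  toFun f := BoundedContinuousFunction.mkOfCompact
    ⟨i.set.domRestrict (iteratedFDeriv ℝ i.order (inChart i.chart i.functional f)),
      ((continuousOn_chartDeriv f i.functional i.chart_mem i.order).mono i.subset).domRestrict⟩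
  map_add' f g := by
    refine BoundedContinuousFunction.ext fun v => ?_
    change iteratedFDeriv ℝ i.order (inChart i.chart i.functional (f + g)) v.1 =
      iteratedFDeriv ℝ i.order (inChart i.chart i.functional f) v.1 +
        iteratedFDeriv ℝ i.order (inChart i.chart i.functional g) v.1
    rw [map_add, iteratedFDeriv_add_apply (contDiffAt_chart f _ i.chart_mem (i.subset v.2) _)
      (contDiffAt_chart g _ i.chart_mem (i.subset v.2) _)]
  map_smul' c f := by
    refine BoundedContinuousFunction.ext fun v => ?_
    change iteratedFDeriv ℝ i.order (inChart i.chart i.functional (c • f)) v.1 =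
      c • iteratedFDeriv ℝ i.order (inChart i.chart i.functional f) v.1
    rw [map_smul, iteratedFDeriv_const_smul_apply
      (contDiffAt_chart f _ i.chart_mem (i.subset v.2) _)]

lemma norm_jet_le_iff (i : JetIndex 𝕜 E M F) (f : SmoothCc 𝕜 E M F) {c : ℝ} (hc : 0 ≤ c) :
    ‖jet i f‖ ≤ c ↔ ∀ v ∈ i.set,
      ‖iteratedFDeriv ℝ i.order (inChart i.chart i.functional f) v‖ ≤ c :=
  (BoundedContinuousFunction.norm_le hc).trans Subtype.forall

lemma norm_iteratedFDeriv_le_norm_jet (i : JetIndex 𝕜 E M F) (f : SmoothCc 𝕜 E M F) {v : E}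
    (hv : v ∈ i.set) :
    ‖iteratedFDeriv ℝ i.order (inChart i.chart i.functional f) v‖ ≤ ‖jet i f‖ :=
  (norm_jet_le_iff i f (norm_nonneg _)).1 le_rfl v hv

lemma tendsto_jet_iff {ι : Type*} {l : Filter ι} (i : JetIndex 𝕜 E M F)
    (f : ι → SmoothCc 𝕜 E M F) (g : SmoothCc 𝕜 E M F) :
    Filter.Tendsto (fun n => jet i (f n)) l (𝓝 (jet i g)) ↔
      TendstoUniformlyOn (fun n => iteratedFDeriv ℝ i.order (inChart i.chart i.functional (f n)))
        (iteratedFDeriv ℝ i.order (inChart i.chart i.functional g)) l i.set :=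
  (BoundedContinuousFunction.tendsto_iff_tendstoUniformly (l := l)).trans
    tendstoUniformlyOn_iff_tendstoUniformly_comp_coe.symm

/-- A Cauchy filter for a seminorm of the `C^∞`-topology converges uniformly. -/
lemma exists_tendstoUniformlyOn_of_cauchy {l : Filter (SmoothCc 𝕜 E M F)} (i : JetIndex 𝕜 E M F)
    (hl : Cauchy (l.map (jet i))) :
    ∃ G : E → E [×i.order]→L[ℝ] 𝕜, TendstoUniformlyOn
      (fun f : SmoothCc 𝕜 E M F => iteratedFDeriv ℝ i.order (inChart i.chart i.functional f))
        G l i.set := by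
  obtain ⟨G, hG⟩ := CompleteSpace.complete hl
  let G' : BoundedContinuousFunction i.set (E [×i.order]→L[ℝ] 𝕜) := G
  refine ⟨Function.extend Subtype.val G' 0, ?_⟩
  rw [tendstoUniformlyOn_iff_tendstoUniformly_comp_coe,
    Function.extend_comp Subtype.val_injective]
  exact BoundedContinuousFunction.tendsto_iff_tendstoUniformly.1 hG

/-- Uniform convergence on compact sets is the infimum over single compact sets, and on each of them
it is the sup-norm topology of a Banach space. Thus the smooth topology is given by the norms of
jets. -/
lemma smoothTop_eq_iInf :
    smoothTop 𝕜 E M F = ⨅ i : JetIndex 𝕜 E M F, TopologicalSpace.induced (jet i) inferInstance := by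
  have h : ∀ i : JetIndex 𝕜 E M F, TopologicalSpace.induced (jet i) inferInstance =
      TopologicalSpace.induced (chartDeriv 𝕜 E M F i.chart i.order i.functional)
        (TopologicalSpace.induced (UniformFun.ofFun ∘ i.set.domRestrict ∘
          UniformOnFun.toFun {C : Set E | IsCompact C ∧ C ⊆ i.chart.target})
          (UniformFun.topologicalSpace i.set (E [×i.order]→L[ℝ] 𝕜))) := fun i => by
    refine (congrArg (TopologicalSpace.induced (jet i))
      BoundedContinuousFunction.isInducing_coeFn.eq_induced).trans ?_
    rw [induced_compose]
    exact induced_compose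
  refine le_antisymm (le_iInf fun i => ?_) (le_iInf fun φ => le_iInf fun k => le_iInf fun ℓ => ?_)
  · have hle : smoothTop 𝕜 E M F ≤ TopologicalSpace.induced
        (chartDeriv 𝕜 E M F i.chart i.order i.functional) inferInstance :=
      iInf_le_of_le (⟨i.chart, i.chart_mem⟩ : atlas E M)
        (iInf_le_of_le i.order (iInf_le _ i.functional))
    rw [h]
    refine hle.trans (induced_mono ?_)
    rw [UniformOnFun.topologicalSpace_eq]
    exact iInf₂_le i.set ⟨i.isCompact, i.subset⟩
  · rw [UniformOnFun.topologicalSpace_eq, induced_iInf]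
    refine le_iInf fun C => ?_
    rw [induced_iInf]
    refine le_iInf fun hC => ?_
    rw [← h ⟨φ, φ.2, k, ℓ, C, hC.1, hC.2⟩]
    exact iInf_le _ _

end Jets

end SmoothCc

/-! ### The inductive limit topology -/

namespace SmoothCc

section InductiveLimit

variable {𝕜 E M F : Type*} [RCLike 𝕜] [NormedAddCommGroup E] [NormedSpace ℝ E]
  [TopologicalSpace M] [ChartedSpace E M] [AddCommGroup F] [Module 𝕜 F]

variable (𝕜 E F) in
/-- The functions with support in `K`. -/
def supportedIn (K : Set M) : Submodule 𝕜 (SmoothCc 𝕜 E M F) where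
  carrier := {f | tsupport f.1 ⊆ K}
  zero_mem' := by
    change tsupport (0 : M → F) ⊆ K
    rw [tsupport_zero]
    exact Set.empty_subset K
  add_mem' {f g} hf hg := (tsupport_add f.1 g.1).trans (Set.union_subset hf hg)
  smul_mem' c f hf := (closure_mono (Function.support_const_smul_subset c f.1)).trans hf

variable (𝕜 E F) in
/-- The space `C_K^∞(M, F)`, to be given the `C^∞`-topology. -/
def SmoothOn (K : Set M) : Type _ := supportedIn 𝕜 E F K

namespace SmoothOn

variable {K : Set M}

instance : AddCommGroup (SmoothOn 𝕜 E F K) := inferInstanceAs (AddCommGroup (supportedIn 𝕜 E F K))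

instance : Module 𝕜 (SmoothOn 𝕜 E F K) := inferInstanceAs (Module 𝕜 (supportedIn 𝕜 E F K))

variable (𝕜 E F K) in
/-- The inclusion of `C_K^∞(M, F)` into `C_c^∞(M, F)`. -/
def incl : SmoothOn 𝕜 E F K →ₗ[𝕜] SmoothCc 𝕜 E M F := (supportedIn 𝕜 E F K).subtype

lemma incl_mem (f : SmoothOn 𝕜 E F K) : tsupport (incl 𝕜 E F K f).1 ⊆ K := f.2

lemma incl_injective : Function.Injective (incl 𝕜 E F K) := Subtype.val_injective

instance : TopologicalSpace (SmoothOn 𝕜 E F K) :=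
  TopologicalSpace.induced (incl 𝕜 E F K) (smoothTop 𝕜 E M F)

lemma continuous_incl (hK : IsCompact K) : Continuous (incl 𝕜 E F K) :=
  continuous_sInf_rng.2 fun _ h => h.2 K hK

end SmoothOn

/-- Linear maps on `C_c^∞(M, F)` are continuous if their restrictions to the `C_K^∞(M, F)` are. -/
lemma continuous_of_continuous_comp_incl {W : Type*} [AddCommGroup W] [Module 𝕜 W]
    [TopologicalSpace W] [PolynormableSpace 𝕜 W] (T : SmoothCc 𝕜 E M F →ₗ[𝕜] W)
    (h : ∀ K : Set M, IsCompact K → Continuous (T ∘ₗ SmoothOn.incl 𝕜 E F K)) : Continuous T := by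
  rw [continuous_iff_le_induced]
  refine sInf_le ⟨PolynormableSpace.induced T, fun K hK => ?_⟩
  exact continuous_induced_rng.2 (h K hK)

variable [IsManifold 𝓘(ℝ, E) (⊤ : ℕ∞) M]

namespace SmoothOn

variable {K : Set M}

lemma withSeminorms : WithSeminorms (SeminormFamily.sigma fun i : JetIndex 𝕜 E M F =>
    SeminormFamily.comp (fun _ : Fin 1 => normSeminorm 𝕜 (JetSpace i))
      (jet i ∘ₗ incl 𝕜 E F K)) := by
  have h : (instTopologicalSpace : TopologicalSpace (SmoothOn 𝕜 E F K)) =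
      ⨅ i, TopologicalSpace.induced (jet i ∘ₗ incl 𝕜 E F K) inferInstance := by
    refine (congrArg (TopologicalSpace.induced (incl 𝕜 E F K)) smoothTop_eq_iInf).trans ?_
    rw [induced_iInf]
    exact iInf_congr fun i => induced_compose
  rw [h]
  exact withSeminorms_iInf fun i =>
    (jet i ∘ₗ incl 𝕜 E F K).withSeminorms_induced (norm_withSeminorms 𝕜 (JetSpace i))

instance : PolynormableSpace 𝕜 (SmoothOn 𝕜 E F K) := withSeminorms.toPolynormableSpace

instance : IsTopologicalAddGroup (SmoothOn 𝕜 E F K) := withSeminorms.topologicalAddGroup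

lemma tendsto_nhds_iff {ι : Type*} {l : Filter ι} (f : ι → SmoothOn 𝕜 E F K)
    (g : SmoothOn 𝕜 E F K) : Filter.Tendsto f l (𝓝 g) ↔
      ∀ i, Filter.Tendsto (fun n => jet i (incl 𝕜 E F K (f n))) l (𝓝 (jet i (incl 𝕜 E F K g))) := by
  rw [withSeminorms.tendsto_nhds]
  simp only [Metric.tendsto_nhds, dist_eq_norm, ← map_sub]
  exact ⟨fun h i => h ⟨i, 0⟩, fun h i => h i.1⟩

lemma continuous_jet_incl (i : JetIndex 𝕜 E M F) : Continuous (jet i ∘ₗ incl 𝕜 E F K) :=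
  continuous_iff_continuousAt.2 fun f => (tendsto_nhds_iff id f).1 Filter.tendsto_id i

lemma continuous_iff {X : Type*} [TopologicalSpace X] {f : X → SmoothOn 𝕜 E F K} :
    Continuous f ↔ ∀ i, Continuous fun x => jet i (incl 𝕜 E F K (f x)) := by
  simp only [continuous_iff_continuousAt, ContinuousAt]
  exact ⟨fun h i x => (tendsto_nhds_iff _ _).1 (h x) i,
    fun h x => (tendsto_nhds_iff _ _).2 fun i => h i x⟩

end SmoothOn

lemma continuous_jet (i : JetIndex 𝕜 E M F) : Continuous (jet i) :=
  continuous_of_continuous_comp_incl _ fun _ _ => SmoothOn.continuous_jet_incl i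

/-- Support-decreasing linear maps that are given by a linear map of the values are continuous. -/
lemma continuous_of_forall_functional {F' : Type*} [AddCommGroup F'] [Module 𝕜 F']
    (T : SmoothCc 𝕜 E M F →ₗ[𝕜] SmoothCc 𝕜 E M F') (t : F →ₗ[𝕜] F')
    (h : ∀ f p, (T f).1 p = t (f.1 p)) : Continuous T := by
  refine continuous_of_continuous_comp_incl T fun K hK => ?_
  have hs : ∀ f : SmoothOn 𝕜 E F K, T (SmoothOn.incl 𝕜 E F K f) ∈ supportedIn 𝕜 E F' K := fun f =>
    (closure_mono (Function.support_subset_iff'.2 fun p hp => by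
      rw [h, Function.notMem_support.1 hp, map_zero])).trans f.incl_mem
  let T' : SmoothOn 𝕜 E F K → SmoothOn 𝕜 E F' K := fun f => ⟨_, hs f⟩
  have hT' : Continuous T' := SmoothOn.continuous_iff.2 fun i => by
    -- The jet of `T f` for a functional `m` is the jet of `f` for the functional `m ∘ t`.
    refine (SmoothOn.continuous_jet_incl (K := K)
      (⟨i.chart, i.chart_mem, i.order, i.functional ∘ₗ t, i.set, i.isCompact, i.subset⟩ :
        JetIndex 𝕜 E M F)).congr fun f => ?_
    have hin : inChart i.chart (i.functional ∘ₗ t) (SmoothOn.incl 𝕜 E F K f) =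
        inChart i.chart i.functional (T (SmoothOn.incl 𝕜 E F K f)) := funext fun v => by
      rw [inChart_apply, inChart_apply, h]
      rfl
    refine BoundedContinuousFunction.ext fun v => ?_
    change iteratedFDeriv ℝ i.order (inChart i.chart (i.functional ∘ₗ t)
      (SmoothOn.incl 𝕜 E F K f)) v.1 = iteratedFDeriv ℝ i.order (inChart i.chart i.functional
        (T (SmoothOn.incl 𝕜 E F K f))) v.1
    rw [hin]
  exact (SmoothOn.continuous_incl hK).comp hT'

/-- Evaluation at `p` is a jet of order zero over the one-point set `{φ p}`. This gives the
Hausdorff property and the pointwise limits in the completeness proof. -/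
lemma continuous_eval (p : M) (ℓ : F →ₗ[𝕜] 𝕜) :
    Continuous fun f : SmoothCc 𝕜 E M F => ℓ (f.1 p) := by
  let φ := chartAt E p
  let i : JetIndex 𝕜 E M F := ⟨φ, chart_mem_atlas E p, 0, ℓ, {φ p}, isCompact_singleton,
    Set.singleton_subset_iff.2 (φ.map_source (mem_chart_source E p))⟩
  have h : Continuous fun G : BoundedContinuousFunction i.set (E [×i.order]→L[ℝ] 𝕜) =>
      G ⟨φ p, rfl⟩ 0 :=
    (ContinuousMultilinearMap.apply ℝ (fun _ : Fin i.order => E) 𝕜 0).continuous.comp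
      (BoundedContinuousFunction.lipschitz_eval_const _).continuous
  refine (Continuous.comp (g := fun G : BoundedContinuousFunction i.set (E [×i.order]→L[ℝ] 𝕜) =>
      G ⟨φ p, rfl⟩ 0) h (continuous_jet i)).congr fun f => ?_
  change iteratedFDeriv ℝ 0 (inChart φ ℓ f) (φ p) 0 = _
  rw [iteratedFDeriv_zero_apply, inChart_apply, φ.left_inv (mem_chart_source E p)]

instance : T2Space (SmoothCc 𝕜 E M 𝕜) :=
  T2Space.of_injective_continuous (f := fun f : SmoothCc 𝕜 E M 𝕜 => f.1) Subtype.val_injective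
    (continuous_pi fun p => (continuous_eval p (LinearMap.id : 𝕜 →ₗ[𝕜] 𝕜)).congr fun _ => rfl)

end InductiveLimit

end SmoothCc

/-! ### Limits of smooth functions -/

section SmoothLimits

variable {ι X Y : Type*} [NormedAddCommGroup X] [NormedSpace ℝ X] [LocallyCompactSpace X]
  [NormedAddCommGroup Y] [NormedSpace ℝ Y] {l : Filter ι} [l.NeBot] {f : ι → X → Y} {U : Set X}

/-- If all derivatives of smooth functions converge uniformly on compact sets, then the limit is
smooth, and its derivatives are the limits of the derivatives. -/
lemma contDiffOn_of_tendstoUniformlyOn_iteratedFDeriv (hU : IsOpen U)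
    (hf : ∀ n, ContDiffOn ℝ (⊤ : ℕ∞) (f n) U) {g : X → Y}
    (hg : ∀ v ∈ U, Filter.Tendsto (fun n => f n v) l (𝓝 (g v)))
    (hd : ∀ (k : ℕ) (C : Set X), IsCompact C → C ⊆ U → ∃ G : X → X [×k]→L[ℝ] Y,
      TendstoUniformlyOn (fun n => iteratedFDeriv ℝ k (f n)) G l C) :
    ContDiffOn ℝ (⊤ : ℕ∞) g U ∧ ∀ (k : ℕ) (C : Set X), IsCompact C → C ⊆ U →
      TendstoUniformlyOn (fun n => iteratedFDeriv ℝ k (f n)) (iteratedFDeriv ℝ k g) l C := by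
  -- Pointwise limits provide one candidate `G k` for each order, independent of the compact set;
  -- outside `U` its value is irrelevant.
  have hpt : ∀ (k : ℕ) (v : X), ∃ y : X [×k]→L[ℝ] Y,
      v ∈ U → Filter.Tendsto (fun n => iteratedFDeriv ℝ k (f n) v) l (𝓝 y) := fun k v => by
    by_cases hv : v ∈ U
    · obtain ⟨G, hG⟩ := hd k {v} isCompact_singleton (Set.singleton_subset_iff.2 hv)
      exact ⟨G v, fun _ => hG.tendsto_at rfl⟩
    · exact ⟨0, fun h => absurd h hv⟩
  choose G hG using hpt
  have hunif : ∀ (k : ℕ) (C : Set X), IsCompact C → C ⊆ U →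
      TendstoUniformlyOn (fun n => iteratedFDeriv ℝ k (f n)) (G k) l C := fun k C hC hCU => by
    obtain ⟨H, hH⟩ := hd k C hC hCU
    exact hH.congr_right fun v hv => tendsto_nhds_unique (hH.tendsto_at hv) (hG k v (hCU hv))
  have hloc : ∀ k, TendstoLocallyUniformlyOn (fun n => iteratedFDeriv ℝ k (f n)) (G k) l U :=
    fun k => (tendstoLocallyUniformlyOn_iff_forall_isCompact hU).2 fun C hCU hC => hunif k C hC hCU
  let P : X → FormalMultilinearSeries ℝ X Y := fun v k => G k v
  -- The limits `G k` form a Taylor series of `g`: the derivative of `G m` is the limit of the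
  -- derivatives, by locally uniform convergence at order `m + 1`.
  have hT : HasFTaylorSeriesUpToOn (⊤ : ℕ∞) g P U := by
    refine (hasFTaylorSeriesUpToOn_top_iff' le_rfl).2 ⟨fun v hv => ?_, fun m v hv => HasFDerivAt.hasFDerivWithinAt ?_⟩
    · refine tendsto_nhds_unique ?_ (hg v hv)
      exact ((ContinuousMultilinearMap.apply ℝ (fun _ : Fin 0 => X) Y 0).continuous.tendsto _).comp
        (hG 0 v hv)
    · refine hasFDerivAt_of_tendstoLocallyUniformlyOn (𝕜 := ℝ) hU
        (f := fun n => iteratedFDeriv ℝ m (f n))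
        (f' := fun n v => (iteratedFDeriv ℝ (m + 1) (f n) v).curryLeft)
        (g' := fun v => (G (m + 1) v).curryLeft) ?_ (fun n w hw => ?_) (fun w hw => hG m w hw) hv
      · exact (continuousMultilinearCurryLeftEquiv ℝ (fun _ : Fin (m + 1) => X)
          Y).isometry.uniformContinuous.comp_tendstoLocallyUniformlyOn (hloc (m + 1))
      · have h := (((hf n).contDiffAt (hU.mem_nhds hw)).differentiableAt_iteratedFDeriv
          (m := m) (by exact_mod_cast ENat.natCast_lt_top m)).hasFDerivAt
        exact h
  refine ⟨hT.contDiffOn, fun k C hC hCU => (hunif k C hC hCU).congr_right fun v hv => ?_⟩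
  rw [← iteratedFDerivWithin_of_isOpen k hU (hCU hv)]
  exact hT.eq_iteratedFDerivWithin_of_uniqueDiffOn (by exact_mod_cast le_top) hU.uniqueDiffOn
    (hCU hv)

end SmoothLimits

/-! ### Completeness of the spaces with fixed support -/

namespace SmoothCc

section Complete

variable {𝕜 E M : Type*} [RCLike 𝕜] [NormedAddCommGroup E] [NormedSpace ℝ E]
  [TopologicalSpace M] [ChartedSpace E M]
  [IsManifold 𝓘(ℝ, E) (⊤ : ℕ∞) M]

lemma contMDiff_of_forall_chart {g : M → 𝕜}
    (hg : ∀ φ ∈ atlas E M, ContDiffOn ℝ (⊤ : ℕ∞) (fun v => g (φ.symm v)) φ.target) :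
    ContMDiff 𝓘(ℝ, E) 𝓘(ℝ, 𝕜) (⊤ : ℕ∞) g := by
  intro p
  have hφ := chart_mem_atlas E p
  have h : ContMDiffOn 𝓘(ℝ, E) 𝓘(ℝ, 𝕜) (⊤ : ℕ∞) (fun q => g ((chartAt E p).symm (chartAt E p q)))
      (chartAt E p).source :=
    (contMDiffOn_iff_contDiffOn.2 (hg _ hφ)).comp
      (contMDiffOn_of_mem_maximalAtlas (IsManifold.subset_maximalAtlas hφ))
      (chartAt E p).mapsTo
  exact (h.congr fun q hq => by rw [(chartAt E p).left_inv hq]).contMDiffAt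
    ((chartAt E p).open_source.mem_nhds (mem_chart_source E p))

/-- Jets and evaluations are continuous on the whole of `C_c^∞(M)`, so a Cauchy filter there has a
smooth limit with convergence of all jets. Convergence in `C_K^∞(M)` passes back along the
continuous inclusion; no comparison of the subspace topology with the smooth topology is needed. -/
lemma isComplete_supportedIn [FiniteDimensional ℝ E] [T2Space M] {K : Set M} (hK : IsCompact K) :
    letI := IsTopologicalAddGroup.rightUniformSpace (SmoothCc 𝕜 E M 𝕜)
    IsComplete (supportedIn 𝕜 E 𝕜 K : Set (SmoothCc 𝕜 E M 𝕜)) := by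
  let _ := IsTopologicalAddGroup.rightUniformSpace (SmoothCc 𝕜 E M 𝕜)
  have : IsUniformAddGroup (SmoothCc 𝕜 E M 𝕜) := isUniformAddGroup_of_addCommGroup
  intro l hl hlK
  have := hl.1
  let ev (p : M) : SmoothCc 𝕜 E M 𝕜 →ₗ[𝕜] 𝕜 := LinearMap.proj p ∘ₗ (SmoothCc 𝕜 E M 𝕜).subtype
  have hev : ∀ p, Continuous (ev p) := fun p =>
    (continuous_eval p (LinearMap.id : 𝕜 →ₗ[𝕜] 𝕜)).congr fun _ => rfl
  have hlim : ∀ p, ∃ y : 𝕜, Filter.Tendsto (fun f : SmoothCc 𝕜 E M 𝕜 => f.1 p) l (𝓝 y) := fun p =>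
    CompleteSpace.complete (hl.map (uniformContinuous_addMonoidHom_of_continuous
      (f := (ev p).toAddMonoidHom) (hev p)))
  choose g hg using hlim
  have hgK : ∀ p ∉ K, g p = 0 := fun p hp => by
    refine tendsto_nhds_unique (hg p) (tendsto_const_nhds.congr' ?_)
    filter_upwards [Filter.le_principal_iff.1 hlK] with f hf
    exact (image_eq_zero_of_notMem_tsupport fun h => hp (hf h)).symm
  have hgs : tsupport g ⊆ K :=
    closure_minimal (Function.support_subset_iff'.2 hgK) hK.isClosed
  have key : ∀ (ℓ : 𝕜 →ₗ[𝕜] 𝕜) (φ : OpenPartialHomeomorph M E) (hφ : φ ∈ atlas E M),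
      ContDiffOn ℝ (⊤ : ℕ∞) (fun v => ℓ (g (φ.symm v))) φ.target ∧
      ∀ (k : ℕ) (C : Set E), IsCompact C → C ⊆ φ.target → TendstoUniformlyOn
        (fun f : SmoothCc 𝕜 E M 𝕜 => iteratedFDeriv ℝ k (inChart φ ℓ f))
        (iteratedFDeriv ℝ k (fun v => ℓ (g (φ.symm v)))) l C := by
    intro ℓ φ hφ
    refine contDiffOn_of_tendstoUniformlyOn_iteratedFDeriv φ.open_target
      (fun f => contDiffOn_chart f ℓ hφ) (fun v _ => ?_) fun k C hC hCφ => ?_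
    · exact ((LinearMap.continuous_of_finiteDimensional ℓ).tendsto _).comp (hg (φ.symm v))
    · let i : JetIndex 𝕜 E M 𝕜 := ⟨φ, hφ, k, ℓ, C, hC, hCφ⟩
      exact exists_tendstoUniformlyOn_of_cauchy i
        (hl.map (uniformContinuous_addMonoidHom_of_continuous
          (f := (jet i).toAddMonoidHom) (continuous_jet i)))
  let G : SmoothCc 𝕜 E M 𝕜 := ⟨g, HasCompactSupport.of_support_subset_isCompact hK
    (subset_closure.trans hgs), fun ℓ => contMDiff_of_forall_chart fun φ hφ => (key ℓ φ hφ).1⟩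
  refine ⟨G, hgs, ?_⟩
  have hjet : ∀ i : JetIndex 𝕜 E M 𝕜, Filter.Tendsto (jet i) l (𝓝 (jet i G)) := fun i =>
    (tendsto_jet_iff i id G).2
      ((key i.functional i.chart i.chart_mem).2 i.order i.set i.isCompact i.subset)
  have hrange : Set.range (SmoothOn.incl 𝕜 E 𝕜 K) ∈ l :=
    Filter.mem_of_superset (Filter.le_principal_iff.1 hlK) fun f hf => ⟨⟨f, hf⟩, rfl⟩
  have ht : Filter.Tendsto id (l.comap (SmoothOn.incl 𝕜 E 𝕜 K))
      (𝓝 (⟨G, hgs⟩ : SmoothOn 𝕜 E 𝕜 K)) :=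
    (SmoothOn.tendsto_nhds_iff _ _).2 fun i => (hjet i).comp Filter.tendsto_comap
  have h : (l.comap (SmoothOn.incl 𝕜 E 𝕜 K)).map (SmoothOn.incl 𝕜 E 𝕜 K) ≤ 𝓝 G :=
    ((SmoothOn.continuous_incl hK).tendsto _).comp ht
  rwa [Filter.map_comap_of_mem hrange] at h

end Complete

end SmoothCc

/-! ### Products with fixed supports -/

namespace SmoothCc

section Products

variable {𝕜 E M : Type*} [RCLike 𝕜] [NormedAddCommGroup E] [NormedSpace ℝ E]
  [TopologicalSpace M] [ChartedSpace E M]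

lemma mul_apply (f g : SmoothCc 𝕜 E M 𝕜) (p : M) : (f * g).1 p = f.1 p * g.1 p := rfl

lemma tsupport_mul_subset (f g : SmoothCc 𝕜 E M 𝕜) : tsupport (f * g).1 ⊆ tsupport f.1 :=
  tsupport_mul_subset_left

/-- The product `C_K^∞(M) × C_{K'}^∞(M) → C_K^∞(M)`. -/
def SmoothOn.mul {K K' : Set M} :
    SmoothOn 𝕜 E 𝕜 K →ₗ[𝕜] SmoothOn 𝕜 E 𝕜 K' →ₗ[𝕜] SmoothOn 𝕜 E 𝕜 K :=
  LinearMap.mk₂ 𝕜 (fun f g => ⟨incl 𝕜 E 𝕜 K f * incl 𝕜 E 𝕜 K' g,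
      (tsupport_mul_subset _ _).trans f.incl_mem⟩)
    (fun _ _ _ => incl_injective (add_mul _ _ _))
    (fun _ _ _ => incl_injective (smul_mul_assoc _ _ _))
    (fun _ _ _ => incl_injective (mul_add _ _ _))
    (fun _ _ _ => incl_injective (mul_smul_comm _ _ _))

variable [IsManifold 𝓘(ℝ, E) (⊤ : ℕ∞) M]

lemma norm_iteratedFDeriv_inChart_mul_le (i : JetIndex 𝕜 E M 𝕜) (f g : SmoothCc 𝕜 E M 𝕜) {v : E}
    (hv : v ∈ i.set) : ‖iteratedFDeriv ℝ i.order (inChart i.chart i.functional (f * g)) v‖ ≤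
      ∑ j ∈ Finset.range (i.order + 1), (i.order.choose j : ℝ) *
        ‖iteratedFDeriv ℝ j (inChart i.chart i.functional f) v‖ *
        ‖iteratedFDeriv ℝ (i.order - j) (inChart i.chart LinearMap.id g) v‖ := by
  have h : inChart i.chart i.functional (f * g) = fun v =>
      inChart i.chart i.functional f v * inChart i.chart LinearMap.id g v := funext fun u => by
    rw [inChart_apply, inChart_apply, inChart_apply, mul_apply, mul_comm, ← smul_eq_mul, map_smul,
      smul_eq_mul, mul_comm]
    rfl
  have hU := i.chart.open_target
  have hvU := i.subset hv
  rw [h]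
  have := norm_iteratedFDerivWithin_mul_le (contDiffOn_chart f i.functional i.chart_mem)
    (contDiffOn_chart g LinearMap.id i.chart_mem) hU.uniqueDiffOn hvU (n := i.order)
    (by exact_mod_cast le_top)
  simpa only [iteratedFDerivWithin_of_isOpen _ hU hvU] using this

/-- Replace the order and the functional in the data of a seminorm. -/
def JetIndex.change (i : JetIndex 𝕜 E M 𝕜) (k : ℕ) (ℓ : 𝕜 →ₗ[𝕜] 𝕜) : JetIndex 𝕜 E M 𝕜 :=
  ⟨i.chart, i.chart_mem, k, ℓ, i.set, i.isCompact, i.subset⟩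

/-- The seminorm `f ↦ ∑ₖ cₖ ‖jet f‖` over orders up to `n`, on `C_K^∞(M)`. -/
def SmoothOn.jetSeminorm (K : Set M) (i : JetIndex 𝕜 E M 𝕜) (ℓ : 𝕜 →ₗ[𝕜] 𝕜) :
    Seminorm 𝕜 (SmoothOn 𝕜 E 𝕜 K) :=
  ∑ j ∈ Finset.range (i.order + 1), (i.order.choose j : NNReal) •
    (normSeminorm 𝕜 (JetSpace (i.change j ℓ))).comp (jet (i.change j ℓ) ∘ₗ incl 𝕜 E 𝕜 K)

lemma SmoothOn.jetSeminorm_apply {K : Set M} (i : JetIndex 𝕜 E M 𝕜) (ℓ : 𝕜 →ₗ[𝕜] 𝕜)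
    (f : SmoothOn 𝕜 E 𝕜 K) : jetSeminorm K i ℓ f = ∑ j ∈ Finset.range (i.order + 1),
      (i.order.choose j : ℝ) * ‖jet (i.change j ℓ) (incl 𝕜 E 𝕜 K f)‖ := by
  rw [jetSeminorm, sum_apply]
  rfl

lemma SmoothOn.continuous_jetSeminorm {K : Set M} (i : JetIndex 𝕜 E M 𝕜) (ℓ : 𝕜 →ₗ[𝕜] 𝕜) :
    Continuous (jetSeminorm K i ℓ) := by
  have h : ⇑(jetSeminorm K i ℓ) = _ := funext (jetSeminorm_apply i ℓ)
  rw [h]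
  exact continuous_finsetSum _ fun j _ => continuous_const.mul (continuous_jet_incl _).norm

lemma SmoothOn.continuous_mul {K K' : Set M} :
    Continuous fun z : SmoothOn 𝕜 E 𝕜 K × SmoothOn 𝕜 E 𝕜 K' => mul z.1 z.2 := by
  refine continuous_bilinear_of_seminorm_bound withSeminorms mul fun ⟨i, _⟩ =>
    ⟨jetSeminorm K i i.functional, jetSeminorm K' i LinearMap.id, continuous_jetSeminorm _ _,
      continuous_jetSeminorm _ _, fun f g => ?_⟩
  change ‖jet i (incl 𝕜 E 𝕜 K f * incl 𝕜 E 𝕜 K' g)‖ ≤ _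
  rw [norm_jet_le_iff i _ (mul_nonneg (apply_nonneg _ _) (apply_nonneg _ _))]
  intro v hv
  refine (norm_iteratedFDeriv_inChart_mul_le i _ _ hv).trans ?_
  rw [jetSeminorm_apply, Finset.sum_mul]
  refine Finset.sum_le_sum fun j hj => ?_
  have hj' : j ≤ i.order := Nat.lt_succ_iff.1 (Finset.mem_range.1 hj)
  refine mul_le_mul (mul_le_mul_of_nonneg_left
    (norm_iteratedFDeriv_le_norm_jet (i.change j i.functional) _ hv) (Nat.cast_nonneg _)) ?_
    (norm_nonneg _) (by positivity)
  refine (norm_iteratedFDeriv_le_norm_jet (i.change (i.order - j) LinearMap.id) _ hv).trans ?_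
  rw [jetSeminorm_apply]
  refine le_trans ?_ (Finset.single_le_sum
    (f := fun j => (i.order.choose j : ℝ) * ‖jet (i.change j LinearMap.id) (incl 𝕜 E 𝕜 K' g)‖)
    (fun _ _ => by positivity) (Finset.mem_range.2 (Nat.lt_succ_iff.2 (Nat.sub_le i.order j))))
  -- The weights `choose` are at least `1` at orders up to `i.order`, so the single jet of `g` is
  -- dominated by the weighted sum.
  refine le_mul_of_one_le_left (norm_nonneg _) ?_
  exact_mod_cast Nat.choose_pos (Nat.sub_le i.order j)

end Products

end SmoothCc

/-! ### Seminorms on the inductive limit -/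

section SeminormTopology

variable {𝕜 V : Type*} [RCLike 𝕜] [AddCommGroup V] [Module 𝕜 V]

/-- The space `V` with the topology of the single seminorm `p`. -/
def WithSeminorm (_ : Seminorm 𝕜 V) : Type _ := V

instance (p : Seminorm 𝕜 V) : AddCommGroup (WithSeminorm p) := inferInstanceAs (AddCommGroup V)

instance (p : Seminorm 𝕜 V) : Module 𝕜 (WithSeminorm p) := inferInstanceAs (Module 𝕜 V)

/-- The family that consists of the seminorm `p`. -/
def WithSeminorm.family (p : Seminorm 𝕜 V) : SeminormFamily 𝕜 (WithSeminorm p) Unit := fun _ => p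

instance (p : Seminorm 𝕜 V) : TopologicalSpace (WithSeminorm p) :=
  (WithSeminorm.family p).moduleFilterBasis.topology

lemma WithSeminorm.withSeminorms (p : Seminorm 𝕜 V) : WithSeminorms (WithSeminorm.family p) := ⟨rfl⟩

instance (p : Seminorm 𝕜 V) : PolynormableSpace 𝕜 (WithSeminorm p) :=
  (WithSeminorm.withSeminorms p).toPolynormableSpace

end SeminormTopology

namespace SmoothCc

section Limit

variable {𝕜 E M F : Type*} [RCLike 𝕜] [NormedAddCommGroup E] [NormedSpace ℝ E]
  [TopologicalSpace M] [ChartedSpace E M] [AddCommGroup F] [Module 𝕜 F]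
  [IsManifold 𝓘(ℝ, E) (⊤ : ℕ∞) M]

/-- The universal property concerns linear maps; it is applied to the identity map into the space
topologized by `p` alone. -/
lemma continuous_seminorm (p : Seminorm 𝕜 (SmoothCc 𝕜 E M F))
    (h : ∀ K : Set M, IsCompact K → Continuous fun f => p (SmoothOn.incl 𝕜 E F K f)) :
    Continuous p := by
  let T : SmoothCc 𝕜 E M F →ₗ[𝕜] WithSeminorm p := LinearMap.id
  have hT : Continuous T := continuous_of_continuous_comp_incl T fun K hK =>
    (WithSeminorm.withSeminorms p).continuous_of_continuous_comp _ fun _ => h K hK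
  exact ((WithSeminorm.withSeminorms p).continuous_seminorm ()).comp hT

/-- The sum of a locally finite sequence of continuous seminorms. -/
lemma exists_seminorm_sum_le (K : CompactExhaustion M) (q : ℕ → Seminorm 𝕜 (SmoothCc 𝕜 E M F))
    (hq : ∀ n, Continuous (q n)) (N : ℕ → ℕ)
    (h0 : ∀ m, ∀ f ∈ supportedIn 𝕜 E F (K m), ∀ n, N m ≤ n → q n f = 0) :
    ∃ Q : Seminorm 𝕜 (SmoothCc 𝕜 E M F), Continuous Q ∧
      ∀ f n, ∑ i ∈ Finset.range n, q i f ≤ Q f := by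
  have hsum : ∀ m, ∀ f ∈ supportedIn 𝕜 E F (K m),
      HasSum (fun n => q n f) (∑ n ∈ Finset.range (N m), q n f) := fun m f hf =>
    hasSum_sum_of_ne_finset_zero fun n hn => h0 m f hf n (by simpa using hn)
  have hex : ∀ f : SmoothCc 𝕜 E M F, ∃ m, f ∈ supportedIn 𝕜 E F (K m) := fun f =>
    K.exists_superset_of_isCompact f.2.1
  have hsm : ∀ f, Summable fun n => q n f := fun f =>
    let ⟨m, hm⟩ := hex f
    (hsum m f hm).summable
  -- The seminorm is the full series. On functions supported in `K m` only the first `N m` terms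
  -- survive, so it is continuous on each step of the limit.
  refine ⟨Seminorm.of (fun f => ∑' n, q n f) (fun f g => ?_) (fun c f => ?_), ?_, fun f n => ?_⟩
  · rw [← (hsm f).tsum_add (hsm g)]
    exact (hsm _).tsum_le_tsum (fun n => map_add_le_add (q n) f g) ((hsm f).add (hsm g))
  · simp only [map_smul_eq_mul]
    exact tsum_mul_left
  · refine continuous_seminorm _ fun C hC => ?_
    obtain ⟨m, hm⟩ := K.exists_superset_of_isCompact hC
    refine (continuous_finsetSum (Finset.range (N m)) fun n _ =>
      (hq n).comp (SmoothOn.continuous_incl (𝕜 := 𝕜) (E := E) (F := F) hC)).congr fun f => ?_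
    exact (hsum m _ (f.incl_mem.trans hm)).tsum_eq.symm
  · exact (hsm f).sum_le_tsum _ fun i _ => apply_nonneg (q i) f

end Limit

/-! ### Cutoff functions and joint continuity of the product -/

section Cutoffs

variable {𝕜 E M : Type*} [RCLike 𝕜] [NormedAddCommGroup E] [NormedSpace ℝ E]
  [TopologicalSpace M] [ChartedSpace E M]

lemma mul_eq_of_eqOn {e f : SmoothCc 𝕜 E M 𝕜} {K : Set M} (he : ∀ p ∈ K, e.1 p = 1)
    (hf : f ∈ supportedIn 𝕜 E 𝕜 K) : e * f = f := by
  refine Subtype.ext (funext fun p => ?_)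
  rw [mul_apply]
  by_cases hp : p ∈ K
  · rw [he p hp, one_mul]
  · rw [image_eq_zero_of_notMem_tsupport fun h => hp (hf h), mul_zero]

lemma mul_mem_supportedIn {f : SmoothCc 𝕜 E M 𝕜} {K : Set M} (hf : f ∈ supportedIn 𝕜 E 𝕜 K)
    (g : SmoothCc 𝕜 E M 𝕜) : f * g ∈ supportedIn 𝕜 E 𝕜 K :=
  (tsupport_mul_subset f g).trans hf

variable [IsManifold 𝓘(ℝ, E) (⊤ : ℕ∞) M]

variable (𝕜 E) in
lemma exists_cutoff [FiniteDimensional ℝ E] [T2Space M] [SigmaCompactSpace M]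
    (K : CompactExhaustion M) (n : ℕ) : ∃ e : SmoothCc 𝕜 E M 𝕜,
      (∀ p ∈ K n, e.1 p = 1) ∧ e ∈ supportedIn 𝕜 E 𝕜 (K (n + 1)) := by
  obtain ⟨f, hf0, hf1, -⟩ := exists_contMDiffMap_zero_one_of_isClosed (n := (⊤ : ℕ∞))
    𝓘(ℝ, E) (s := (interior (K (n + 1)))ᶜ) (t := K n) isOpen_interior.isClosed_compl
    (K.isCompact n).isClosed
    (Set.disjoint_left.2 fun p hp hp' => hp (K.subset_interior_succ n hp'))
  have hs : tsupport (fun p => ((f p : ℝ) : 𝕜)) ⊆ K (n + 1) := by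
    refine closure_minimal (Function.support_subset_iff'.2 fun p hp => ?_)
      (K.isCompact (n + 1)).isClosed
    have h : f p = 0 := hf0 fun h => hp (interior_subset h)
    rw [h, RCLike.ofReal_zero]
  refine ⟨⟨fun p => ((f p : ℝ) : 𝕜), HasCompactSupport.of_support_subset_isCompact
    (K.isCompact (n + 1)) (subset_closure.trans hs), fun ℓ => contMDiff_functional ℓ
      ((RCLike.ofRealCLM (K := 𝕜)).contDiff.comp_contMDiff f.contMDiff)⟩, fun p hp => ?_, hs⟩
  have h : f p = 1 := hf1 hp
  change ((f p : ℝ) : 𝕜) = 1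
  rw [h, RCLike.ofReal_one]

lemma isLimitOfUnitalSubalgebras [FiniteDimensional ℝ E] [T2Space M] [SigmaCompactSpace M] :
    IsLimitOfUnitalSubalgebras 𝕜 (SmoothCc 𝕜 E M 𝕜) := by
  have : LocallyCompactSpace M := ChartedSpace.locallyCompactSpace E M
  let K := CompactExhaustion.choice M
  refine ⟨fun n => { supportedIn 𝕜 E 𝕜 (K n) with
    mul_mem' := fun hf _ => mul_mem_supportedIn hf _ }, fun m n hmn f hf => ?_, fun f => ?_,
    fun n => isComplete_supportedIn (K.isCompact n), fun n => ?_, fun p hp => ?_⟩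
  · exact Set.Subset.trans hf (K.subset hmn)
  · exact K.exists_superset_of_isCompact f.2.1
  · obtain ⟨e, he, -⟩ := exists_cutoff 𝕜 E K n
    exact ⟨e, fun f hf => mul_eq_of_eqOn he hf⟩
  · refine continuous_seminorm p fun C hC => ?_
    obtain ⟨n, hn⟩ := K.exists_superset_of_isCompact hC
    exact (hp n).comp ((SmoothOn.continuous_incl hC).subtype_mk fun f => f.incl_mem.trans hn)

/-- Multiplication by a function with support in `K`, as a map into `C_K^∞(M)`. -/
def mulInto {K : Set M} (h : SmoothOn 𝕜 E 𝕜 K) : SmoothCc 𝕜 E M 𝕜 →ₗ[𝕜] SmoothOn 𝕜 E 𝕜 K where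
  toFun f := ⟨SmoothOn.incl 𝕜 E 𝕜 K h * f, mul_mem_supportedIn h.incl_mem f⟩
  map_add' _ _ := SmoothOn.incl_injective (mul_add _ _ _)
  map_smul' _ _ := SmoothOn.incl_injective (mul_smul_comm _ _ _)

lemma continuous_mulInto {K : Set M} (h : SmoothOn 𝕜 E 𝕜 K) : Continuous (mulInto h) :=
  continuous_of_continuous_comp_incl _ fun _ _ =>
    SmoothOn.continuous_mul.comp (Continuous.prodMk_right h)

/-- A locally finite partition of products: `f g = ∑ (h n f) (χ n g)`, where the functions `h n`
and `χ n` are supported in the sets of a compact exhaustion and vanish on given compact sets for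
large `n`. -/
lemma exists_partition [FiniteDimensional ℝ E] [T2Space M] [SigmaCompactSpace M]
    (K : CompactExhaustion M) : ∃ h χ : ∀ n, SmoothOn 𝕜 E 𝕜 (K (n + 2)),
      (∀ m, ∀ f ∈ supportedIn 𝕜 E 𝕜 (K m), ∀ n, m + 2 ≤ n →
        mulInto (h n) f = 0 ∧ mulInto (χ n) f = 0) ∧
      ∀ m, ∀ f ∈ supportedIn 𝕜 E 𝕜 (K m), ∀ g, f * g = ∑ n ∈ Finset.range (m + 1),
        SmoothOn.incl 𝕜 E 𝕜 _ (mulInto (h n) f) * SmoothOn.incl 𝕜 E 𝕜 _ (mulInto (χ n) g) := by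
  choose e he hes using exists_cutoff 𝕜 E K
  obtain ⟨ε, hε0, hεs, hε⟩ : ∃ ε : ℕ → SmoothCc 𝕜 E M 𝕜, ε 0 = 0 ∧
      (∀ n, ε n ∈ supportedIn 𝕜 E 𝕜 (K n)) ∧
      ∀ m n, m < n → ∀ f ∈ supportedIn 𝕜 E 𝕜 (K m), ε n * f = f := by
    -- The index shift, with `ε 0 = 0`, makes `ε n` supported in `K n` and a unit on `K m` for every
    -- `m < n`.
    refine ⟨fun n => Nat.casesOn n 0 e, rfl, fun n => ?_, fun m n hmn f hf => ?_⟩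
    · cases n with
      | zero => exact zero_mem _
      | succ n => exact hes n
    · cases n with
      | zero => exact absurd hmn (Nat.not_lt_zero m)
      | succ n => exact mul_eq_of_eqOn (fun p hp => he n p (K.subset (Nat.lt_succ_iff.1 hmn) hp)) hf
  have hεε : ∀ m n, m < n → ε n * ε m = ε m := fun m n hmn => hε m n hmn _ (hεs m)
  have hmono : ∀ {m n}, m ≤ n → supportedIn 𝕜 E 𝕜 (K m) ≤ supportedIn 𝕜 E 𝕜 (K n) :=
    fun hmn f hf => Set.Subset.trans hf (K.subset hmn)
  let h (n : ℕ) : SmoothOn 𝕜 E 𝕜 (K (n + 2)) :=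
    ⟨ε (n + 1) - ε n, sub_mem (hmono (by omega) (hεs _)) (hmono (by omega) (hεs _))⟩
  -- One index further on either side than in `h n`, so that `h n * χ n = h n`. For `n = 0` the
  -- truncated `n - 1` is `0`, which is harmless since `ε 0 = 0`. The lower index is why vanishing
  -- on `K m` starts at `m + 2`.
  let χ (n : ℕ) : SmoothOn 𝕜 E 𝕜 (K (n + 2)) :=
    ⟨ε (n + 2) - ε (n - 1), sub_mem (hεs _) (hmono (by omega) (hεs _))⟩
  have hh : ∀ n f, SmoothOn.incl 𝕜 E 𝕜 _ (mulInto (h n) f) = (ε (n + 1) - ε n) * f :=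
    fun _ _ => rfl
  have hχ : ∀ n f, SmoothOn.incl 𝕜 E 𝕜 _ (mulInto (χ n) f) = (ε (n + 2) - ε (n - 1)) * f :=
    fun _ _ => rfl
  have hhχ : ∀ n, (ε (n + 1) - ε n) * (ε (n + 2) - ε (n - 1)) = ε (n + 1) - ε n := fun n => by
    have h1 : ε n * ε (n - 1) = ε (n - 1) := by
      rcases Nat.eq_zero_or_pos n with rfl | hn
      · rw [hε0, mul_zero]
      · exact hεε _ _ (by omega)
    rw [sub_mul, mul_sub, mul_sub, h1, hεε (n - 1) (n + 1) (by omega), mul_comm, mul_comm (ε n),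
      hεε (n + 1) (n + 2) (by omega), hεε n (n + 2) (by omega)]
    abel
  refine ⟨h, χ, fun m f hf n hn => ⟨SmoothOn.incl_injective ?_, SmoothOn.incl_injective ?_⟩,
    fun m f hf g => ?_⟩
  · rw [hh, sub_mul, hε m _ (by omega) f hf, hε m _ (by omega) f hf, sub_self, map_zero]
  · rw [hχ, sub_mul, hε m _ (by omega) f hf, hε m _ (by omega) f hf, sub_self, map_zero]
  · simp only [hh, hχ, mul_mul_mul_comm _ f, hhχ]
    -- The `h n` with `n ≤ m` telescope to `ε (m + 1)`, which is a unit for `f`.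
    rw [← Finset.sum_mul, Finset.sum_range_sub, hε0, sub_zero, ← mul_assoc,
      hε m _ (Nat.lt_succ_self m) f hf]

/-- Products on fixed supports give `p(fg) ≤ s n (f) * s' n (g)` with seminorms that depend on `n`.
Inserting the partition and bounding `∑ aₙ bₙ` by `(∑ aₙ)(∑ bₙ)` produces a single pair of
seminorms, continuous because both sums are locally finite. -/
instance [FiniteDimensional ℝ E] [T2Space M] [SigmaCompactSpace M] :
    ContinuousMul (SmoothCc 𝕜 E M 𝕜) where
  continuous_mul := by
    have : LocallyCompactSpace M := ChartedSpace.locallyCompactSpace E M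
    let K := CompactExhaustion.choice M
    obtain ⟨h, χ, hzero, hsum⟩ := exists_partition (𝕜 := 𝕜) (E := E) K
    refine continuous_bilinear_of_seminorm_bound (PolynormableSpace.withSeminorms 𝕜 _)
      (LinearMap.mul 𝕜 (SmoothCc 𝕜 E M 𝕜)) fun ⟨p, hp⟩ => ?_
    have hb : ∀ n, ∃ s s' : Seminorm 𝕜 (SmoothOn 𝕜 E 𝕜 (K (n + 2))), Continuous s ∧
        Continuous s' ∧ ∀ f g, p (SmoothOn.incl 𝕜 E 𝕜 _ (SmoothOn.mul f g)) ≤ s f * s' g :=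
      fun n => exists_seminorm_bound_of_continuous p
        (SmoothOn.mul.compr₂ (SmoothOn.incl 𝕜 E 𝕜 (K (n + 2))))
        (hp.comp ((SmoothOn.continuous_incl (K.isCompact (n + 2))).comp SmoothOn.continuous_mul))
    choose s s' hs hs' hle using hb
    obtain ⟨P, hP, hPle⟩ := exists_seminorm_sum_le K (fun n => (s n).comp (mulInto (h n)))
      (fun n => (hs n).comp (continuous_mulInto (h n))) (fun m => m + 2) fun m f hf n hn => by
        rw [Seminorm.comp_apply, (hzero m f hf n hn).1, map_zero]
    obtain ⟨Q, hQ, hQle⟩ := exists_seminorm_sum_le K (fun n => (s' n).comp (mulInto (χ n)))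
      (fun n => (hs' n).comp (continuous_mulInto (χ n))) (fun m => m + 2) fun m f hf n hn => by
        rw [Seminorm.comp_apply, (hzero m f hf n hn).2, map_zero]
    refine ⟨P, Q, hP, hQ, fun f g => ?_⟩
    obtain ⟨m, hm⟩ := K.exists_superset_of_isCompact f.2.1
    change p (f * g) ≤ _
    rw [hsum m f hm g]
    calc _ ≤ ∑ n ∈ Finset.range (m + 1), s n (mulInto (h n) f) * s' n (mulInto (χ n) g) :=
          (Finset.le_sum_of_subadditive p (map_zero p).le (map_add_le_add p) _ _).trans
            (Finset.sum_le_sum fun n _ => hle n _ _)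
      _ ≤ (∑ n ∈ Finset.range (m + 1), s n (mulInto (h n) f)) *
          ∑ n ∈ Finset.range (m + 1), s' n (mulInto (χ n) g) :=
        (Finset.sum_le_sum fun n hn => mul_le_mul_of_nonneg_left (Finset.single_le_sum
          (f := fun n => s' n (mulInto (χ n) g)) (fun _ _ => apply_nonneg _ _) hn)
            (apply_nonneg _ _)).trans_eq (Finset.sum_mul _ _ _).symm
      _ ≤ P f * Q g := mul_le_mul (hPle f _) (hQle g _)
        (Finset.sum_nonneg fun n _ => apply_nonneg _ _) (apply_nonneg _ _)

end Cutoffs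

end SmoothCc

/-! ### Vector-valued functions as a tensor product -/

namespace SmoothCc

section VectorValued

variable {𝕜 E M F : Type*} [RCLike 𝕜] [NormedAddCommGroup E] [NormedSpace ℝ E]
  [TopologicalSpace M] [ChartedSpace E M] [AddCommGroup F] [Module 𝕜 F]

lemma smulVec_apply (a : SmoothCc 𝕜 E M 𝕜) (x : F) (p : M) : (smulVec a x).1 p = a.1 p • x := rfl

variable (𝕜 E M F) in
/-- The linear map `C_c^∞(M) ⊗ F → C_c^∞(M, F)`. -/
def ofTensor : ProjTensor 𝕜 (SmoothCc 𝕜 E M 𝕜) F →ₗ[𝕜] SmoothCc 𝕜 E M F :=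
  ProjTensor.lift (LinearMap.mk₂ 𝕜 smulVec
    (fun _ _ _ => Subtype.ext (funext fun _ => add_smul _ _ _))
    (fun _ _ _ => Subtype.ext (funext fun _ => mul_smul _ _ _))
    (fun _ _ _ => Subtype.ext (funext fun _ => smul_add _ _ _))
    (fun _ _ _ => Subtype.ext (funext fun _ => smul_comm _ _ _)))

lemma ofTensor_mk (a : SmoothCc 𝕜 E M 𝕜) (x : F) :
    ofTensor 𝕜 E M F (ProjTensor.mk 𝕜 _ _ a x) = smulVec a x := rfl

/-- The component `ℓ ∘ f`. -/
def component (ℓ : F →ₗ[𝕜] 𝕜) : SmoothCc 𝕜 E M F →ₗ[𝕜] SmoothCc 𝕜 E M 𝕜 where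
  toFun f := ⟨fun p => ℓ (f.1 p), f.2.1.comp_left (map_zero ℓ), fun m => f.2.2 (m ∘ₗ ℓ)⟩
  map_add' _ _ := Subtype.ext (funext fun _ => map_add ℓ _ _)
  map_smul' _ _ := Subtype.ext (funext fun _ => map_smul ℓ _ _)

lemma component_apply (ℓ : F →ₗ[𝕜] 𝕜) (f : SmoothCc 𝕜 E M F) (p : M) :
    (component ℓ f).1 p = ℓ (f.1 p) := rfl

variable [IsManifold 𝓘(ℝ, E) (⊤ : ℕ∞) M] [FiniteDimensional 𝕜 F] [TopologicalSpace F]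
  [IsTopologicalAddGroup F] [ContinuousSMul 𝕜 F] [T2Space F]

variable (𝕜 E M F) in
/-- The isomorphism `C_c^∞(M, F) ≃ C_c^∞(M) ⊗ F` for finite-dimensional `F`. -/
def equivTensor : SmoothCc 𝕜 E M F ≃L[𝕜] ProjTensor 𝕜 (SmoothCc 𝕜 E M 𝕜) F :=
  let b := Module.finBasis 𝕜 F
  let T : SmoothCc 𝕜 E M F →ₗ[𝕜] ProjTensor 𝕜 (SmoothCc 𝕜 E M 𝕜) F :=
    ∑ i, (ProjTensor.mk 𝕜 _ F).flip (b i) ∘ₗ component (b.coord i)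
  have hT : ∀ f, T f = ∑ i, ProjTensor.mk 𝕜 _ F (component (b.coord i) f) (b i) := fun f => by
    rw [LinearMap.sum_apply]
    rfl
  { toLinearEquiv := LinearEquiv.ofLinearMap T (ofTensor 𝕜 E M F)
      (ProjTensor.ext_mk fun a x => by
        rw [LinearMap.comp_apply, ofTensor_mk, hT, LinearMap.id_apply]
        have h : ∀ i, component (b.coord i) (smulVec a x) = b.coord i x • a := fun i =>
          Subtype.ext (funext fun p => by
            rw [component_apply, smulVec_apply, map_smul, smul_eq_mul, mul_comm]
            rfl)
        simp only [h, map_smul, LinearMap.smul_apply]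
        conv_rhs => rw [← b.sum_repr x, map_sum]
        simp)
      (LinearMap.ext fun f => by
        rw [LinearMap.comp_apply, hT, map_sum, LinearMap.id_apply]
        refine Subtype.ext (funext fun p => ?_)
        simp only [ofTensor_mk, AddSubmonoidClass.coe_finsetSum, Finset.sum_apply, smulVec_apply,
          component_apply]
        exact b.sum_repr (f.1 p))
    continuous_toFun := by
      change Continuous fun f => T f
      simp only [hT]
      exact continuous_finsetSum _ fun i _ => (ProjTensor.continuous_mk_left (b i)).comp
        (continuous_of_forall_functional _ (b.coord i) fun _ _ => rfl)
    continuous_invFun := ProjTensor.continuous_of_continuous_mk_left (ofTensor 𝕜 E M F) fun x =>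
      continuous_of_forall_functional (ofTensor 𝕜 E M F ∘ₗ (ProjTensor.mk 𝕜 _ F).flip x)
        (LinearMap.toSpanSingleton 𝕜 F x) fun _ _ => rfl }

lemma equivTensor_symm_apply (z : ProjTensor 𝕜 (SmoothCc 𝕜 E M 𝕜) F) :
    (equivTensor 𝕜 E M F).symm z = ofTensor 𝕜 E M F z := rfl

lemma equivTensor_smulVec (a : SmoothCc 𝕜 E M 𝕜) (x : F) :
    equivTensor 𝕜 E M F (smulVec a x) = ProjTensor.mk 𝕜 _ F a x :=
  (equivTensor 𝕜 E M F).apply_symm_apply (ProjTensor.mk 𝕜 _ F a x)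

end VectorValued

section Lie

variable {𝕜 E M 𝔤 : Type*} [RCLike 𝕜] [NormedAddCommGroup E] [NormedSpace ℝ E]
  [TopologicalSpace M] [ChartedSpace E M] [LieRing 𝔤] [LieAlgebra 𝕜 𝔤] [FiniteDimensional 𝕜 𝔤]

lemma lie_smulVec (a b : SmoothCc 𝕜 E M 𝕜) (x y : 𝔤) :
    ⁅smulVec a x, smulVec b y⁆ = smulVec (a * b) ⁅x, y⁆ := by
  refine Subtype.ext (funext fun p => ?_)
  change ⁅a.1 p • x, b.1 p • y⁆ = (a.1 p * b.1 p) • ⁅x, y⁆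
  rw [smul_lie, lie_smul, smul_smul]

lemma ofTensor_lie (u v : ProjTensor 𝕜 (SmoothCc 𝕜 E M 𝕜) 𝔤) :
    ofTensor 𝕜 E M 𝔤 ⁅u, v⁆ = ⁅ofTensor 𝕜 E M 𝔤 u, ofTensor 𝕜 E M 𝔤 v⁆ := by
  induction u using ProjTensor.ind with
  | h0 => rw [zero_lie, map_zero, zero_lie]
  | hadd u u' hu hu' => rw [add_lie, map_add, map_add, add_lie, hu, hu']
  | hmk a x =>
    induction v using ProjTensor.ind with
    | h0 => rw [lie_zero, map_zero, lie_zero]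
    | hadd v v' hv hv' => rw [lie_add, map_add, map_add, lie_add, hv, hv']
    | hmk b y => rw [lie_mk, ofTensor_mk, ofTensor_mk, ofTensor_mk, lie_smulVec]

variable [IsManifold 𝓘(ℝ, E) (⊤ : ℕ∞) M] [TopologicalSpace 𝔤]
  [IsTopologicalAddGroup 𝔤] [ContinuousSMul 𝕜 𝔤] [T2Space 𝔤]

lemma equivTensor_lie (f g : SmoothCc 𝕜 E M 𝔤) :
    equivTensor 𝕜 E M 𝔤 ⁅f, g⁆ = ⁅equivTensor 𝕜 E M 𝔤 f, equivTensor 𝕜 E M 𝔤 g⁆ := by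
  rw [← ContinuousLinearEquiv.eq_symm_apply, equivTensor_symm_apply, ofTensor_lie,
    ← equivTensor_symm_apply, ← equivTensor_symm_apply, ContinuousLinearEquiv.symm_apply_apply,
    ContinuousLinearEquiv.symm_apply_apply]

theorem exists_isUniversalCocycle [LieAlgebra.IsKilling 𝕜 𝔤] [FiniteDimensional ℝ E] [T2Space M]
    [SigmaCompactSpace M] :
    ∃ ω : SmoothCc 𝕜 E M 𝔤 →ₗ[𝕜] SmoothCc 𝕜 E M 𝔤 →ₗ[𝕜] MaierSpace 𝕜 (SmoothCc 𝕜 E M 𝕜) 𝔤,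
      (∀ (a b : SmoothCc 𝕜 E M 𝕜) (x y : 𝔤), ω (smulVec a x) (smulVec b y) =
        maierValue 𝕜 (SmoothCc 𝕜 E M 𝕜) 𝔤 a b x y) ∧ IsUniversalCocycle.{w} ω := by
  have hA : IsLimitOfUnitalSubalgebras 𝕜 (SmoothCc 𝕜 E M 𝕜) := isLimitOfUnitalSubalgebras
  obtain ⟨ω, hω, hu⟩ := hA.exists_isUniversalCocycle_of_equiv (equivTensor 𝕜 E M 𝔤) equivTensor_lie
  refine ⟨ω, fun a b x y => ?_, hu⟩
  rw [hω, equivTensor_smulVec, equivTensor_smulVec, maierCocycle_mk]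

end Lie

end SmoothCc

end CurrentLie

end

open CurrentLie in
theorem mainTheorem4 {𝕜 : Type*} [RCLike 𝕜]
    {𝔤 : Type*} [LieRing 𝔤] [LieAlgebra 𝕜 𝔤] [FiniteDimensional 𝕜 𝔤]
    [LieAlgebra.IsSemisimple 𝕜 𝔤]
    [TopologicalSpace 𝔤] [IsTopologicalAddGroup 𝔤] [ContinuousSMul 𝕜 𝔤] [T2Space 𝔤] :
    (∀ (A : Type*) [NonUnitalCommRing A] [Module 𝕜 A] [IsScalarTower 𝕜 A A]
      [SMulCommClass 𝕜 A A] [TopologicalSpace A] [IsTopologicalAddGroup A]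
      [ContinuousSMul 𝕜 A] [ContinuousMul A] [PolynormableSpace 𝕜 A] [T2Space A],
      IsLimitOfUnitalSubalgebras 𝕜 A →
        IsUniversalCocycle.{w} (maierCocycle 𝕜 A 𝔤)) ∧
    (∀ (E : Type*) [NormedAddCommGroup E] [NormedSpace ℝ E] [FiniteDimensional ℝ E]
      (M : Type*) [TopologicalSpace M] [T2Space M] [SigmaCompactSpace M] [ChartedSpace E M]
      [IsManifold 𝓘(ℝ, E) (⊤ : ℕ∞) M],
      (ContinuousMul (SmoothCc 𝕜 E M 𝕜) ∧ T2Space (SmoothCc 𝕜 E M 𝕜) ∧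
        IsLimitOfUnitalSubalgebras 𝕜 (SmoothCc 𝕜 E M 𝕜)) ∧
      ∃ ω : SmoothCc 𝕜 E M 𝔤 →ₗ[𝕜] SmoothCc 𝕜 E M 𝔤 →ₗ[𝕜] MaierSpace 𝕜 (SmoothCc 𝕜 E M 𝕜) 𝔤,
        (∀ (a b : SmoothCc 𝕜 E M 𝕜) (x y : 𝔤),
          ω (SmoothCc.smulVec a x) (SmoothCc.smulVec b y) =
            maierValue 𝕜 (SmoothCc 𝕜 E M 𝕜) 𝔤 a b x y) ∧
        IsUniversalCocycle.{w} ω) := by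
  -- Cartan's criterion enters through instance inference: semisimplicity over `𝕜` supplies the
  -- nondegenerate Killing form used above.
  refine ⟨fun A _ _ _ _ _ _ _ _ _ _ hA => isUniversalCocycle_maierCocycle hA,
    fun E _ _ _ M _ _ _ _ _ => ⟨⟨inferInstance, inferInstance,
      SmoothCc.isLimitOfUnitalSubalgebras⟩, SmoothCc.exists_isUniversalCocycle⟩⟩
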